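/- **Setting.** Consider $N\ge 1$ subsystems, $i\in\{1,\dots,N\}$, with states $u_i(t,x)\in\mathbb R^{n_i}$, $v_i(t,x)\in\mathbb R^{m_i}$ ($n_i,m_i\ge1$), $t\ge0$, $x\in[0,1]$, coupled in a chain: $$\partial_t\begin{pmatrix}u_i\\v_i\end{pmatrix}+\Lambda_i\,\partial_x\begin{pmatrix}u_i\\v_i\end{pmatrix}=\Sigma_i(x)\begin{pmatrix}u_i\\v_i\end{pmatrix},\qquad \Lambda_i=\mathrm{diag}(\Lambda_i^+,-\Lambda_i^-),$$ $$u_i(t,0)=Q_{i,i}v_i(t,0)+Q_{i,i-1}u_{i-1}(t,1),\qquad v_i(t,1)=R_{i,i}u_i(t,1)+R_{i,i+1}v_{i+1}(t,0),$$ where $Q_{1,0}u_0(t,1)=U(t)$ is the control input and the term $R_{N,N+1}v_{N+1}$ is absent. Here $\Lambda_i^+=\mathrm{diag}(\lambda_i^1,\dots,\lambda_i^{n_i})$ and $\Lambda_i^-=\mathrm{diag}(\mu_i^1,\dots,\mu_i^{m_i})$ with $0<\lambda_i^1<\dots<\lambda_i^{n_i}$ and $0<\mu_i^1<\dots<\mu_i^{m_i}$;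 the matrix $\Sigma_i=\begin{pmatrix}\Sigma_i^{++}&\Sigma_i^{+-}\\ \Sigma_i^{-+}&\Sigma_i^{--}\end{pmatrix}$ is continuous on $[0,1]$ with zero diagonal, and the $Q$'s and $R$'s are constant. Solutions are continuous functions on $[0,\infty)\times[0,1]$ that satisfy the boundary conditions for $t\ge 0$ and the equations integrated along characteristic lines (in particular, $H^1$ solutions). **Kernels.** For $i<N$ let $K_i=\begin{pmatrix}K_i^{uu}&K_i^{uv}\\K_i^{vu}&K_i^{vv}\end{pmatrix}$ be a piecewise continuous solution (along characteristic lines) on $0\le x\le y\le1$ of $$\Lambda_i\partial_xK_i+\partial_yK_i\Lambda_i=-K_i\Sigma_i(y)+\begin{pmatrix}G_i(x)&0\\0&0\end{pmatrix}K_i,$$ $$\Lambda_iK_i(x,x)-K_i(x,x)\Lambda_i=\Sigma_i(x)-\begin{pmatrix}G_i(x)&0\\0&0\end{pmatrix},\qquad K_i^{uu}(x,1)\Lambda_i^+=K_i^{uv}(x,1)\Lambda_i^-R_{i,i}\qquad(0\le x<1),$$ where $G_i$ is the strictly upper-triangular matrix with $(G_i(x))_{k\ell}=(\Sigma_i^{++}(x))_{k\ell}+(\lambda_i^\ell-\lambda_i^k)(K_i^{uu}(x,x))_{k\ell}$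 for $k\le\ell$. Let $F_i$ be a piecewise continuous solution (along characteristic lines) on $0\le x\le 1$, $0\le y\le x/\lambda_i^1$ of $$\Lambda_i^+\partial_xF_i+\partial_yF_i=G_i(x)F_i,\qquad F_i(x,0)=-K_i^{uv}(x,1)\Lambda_i^-R_{i,i+1},\qquad (F_i(x,x/\lambda_i^1))_{k\ell}=0\ \ (k>1,\ x>0).$$ Define $$\alpha_i(t,x)=u_i(t,x)+\int_0^{x/\lambda_i^1}F_i(x,y)v_{i+1}(t-y,0)\,dy+\int_x^1\big(K_i^{uu}(x,y)u_i(t,y)+K_i^{uv}(x,y)v_i(t,y)\big)dy,$$ $$\beta_i(t,x)=v_i(t,x)+\int_x^1\big(K_i^{vu}(x,y)u_i(t,y)+K_i^{vv}(x,y)v_i(t,y)\big)dy .$$ **Tracking law.** Let $D_i=\sum_{j<i}1/\lambda_j^1$. The virtual input of subsystem $i$ is $\hat U_i(t)=Q_{i,i-1}\alpha_{i-1}(t+D_i,1)$ for $i\ge 2$, and $\hat U_1=U$. For a reference $\zeta_i$, a matrix function $g$ on $\mathbb R$, and functions $P_{u_i},P_{v_i}$, the tracking law is $$\hat U_i(t)=\hat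 U_i^{tr}(t)-Q_{i,i}P_{v_i}(t,0)-\int_0^1\big(K_i^{uu}(0,y)P_{u_i}(t,y)+K_i^{uv}(0,y)P_{v_i}(t,y)\big)dy+Q_{i,i-1}\int_0^{1/\lambda_{i-1}^1}F_{i-1}(1,y)P_{v_i}(t-y,0)\,dy$$ (no last term if $i=1$), with $$(\hat U_i^{tr}(t))_j=\zeta_i^j\Big(t+D_i+\tfrac1{\lambda_i^j}\Big)+\sum_{\ell=j+1}^{n_i}\int_0^{1/\lambda_i^j}g_{j\ell}(\nu)\,\zeta_i^\ell(t+D_i+\nu)\,d\nu .$$ Write $\|\phi_{[t]}\|_{L^2_r}^2=\big|\int_{-r}^0|\phi(t+\theta)|^2d\theta\big|$ for $r\in\mathbb R$ (a past window if $r>0$, a future window if $r<0$). **Statement.** Let $1\le i\le N-1$. There exist constants $\kappa_i>0$ and $0<\eta_i\le\frac1{\lambda_i^1}+\frac1{\mu_i^1}$ and a bounded measurable matrix function $g$, depending only on the chain, the kernels and $i$, such that for every $t_0>0$, every control input $U$, every solution of the chain and every continuous $\zeta_i:[0,\infty)\to\mathbb R^{n_i}$ (in particular every $H^1$ one): (a)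 If $\alpha_i(t,1)=\zeta_i(t)$ for all $t>t_0+\frac1{\lambda_i^1}$, then for all $t>t_0+\frac1{\lambda_i^1}+\frac1{\mu_i^1}$ the functions $\alpha_i(t,\cdot),\beta_i(t,\cdot)$ are in $L^2([0,1])$ and $$\|(\alpha_i(t,\cdot),\beta_i(t,\cdot))\|_{L^2}^2\le\kappa_i\Big(\|(\zeta_i)_{[t]}\|^2_{L^2_{\eta_i}}+\|(\zeta_i)_{[t]}\|^2_{L^2_{-\eta_i}}+\|(v_{i+1}(\cdot,0))_{[t]}\|^2_{L^2_{\eta_i}}\Big).\qquad(*)$$ (b) Suppose that for all $t>t_0$ the tracking law with this $g$ is applied and the predictions are exact, i.e. $P_{u_i}(t,x)=u_i(t+D_i,x)$ and $P_{v_i}(t,x)=v_i(t+D_i,x)$ for $x\in[0,1]$, and, for $i\ge2$, $P_{v_i}(t-y,0)=v_i(t-y+D_i,0)$ for $0\le y\le1/\lambda_{i-1}^1$. Then $\alpha_i(t,1)=\zeta_i(t)$ for all $t>t_0+D_i+\frac1{\lambda_i^1}$, and $(*)$, with both $L^2$ memberships, holds for all $t>t_0+D_i+\frac1{\lambda_i^1}+\frac1{\mu_i^1}$.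 -/

import Mathlib

open Set MeasureTheory

noncomputable section

/-- Data of a chain of `N` interconnected linear hyperbolic subsystems.
Subsystems are numbered `0, …, N - 1` and only the data of index `i < N` is meaningful.
Subsystem `i` has `n i` rightward and `m i` leftward propagating states. The in-domain coupling
matrix `Sig i` has the four blocks `Σ⁺⁺, Σ⁺⁻, Σ⁻⁺, Σ⁻⁻`. The matrices `Q i`, `Qc i`, `R i`, `Rc i`
are `Q_{i,i}`, `Q_{i+1,i}`, `R_{i,i}`, `R_{i,i+1}`. -/
structure HyperbolicChain where
  N : ℕ
  n : ℕ → ℕ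
  m : ℕ → ℕ
  n_ne : ∀ i, NeZero (n i)
  m_ne : ∀ i, NeZero (m i)
  lam : (i : ℕ) → Fin (n i) → ℝ
  mu : (i : ℕ) → Fin (m i) → ℝ
  lam_pos : ∀ i < N, ∀ j, 0 < lam i j
  lam_mono : ∀ i < N, StrictMono (lam i)
  mu_pos : ∀ i < N, ∀ j, 0 < mu i j
  mu_mono : ∀ i < N, StrictMono (mu i)
  Sig : (i : ℕ) → ℝ → Matrix (Fin (n i) ⊕ Fin (m i)) (Fin (n i) ⊕ Fin (m i)) ℝ
  Sig_cont : ∀ i < N, ContinuousOn (Sig i) (Icc 0 1)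
  Sig_diag : ∀ i < N, ∀ x ∈ Icc (0 : ℝ) 1, ∀ k, Sig i x k k = 0
  Q : (i : ℕ) → Matrix (Fin (n i)) (Fin (m i)) ℝ
  Qc : (i : ℕ) → Matrix (Fin (n (i + 1))) (Fin (n i)) ℝ
  R : (i : ℕ) → Matrix (Fin (m i)) (Fin (n i)) ℝ
  Rc : (i : ℕ) → Matrix (Fin (m i)) (Fin (m (i + 1))) ℝ

attribute [instance] HyperbolicChain.n_ne HyperbolicChain.m_ne

/-- A real function of two variables is piecewise continuous on `D` if `D` is covered by finitely
many Borel pieces with negligible boundary, on each of which the function agrees with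
a function that is continuous up to the boundary of the piece (and hence extends continuously
to the plane). -/
def PiecewiseContinuousOn (f : ℝ × ℝ → ℝ) (D : Set (ℝ × ℝ)) : Prop :=
  ∃ (p : ℕ) (A : Fin p → Set (ℝ × ℝ)) (g : Fin p → ℝ × ℝ → ℝ),
    (∀ k, MeasurableSet (A k) ∧ volume (frontier (A k)) = 0 ∧ Continuous (g k)) ∧
    (D ⊆ ⋃ k, A k) ∧ ∀ k, EqOn f (g k) (A k ∩ D)

/-- The triangle `{(x, y) : 0 ≤ x ≤ y ≤ 1}`. -/
def upperTriangle : Set (ℝ × ℝ) := {p | 0 ≤ p.1 ∧ p.1 ≤ p.2 ∧ p.2 ≤ 1}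

/-- The norm `‖φ_[t]‖_{L²_r} = |∫_{-r}^0 φ(t+θ)ᵀ φ(t+θ) dθ|^{1/2}`, for a real `r` of any sign:
a past window of length `r` if `r > 0`, a future window of length `-r` if `r < 0`. -/
def windowNorm {d : ℕ} (r : ℝ) (φ : ℝ → Fin d → ℝ) (t : ℝ) : ℝ :=
  Real.sqrt |∫ θ in (-r)..0, φ (t + θ) ⬝ᵥ φ (t + θ)|

/-- The square of the `L²([0,1])` norm of a vector-valued function: the sum of the squared
`L²` norms of its components. -/
def l2NormSq {ι : Type} [Fintype ι] (f : ℝ → ι → ℝ) : ℝ :=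
  ∑ k, ∫ x in (0 : ℝ)..1, (f x k) ^ 2

namespace HyperbolicChain

variable (S : HyperbolicChain)

/-- Indices of the components of the state `(u_i, v_i)`. -/
abbrev Idx (i : ℕ) : Type := Fin (S.n i) ⊕ Fin (S.m i)

/-- Signed transport velocities: the diagonal of `Λ_i = diag(Λ_i⁺, -Λ_i⁻)`. -/
def vel (i : ℕ) : S.Idx i → ℝ := Sum.elim (S.lam i) (fun j => -S.mu i j)

/-- The slowest rightward velocity `λ_i^1`. -/
def lam1 (i : ℕ) : ℝ := S.lam i 0

/-- The slowest leftward velocity `μ_i^1`. -/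
def mu1 (i : ℕ) : ℝ := S.mu i 0

/-- The sum of the `1 / λ_j^1` over all subsystems `j` upstream of `i`. -/
def delay (i : ℕ) : ℝ := ∑ j ∈ Finset.range i, 1 / S.lam1 j

/-- A family of states `w i t x = (u_i(t,x), v_i(t,x))`. -/
abbrev State : Type := (i : ℕ) → ℝ → ℝ → S.Idx i → ℝ

variable {S} in
/-- The rightward propagating component `u_i`. -/
def u (w : S.State) (i : ℕ) (t x : ℝ) : Fin (S.n i) → ℝ := fun j => w i t x (Sum.inl j)

variable {S} in
/-- The leftward propagating component `v_i`. -/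
def v (w : S.State) (i : ℕ) (t x : ℝ) : Fin (S.m i) → ℝ := fun j => w i t x (Sum.inr j)

/-- The action of the upstream side on the left boundary of subsystem `i`: the control input
`U(t)` for the first subsystem, `Q_{i,i-1} u_{i-1}(t,1)` for the others. -/
def inflow (U : ℝ → Fin (S.n 0) → ℝ) (w : S.State) : (i : ℕ) → ℝ → Fin (S.n i) → ℝ
  | 0, t => U t
  | k + 1, t => (S.Qc k).mulVec (u w k t 1)

/-- `w` is a continuous solution of the chain with control input `U`. The equations
`∂ₜ w_i + Λ_i ∂ₓ w_i = Σ_i(x) w_i` are understood in the broad sense, that is, integrated along the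
characteristic lines; every `H¹` solution and every classical solution is of this kind. -/
structure IsSolution (U : ℝ → Fin (S.n 0) → ℝ) (w : S.State) : Prop where
  cont : ∀ i < S.N, ContinuousOn (fun p : ℝ × ℝ => w i p.1 p.2) (Ici 0 ×ˢ Icc 0 1)
  transport : ∀ i < S.N, ∀ k : S.Idx i, ∀ t x h : ℝ, 0 ≤ t → 0 ≤ h → x ∈ Icc (0 : ℝ) 1 →
    x + S.vel i k * h ∈ Icc (0 : ℝ) 1 →
    w i (t + h) (x + S.vel i k * h) k = w i t x k +
      ∫ r in (0 : ℝ)..h,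
        ((S.Sig i (x + S.vel i k * r)).mulVec (w i (t + r) (x + S.vel i k * r))) k
  left_bc : ∀ i < S.N, ∀ t : ℝ, 0 ≤ t →
    u w i t 0 = (S.Q i).mulVec (v w i t 0) + S.inflow U w i t
  right_bc : ∀ i, i + 1 < S.N → ∀ t : ℝ, 0 ≤ t →
    v w i t 1 = (S.R i).mulVec (u w i t 1) + (S.Rc i).mulVec (v w (i + 1) t 0)
  last_bc : ∀ i, i + 1 = S.N → ∀ t : ℝ, 0 ≤ t →
    v w i t 1 = (S.R i).mulVec (u w i t 1)

/-- The upper-triangular matrix `G_i(x)` obtained from the trace of `K_i^{uu}` on the diagonal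
(its diagonal vanishes because that of `Σ_i` does). -/
def G (i : ℕ) (K : ℝ → ℝ → Matrix (S.Idx i) (S.Idx i) ℝ) (x : ℝ) :
    Matrix (Fin (S.n i)) (Fin (S.n i)) ℝ :=
  Matrix.of fun k l =>
    if k ≤ l then
      S.Sig i x (Sum.inl k) (Sum.inl l) +
        (S.lam i l - S.lam i k) * K x x (Sum.inl k) (Sum.inl l)
    else 0

/-- The block matrix with upper left block `G_i(x)` and zeros elsewhere. -/
def Gblock (i : ℕ) (K : ℝ → ℝ → Matrix (S.Idx i) (S.Idx i) ℝ) (x : ℝ) :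
    Matrix (S.Idx i) (S.Idx i) ℝ :=
  Matrix.fromBlocks (S.G i K x) 0 0 0

/-- `K` is a piecewise continuous solution of the kernel equations
`Λ ∂ₓK + ∂_y K Λ = -K Σ(y) + [G(x) 0; 0 0] K` on the triangle `0 ≤ x ≤ y ≤ 1` (integrated along
the characteristic lines of each entry), with
`Λ K(x,x) - K(x,x) Λ = Σ(x) - [G(x) 0; 0 0]` and `K^{uu}(x,1) Λ⁺ = K^{uv}(x,1) Λ⁻ R_{i,i}`.
The corner `x = 1`, where these two boundary conditions meet and are in general
incompatible, is left out. -/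
structure IsStateKernel (i : ℕ) (K : ℝ → ℝ → Matrix (S.Idx i) (S.Idx i) ℝ) : Prop where
  piecewise : ∀ k l, PiecewiseContinuousOn (fun p => K p.1 p.2 k l) upperTriangle
  transport : ∀ (k l : S.Idx i) (x y h : ℝ), 0 ≤ h → (x, y) ∈ upperTriangle →
    (x + S.vel i k * h, y + S.vel i l * h) ∈ upperTriangle →
    K (x + S.vel i k * h) (y + S.vel i l * h) k l = K x y k l +
      ∫ r in (0 : ℝ)..h,
        (-(K (x + S.vel i k * r) (y + S.vel i l * r) * S.Sig i (y + S.vel i l * r)) +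
          S.Gblock i K (x + S.vel i k * r) *
            K (x + S.vel i k * r) (y + S.vel i l * r)) k l
  diag_bc : ∀ x ∈ Ico (0 : ℝ) 1,
    Matrix.diagonal (S.vel i) * K x x - K x x * Matrix.diagonal (S.vel i) =
      S.Sig i x - S.Gblock i K x
  right_bc : ∀ x ∈ Ico (0 : ℝ) 1,
    (K x 1).toBlocks₁₁ * Matrix.diagonal (S.lam i) =
      (K x 1).toBlocks₁₂ * Matrix.diagonal (S.mu i) * S.R i

/-- The triangle `{(x, y) : 0 ≤ x ≤ 1, 0 ≤ y ≤ x / λ_i^1}`. -/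
def delayTriangle (i : ℕ) : Set (ℝ × ℝ) :=
  {p | 0 ≤ p.1 ∧ p.1 ≤ 1 ∧ 0 ≤ p.2 ∧ p.2 ≤ p.1 / S.lam1 i}

/-- `F` is a piecewise continuous solution of `Λ⁺ ∂ₓF + ∂_y F = G(x) F` on the triangle
`0 ≤ y ≤ x / λ_i^1` (integrated along the characteristic lines of each entry), with
`F(x,0) = -K^{uv}(x,1) Λ⁻ R_{i,i+1}`, and with `F(x, x / λ_i^1) = 0` in all rows but the first
(away from the corner `x = 0`, where the two conditions meet). -/
structure IsDelayKernel (i : ℕ) (K : ℝ → ℝ → Matrix (S.Idx i) (S.Idx i) ℝ)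
    (F : ℝ → ℝ → Matrix (Fin (S.n i)) (Fin (S.m (i + 1))) ℝ) : Prop where
  piecewise : ∀ k l, PiecewiseContinuousOn (fun p => F p.1 p.2 k l) (S.delayTriangle i)
  transport : ∀ k l (x y h : ℝ), 0 ≤ h → (x, y) ∈ S.delayTriangle i →
    (x + S.lam i k * h, y + h) ∈ S.delayTriangle i →
    F (x + S.lam i k * h) (y + h) k l = F x y k l +
      ∫ r in (0 : ℝ)..h,
        (S.G i K (x + S.lam i k * r) * F (x + S.lam i k * r) (y + r)) k l
  left_bc : ∀ x ∈ Icc (0 : ℝ) 1,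
    F x 0 = -((K x 1).toBlocks₁₂ * Matrix.diagonal (S.mu i) * S.Rc i)
  edge_bc : ∀ x ∈ Ioc (0 : ℝ) 1, ∀ k l, k ≠ 0 → F x (x / S.lam1 i) k l = 0

/-- Families of kernels `K_i`. -/
abbrev StateKernels : Type := (i : ℕ) → ℝ → ℝ → Matrix (S.Idx i) (S.Idx i) ℝ

/-- Families of kernels `F_i`. -/
abbrev DelayKernels : Type :=
  (i : ℕ) → ℝ → ℝ → Matrix (Fin (S.n i)) (Fin (S.m (i + 1))) ℝ

variable {S}

/-- The transformed state `(α_i(t,x), β_i(t,x))`: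
`α_i = u_i + ∫_0^{x/λ_i^1} F_i(x,y) v_{i+1}(t-y,0) dy + ∫_x^1 (K_i^{uu} u_i + K_i^{uv} v_i) dy`,
`β_i = v_i + ∫_x^1 (K_i^{vu} u_i + K_i^{vv} v_i) dy`. -/
def target (K : S.StateKernels) (F : S.DelayKernels) (w : S.State) (i : ℕ) (t x : ℝ) :
    S.Idx i → ℝ := fun k =>
  w i t x k + (∫ y in x..1, ((K i x y).mulVec (w i t y)) k) +
    Sum.elim
      (fun a => ∫ y in (0 : ℝ)..(x / S.lam1 i), ((F i x y).mulVec (v w (i + 1) (t - y) 0)) a)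
      (fun _ => 0) k

/-- The component `α_i` of the transformed state. -/
def alpha (K : S.StateKernels) (F : S.DelayKernels) (w : S.State) (i : ℕ) (t x : ℝ) :
    Fin (S.n i) → ℝ := fun j => target K F w i t x (Sum.inl j)

/-- The virtual input `Û_i(t) = Q_{i,i-1} α_{i-1}(t + ∑_{j<i} 1/λ_j^1, 1)` of subsystem `i`
(for the first subsystem, the control input `U(t)`). -/
def virtualInput (K : S.StateKernels) (F : S.DelayKernels) (U : ℝ → Fin (S.n 0) → ℝ)
    (w : S.State) : (i : ℕ) → ℝ → Fin (S.n i) → ℝ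
  | 0, t => U t
  | k + 1, t => (S.Qc k).mulVec (alpha K F w k (t + S.delay (k + 1)) 1)

variable (S) in
/-- The length `1/λ_{i-1}^1` of the memory of the delayed term of the control law
(`0` for the first subsystem). -/
def memory : ℕ → ℝ
  | 0 => 0
  | k + 1 => 1 / S.lam1 k

/-- The term `Q_{i,i-1} ∫_0^{1/λ_{i-1}^1} F_{i-1}(1,y) p(t-y) dy` (`0` for the first
subsystem). -/
def delayedTerm (F : S.DelayKernels) :
    (i : ℕ) → (ℝ → Fin (S.m i) → ℝ) → ℝ → Fin (S.n i) → ℝ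
  | 0, _, _ => 0
  | k + 1, p, t =>
      (S.Qc k).mulVec fun a => ∫ y in (0 : ℝ)..(1 / S.lam1 k), ((F k 1 y).mulVec (p (t - y))) a

/-- `Pu`, `Pv` are exact predictors of `u_i`, `v_i`, ahead of time by `∑_{j<i} 1/λ_j^1`, at all
times `t > t₀`, the delayed values `Pv (t - y) 0` used by the control law at such times
included. -/
def ExactPredictors (w : S.State) (i : ℕ) (t₀ : ℝ) (Pu : ℝ → ℝ → Fin (S.n i) → ℝ)
    (Pv : ℝ → ℝ → Fin (S.m i) → ℝ) : Prop :=
  ∀ t > t₀,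
    (∀ x ∈ Icc (0 : ℝ) 1, Pu t x = u w i (t + S.delay i) x ∧ Pv t x = v w i (t + S.delay i) x) ∧
    ∀ y ∈ Icc 0 (S.memory i), Pv (t - y) 0 = v w i (t - y + S.delay i) 0

variable (S) in
/-- The feedforward part of the tracking law, with `g ν = Ǧ_i(0,ν)`:
its `j`-th component at time `t` is `ζ^j(t + D + 1/λ_i^j) +
∑_{ℓ>j} ∫_0^{1/λ_i^j} g(ν)_{jℓ} ζ^ℓ(t + D + ν) dν`, where `D = ∑_{j<i} 1/λ_j^1`. -/
def feedforward (i : ℕ) (g : ℝ → Matrix (Fin (S.n i)) (Fin (S.n i)) ℝ)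
    (ζ : ℝ → Fin (S.n i) → ℝ) (t : ℝ) : Fin (S.n i) → ℝ := fun j =>
  ζ (t + S.delay i + 1 / S.lam i j) j +
    ∑ l ∈ Finset.Ioi j, ∫ ν in (0 : ℝ)..(1 / S.lam i j), g ν j l * ζ (t + S.delay i + ν) l

/-- The tracking law: `Û_i^{tr}(t) - Q_{i,i} P_v(t,0) - ∫_0^1 (K_i^{uu}(0,y) P_u(t,y) +
K_i^{uv}(0,y) P_v(t,y)) dy + Q_{i,i-1} ∫_0^{1/λ_{i-1}^1} F_{i-1}(1,y) P_v(t-y,0) dy`. -/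
def trackingLaw (K : S.StateKernels) (F : S.DelayKernels) (i : ℕ)
    (g : ℝ → Matrix (Fin (S.n i)) (Fin (S.n i)) ℝ) (ζ : ℝ → Fin (S.n i) → ℝ)
    (Pu : ℝ → ℝ → Fin (S.n i) → ℝ) (Pv : ℝ → ℝ → Fin (S.m i) → ℝ) (t : ℝ) :
    Fin (S.n i) → ℝ :=
  S.feedforward i g ζ t - (S.Q i).mulVec (Pv t 0)
    - (fun a => ∫ y in (0 : ℝ)..1, ((K i 0 y).mulVec (Sum.elim (Pu t y) (Pv t y))) (Sum.inl a))
    + delayedTerm F i (fun s => Pv s 0) t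

/-- The input-to-state estimate for subsystem `i` at time `t`: the transformed state belongs
to `L²([0,1])` and `‖(α_i, β_i)(t,·)‖²` is at most `κ` times the sum of the squared `L²` norms of
the past and future windows of `ζ` and of the past window of `v_{i+1}(·,0)`. -/
def ISSEstimate (K : S.StateKernels) (F : S.DelayKernels) (w : S.State) (i : ℕ)
    (ζ : ℝ → Fin (S.n i) → ℝ) (κ η t : ℝ) : Prop :=
  (∀ k, MemLp (fun x => target K F w i t x k) 2 (volume.restrict (Icc (0 : ℝ) 1))) ∧
  l2NormSq (fun x => target K F w i t x) ≤
    κ * ((windowNorm η ζ t) ^ 2 + (windowNorm (-η) ζ t) ^ 2 +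
      (windowNorm η (fun s => v w (i + 1) s 0) t) ^ 2)

end HyperbolicChain

end

noncomputable section

/-! The kernels decouple the rightward part of subsystem `i`. When the solution is followed along a
rightward characteristic, the Volterra integral in `K` removes the in-domain coupling except for
`G`, and leaves source terms carried by the outlet values `u_i(t,1)`, `v_i(t,1)`. The outlet
condition on `K^{uu}`, `K^{uv}` and the value of `F` at `y = 0` match the physical boundary
condition at `x = 1`, so these sources cancel against the one produced by the delayed integral in
`F`. Hence `α` solves `∂ₜα + Λ⁺∂ₓα = G(x)α` with `G` strictly upper triangular. In the leftward rows
the `G`-block vanishes, so `β` is pure transport driven by outlet values.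

Such a cascade is solved explicitly from its outflow: row `j` only sees rows `l > j`. Following its
characteristic to `x = 1` and inserting the rows already solved gives `α^j(t,x) = ζ^j(t + (1-x)/λ^j)
+ ∑_{l>j} ∫_0^{(1-x)/λ^j} k_{jl}(x,ν) ζ^l(t+ν) dν` with bounded kernels. The rows `l > j` are
faster, so their look-ahead windows fit inside that of row `j` (`exists_cascade_kernel`). The
feedforward matrix is `g(ν) = k(0,ν)`.

For (a), prescribing the outflow forces `α` to be this formula (`CascadeTransport.eq_of_outflow`),
which bounds it by the future window of `ζ`. At the outlet, `u_i` is `ζ` minus a delayed integral of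
`v_{i+1}(·,0)`, and `v_i` follows from the boundary condition. Tracing `β` back to `x = 1` then
bounds it by past windows (`exists_beta_bound`), and Cauchy–Schwarz turns the pointwise bounds into
`L²` bounds. For (b), the tracking law with exact predictions makes `α(·,0)` the trace at `x = 0` of
the explicit solution. Uniqueness from the inflow (`CascadeTransport.eq_of_inflow`) carries this to
`x = 1`, where the formula reduces to `ζ`, and (a) applies.

Kernels and solutions are only known in integrated form along characteristics, so no derivative is
available. The transformed equations come from an integrated Leibniz rule on moving intervals
(`transported_product_identity`), proved by Fubini. -/

/-! ### Fubini, measurability and the product rule for bounded measurable integrands -/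

theorem intervalIntegrable_of_bound {f : ℝ → ℝ} {a b C : ℝ} (hf : Measurable f)
    (hC : ∀ x ∈ uIcc a b, |f x| ≤ C) : IntervalIntegrable f volume a b := by
  rw [intervalIntegrable_iff]
  refine Measure.integrableOn_of_bounded (M := C) (by simp) hf.aestronglyMeasurable ?_
  refine (ae_restrict_iff' measurableSet_uIoc).2 (.of_forall fun x hx => ?_)
  exact hC x (uIoc_subset_uIcc hx)

theorem intervalIntegral_swap_of_bound {F : ℝ → ℝ → ℝ} {a b c d C : ℝ}
    (hF : Measurable (Function.uncurry F))
    (hC : ∀ r ∈ uIcc a b, ∀ s ∈ uIcc c d, |F r s| ≤ C) :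
    ∫ r in a..b, ∫ s in c..d, F r s = ∫ s in c..d, ∫ r in a..b, F r s := by
  have key : Integrable (Function.uncurry F)
      ((volume.restrict (uIoc a b)).prod (volume.restrict (uIoc c d))) := by
    rw [Measure.prod_restrict]
    refine Measure.integrableOn_of_bounded (M := C) ?_ hF.aestronglyMeasurable ?_
    · rw [← Measure.volume_eq_prod, Measure.volume_eq_prod, Measure.prod_prod]
      exact ENNReal.mul_ne_top (by simp) (by simp)
    · refine (ae_restrict_iff' (measurableSet_uIoc.prod measurableSet_uIoc)).2
        (.of_forall fun x hx => ?_)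
      exact hC x.1 (uIoc_subset_uIcc hx.1) x.2 (uIoc_subset_uIcc hx.2)
  simp only [intervalIntegral.intervalIntegral_eq_integral_uIoc, integral_smul, smul_smul]
  rw [integral_integral_swap key, mul_comm]

theorem measurable_intervalIntegral_param {X : Type*} [MeasurableSpace X] {f : X → ℝ → ℝ}
    {p q : X → ℝ} (hf : Measurable (Function.uncurry f)) (hp : Measurable p) (hq : Measurable q) :
    Measurable fun r => ∫ y in p r..q r, f r y := by
  have aux : ∀ {p q : X → ℝ}, Measurable p → Measurable q →
      Measurable fun r => ∫ y in Ioc (p r) (q r), f r y := by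
    intro p q hp hq
    have hs : MeasurableSet {z : X × ℝ | p z.1 < z.2 ∧ z.2 ≤ q z.1} :=
      (measurableSet_lt (hp.comp measurable_fst) measurable_snd).inter
        (measurableSet_le measurable_snd (hq.comp measurable_fst))
    have := ((hf.indicator hs).stronglyMeasurable.integral_prod_right' (ν := volume)).measurable
    convert this using 2 with r
    rw [← integral_indicator measurableSet_Ioc]
    rfl
  simp only [intervalIntegral]
  exact (aux hp hq).sub (aux hq hp)

theorem abs_intervalIntegral_le {f : ℝ → ℝ} {a b C : ℝ} (h : ∀ x ∈ uIcc a b, |f x| ≤ C) :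
    |∫ x in a..b, f x| ≤ C * |b - a| := by
  rw [← Real.norm_eq_abs]
  exact intervalIntegral.norm_integral_le_of_norm_le_const fun x hx => h x (uIoc_subset_uIcc hx)

/-- Integrals over sub-intervals, as integrals of a truncated function. -/
theorem intervalIntegral_eq_indicator {f : ℝ → ℝ} {a b c d : ℝ} (hac : a ≤ c) (hcd : c ≤ d)
    (hdb : d ≤ b) : ∫ x in c..d, f x = ∫ x in a..b, (Ioc c d).indicator f x := by
  rw [intervalIntegral.integral_of_le hcd, intervalIntegral.integral_of_le (hac.trans (hcd.trans hdb)),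
    setIntegral_indicator measurableSet_Ioc, inter_eq_right.2 (Ioc_subset_Ioc hac hdb)]

theorem intervalIntegral_triangle_swap {F : ℝ → ℝ → ℝ} {h C : ℝ} (h0 : 0 ≤ h)
    (hF : Measurable (Function.uncurry F)) (hC : ∀ r s, |F r s| ≤ C) :
    ∫ r in (0 : ℝ)..h, ∫ s in r..h, F r s = ∫ s in (0 : ℝ)..h, ∫ r in (0 : ℝ)..s, F r s := by
  have hC0 : 0 ≤ C := (abs_nonneg _).trans (hC 0 0)
  have hs : MeasurableSet {z : ℝ × ℝ | z.1 ≤ z.2} := measurableSet_le measurable_fst measurable_snd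
  let F' : ℝ → ℝ → ℝ := fun r s => {z : ℝ × ℝ | z.1 ≤ z.2}.indicator (Function.uncurry F) (r, s)
  have e1 : ∫ r in (0 : ℝ)..h, ∫ s in r..h, F r s = ∫ r in (0 : ℝ)..h, ∫ s in (0 : ℝ)..h, F' r s := by
    refine intervalIntegral.integral_congr fun r hr => ?_
    rw [uIcc_of_le h0] at hr
    rw [intervalIntegral_eq_indicator hr.1 hr.2 le_rfl]
    refine intervalIntegral.integral_congr_ae ?_
    filter_upwards [Measure.ae_ne volume r] with s hsr hs
    rw [uIoc_of_le h0] at hs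
    simp only [F', indicator, mem_Ioc, mem_ofPred_eq, Function.uncurry, hs.2, and_true]
    rcases lt_or_gt_of_ne hsr with hlt | hlt
    · simp [not_lt.2 hlt.le, not_le.2 hlt]
    · simp [hlt, hlt.le]
  have e2 : ∫ s in (0 : ℝ)..h, ∫ r in (0 : ℝ)..s, F r s =
      ∫ s in (0 : ℝ)..h, ∫ r in (0 : ℝ)..h, F' r s := by
    refine intervalIntegral.integral_congr fun s hs => ?_
    rw [uIcc_of_le h0] at hs
    rw [intervalIntegral_eq_indicator le_rfl hs.1 hs.2]
    refine intervalIntegral.integral_congr_ae (.of_forall fun r hr => ?_)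
    rw [uIoc_of_le h0] at hr
    simp [F', indicator, Function.uncurry, hr.1]
  rw [e1, e2]
  refine intervalIntegral_swap_of_bound (C := C) (hF.indicator hs) fun r _ s _ => ?_
  simp only [F', indicator]
  split_ifs
  · exact hC r s
  · simpa using hC0

/-- Product rule for two Lipschitz primitives, obtained from Fubini on a triangle; no
differentiation is involved. -/
theorem mul_eq_add_integral {A B a b : ℝ → ℝ} {s C : ℝ} (hs : 0 ≤ s) (ha : Measurable a)
    (hb : Measurable b) (haC : ∀ r, |a r| ≤ C) (hbC : ∀ r, |b r| ≤ C)
    (hA : ∀ r ∈ Icc 0 s, A r = A 0 + ∫ σ in (0 : ℝ)..r, a σ)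
    (hB : ∀ r ∈ Icc 0 s, B r = B 0 + ∫ σ in (0 : ℝ)..r, b σ) :
    A s * B s = A 0 * B 0 + ∫ r in (0 : ℝ)..s, (a r * B r + A r * b r) := by
  have hC0 : 0 ≤ C := (abs_nonneg _).trans (haC 0)
  have ia : ∀ x y, IntervalIntegrable a volume x y := fun x y =>
    intervalIntegrable_of_bound ha fun r _ => haC r
  have ib : ∀ x y, IntervalIntegrable b volume x y := fun x y =>
    intervalIntegrable_of_bound hb fun r _ => hbC r
  have cA : Continuous fun r => ∫ σ in (0 : ℝ)..r, a σ :=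
    intervalIntegral.continuous_primitive ia 0
  have cB : Continuous fun r => ∫ σ in (0 : ℝ)..r, b σ :=
    intervalIntegral.continuous_primitive ib 0
  have e : ∫ r in (0 : ℝ)..s, (a r * B r + A r * b r) =
      ∫ r in (0 : ℝ)..s, ((a r * B 0 + a r * ∫ σ in (0 : ℝ)..r, b σ) +
        (A 0 * b r + (∫ σ in (0 : ℝ)..r, a σ) * b r)) := by
    refine intervalIntegral.integral_congr fun r hr => ?_
    rw [uIcc_of_le hs] at hr
    rw [hA r hr, hB r hr]
    ring
  have i1 := (ia 0 s).mul_const (B 0)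
  have i2 := (ia 0 s).mul_continuousOn cB.continuousOn
  have i3 := (ib 0 s).const_mul (A 0)
  have i4 := (ib 0 s).continuousOn_mul cA.continuousOn
  rw [e, intervalIntegral.integral_add (i1.add i2) (i3.add i4), intervalIntegral.integral_add i1 i2,
    intervalIntegral.integral_add i3 i4, intervalIntegral.integral_mul_const,
    intervalIntegral.integral_const_mul, hA s ⟨hs, le_rfl⟩, hB s ⟨hs, le_rfl⟩]
  have tri : ∫ r in (0 : ℝ)..s, (∫ σ in (0 : ℝ)..r, a σ) * b r =
      ∫ r in (0 : ℝ)..s, a r * ∫ σ in r..s, b σ := by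
    have := intervalIntegral_triangle_swap (F := fun r σ => a r * b σ) (C := C * C) hs
      ((ha.comp measurable_fst).mul (hb.comp measurable_snd)) fun r σ => by
        rw [abs_mul]
        exact mul_le_mul (haC r) (hbC σ) (abs_nonneg _) hC0
    simp only [intervalIntegral.integral_const_mul, intervalIntegral.integral_mul_const] at this
    exact this.symm
  have i5 : IntervalIntegrable (fun r => a r * ∫ σ in r..s, b σ) volume 0 s := by
    have : (fun r => a r * ∫ σ in r..s, b σ) =
        fun r => a r * ((∫ σ in (0 : ℝ)..s, b σ) - ∫ σ in (0 : ℝ)..r, b σ) := by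
      funext r
      rw [intervalIntegral.integral_interval_sub_left (ib _ _) (ib _ _)]
    rw [this]
    exact (ia 0 s).mul_continuousOn (continuous_const.sub cB).continuousOn
  -- The square `[0, s]²` is the union of its two triangles.
  have tot : (∫ r in (0 : ℝ)..s, a r * ∫ σ in (0 : ℝ)..r, b σ) +
      (∫ r in (0 : ℝ)..s, a r * ∫ σ in r..s, b σ) =
      (∫ r in (0 : ℝ)..s, a r) * ∫ r in (0 : ℝ)..s, b r := by
    rw [← intervalIntegral.integral_add i2 i5, ← intervalIntegral.integral_mul_const]
    refine intervalIntegral.integral_congr fun r _ => ?_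
    rw [← mul_add, intervalIntegral.integral_add_adjacent_intervals (ib _ _) (ib _ _)]
  rw [tri]
  linear_combination -tot

/-! ### Leibniz rule for integrals over moving intervals -/

theorem exists_affine_bound (p₀ p₁ q₀ q₁ h : ℝ) :
    ∃ L, ∀ r ∈ uIcc 0 h, |(q₀ + q₁ * r) - (p₀ + p₁ * r)| ≤ L := by
  have : ContinuousOn (fun r : ℝ => (q₀ + q₁ * r) - (p₀ + p₁ * r)) (uIcc 0 h) := by fun_prop
  exact isCompact_uIcc.exists_bound_of_continuousOn this

theorem measurable_section {f : ℝ → ℝ → ℝ} (hf : Measurable (Function.uncurry f)) {X : Type*}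
    [MeasurableSpace X] {p q : X → ℝ} (hp : Measurable p) (hq : Measurable q) :
    Measurable fun x => f (p x) (q x) :=
  hf.comp (hp.prodMk hq)

/-- Contribution of one moving endpoint. Parametrising the swept interval by `y = q₀ + q₁ r` turns
its integral at time `h` into an integral over the time `r` at which the endpoint passes `y`;
transporting `φ` from `r` to `h` leaves a triangle of values of `ψ`, and Fubini reorders it. -/
theorem strip_side {φ ψ : ℝ → ℝ → ℝ} {h q₀ q₁ C : ℝ} (h0 : 0 ≤ h)
    (hφ : Measurable (Function.uncurry φ)) (hψ : Measurable (Function.uncurry ψ))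
    (hφC : ∀ r y, |φ r y| ≤ C) (hψC : ∀ r y, |ψ r y| ≤ C)
    (hT : ∀ y, ∀ r ∈ Icc 0 h, φ r y = φ 0 y + ∫ σ in (0 : ℝ)..r, ψ σ y) :
    IntervalIntegrable (fun r => q₁ * φ r (q₀ + q₁ * r) + ∫ y in q₀..(q₀ + q₁ * r), ψ r y)
      volume 0 h ∧
    ∫ y in q₀..(q₀ + q₁ * h), φ h y =
      ∫ r in (0 : ℝ)..h, (q₁ * φ r (q₀ + q₁ * r) + ∫ y in q₀..(q₀ + q₁ * r), ψ r y) := by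
  have hC0 : 0 ≤ C := (abs_nonneg _).trans (hφC 0 0)
  have iψ : ∀ y a b, IntervalIntegrable (fun σ => ψ σ y) volume a b := fun y a b =>
    intervalIntegrable_of_bound (measurable_section hψ measurable_id measurable_const)
      fun r _ => hψC r y
  have hm : Measurable fun r : ℝ => q₀ + q₁ * r := by fun_prop
  have i1 : IntervalIntegrable (fun r => q₁ * φ r (q₀ + q₁ * r)) volume 0 h :=
    (intervalIntegrable_of_bound (measurable_section hφ measurable_id hm)
      fun r _ => hφC r _).const_mul q₁
  obtain ⟨L, hL⟩ := exists_affine_bound q₀ 0 q₀ q₁ h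
  have i2 : IntervalIntegrable (fun r => ∫ y in q₀..(q₀ + q₁ * r), ψ r y) volume 0 h := by
    refine intervalIntegrable_of_bound (C := C * L)
      (measurable_intervalIntegral_param hψ measurable_const hm) fun r hr => ?_
    refine (abs_intervalIntegral_le fun y _ => hψC r y).trans ?_
    have := hL r hr
    rw [zero_mul, add_zero] at this
    gcongr
  refine ⟨i1.add i2, ?_⟩
  have e1 : ∫ y in q₀..(q₀ + q₁ * h), φ h y = q₁ * ∫ r in (0 : ℝ)..h, φ h (q₁ * r + q₀) := by
    have := intervalIntegral.smul_integral_comp_mul_add (a := 0) (b := h) (fun y => φ h y) q₁ q₀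
    rw [smul_eq_mul] at this
    rw [this]
    congr 1 <;> ring
  have e2 : ∫ r in (0 : ℝ)..h, φ h (q₁ * r + q₀) =
      (∫ r in (0 : ℝ)..h, φ r (q₀ + q₁ * r)) +
        ∫ r in (0 : ℝ)..h, ∫ σ in r..h, ψ σ (q₀ + q₁ * r) := by
    have j : IntervalIntegrable (fun r => ∫ σ in r..h, ψ σ (q₀ + q₁ * r)) volume 0 h := by
      refine intervalIntegrable_of_bound (C := C * h)
        (measurable_intervalIntegral_param (f := fun r σ => ψ σ (q₀ + q₁ * r))
          (measurable_section hψ measurable_snd (hm.comp measurable_fst)) measurable_id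
          measurable_const) fun r hr => ?_
      refine (abs_intervalIntegral_le fun y _ => hψC _ _).trans ?_
      rw [uIcc_of_le h0] at hr
      rw [abs_of_nonneg (by linarith [hr.2])]
      exact mul_le_mul_of_nonneg_left (by linarith [hr.1]) hC0
    have i0 : IntervalIntegrable (fun r => φ r (q₀ + q₁ * r)) volume 0 h :=
      intervalIntegrable_of_bound (measurable_section hφ measurable_id hm) fun r _ => hφC r _
    rw [← intervalIntegral.integral_add i0 j]
    refine intervalIntegral.integral_congr fun r hr => ?_
    rw [uIcc_of_le h0] at hr
    simp only [add_comm (q₁ * r) q₀]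
    rw [hT _ h ⟨h0, le_rfl⟩, hT _ r hr, add_assoc,
      intervalIntegral.integral_add_adjacent_intervals (iψ _ _ _) (iψ _ _ _)]
  rw [e1, e2, intervalIntegral.integral_add i1 i2, intervalIntegral.integral_const_mul, mul_add,
    intervalIntegral_triangle_swap (F := fun r σ => ψ σ (q₀ + q₁ * r)) h0
      (measurable_section hψ measurable_snd (hm.comp measurable_fst)) (fun _ _ => hψC _ _),
    ← intervalIntegral.integral_const_mul q₁ (fun s => ∫ r in (0 : ℝ)..s, ψ s (q₀ + q₁ * r))]
  congr 1
  refine intervalIntegral.integral_congr fun s _ => ?_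
  have := intervalIntegral.smul_integral_comp_mul_add (a := 0) (b := s) (fun y => ψ s y) q₁ q₀
  rw [smul_eq_mul] at this
  simp only [add_comm q₀]
  rw [this]
  congr 1
  ring

/-- The moving interval is the fixed interval `[p₀, q₀]` plus the part swept by the right end minus
the part swept by the left end; the fixed part is plain Fubini. -/
theorem strip_identity {φ ψ : ℝ → ℝ → ℝ} {h p₀ p₁ q₀ q₁ C : ℝ} (h0 : 0 ≤ h)
    (hφ : Measurable (Function.uncurry φ)) (hψ : Measurable (Function.uncurry ψ))
    (hφC : ∀ r y, |φ r y| ≤ C) (hψC : ∀ r y, |ψ r y| ≤ C)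
    (hT : ∀ y, ∀ r ∈ Icc 0 h, φ r y = φ 0 y + ∫ σ in (0 : ℝ)..r, ψ σ y) :
    IntervalIntegrable (fun r => (∫ y in (p₀ + p₁ * r)..(q₀ + q₁ * r), ψ r y)
      + (q₁ * φ r (q₀ + q₁ * r) - p₁ * φ r (p₀ + p₁ * r))) volume 0 h ∧
    ∫ y in (p₀ + p₁ * h)..(q₀ + q₁ * h), φ h y = (∫ y in p₀..q₀, φ 0 y) +
      ∫ r in (0 : ℝ)..h, ((∫ y in (p₀ + p₁ * r)..(q₀ + q₁ * r), ψ r y)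
        + (q₁ * φ r (q₀ + q₁ * r) - p₁ * φ r (p₀ + p₁ * r))) := by
  have iφ : ∀ r a b, IntervalIntegrable (φ r) volume a b := fun r a b =>
    intervalIntegrable_of_bound (measurable_section hφ measurable_const measurable_id)
      fun y _ => hφC r y
  have iψ : ∀ r a b, IntervalIntegrable (ψ r) volume a b := fun r a b =>
    intervalIntegrable_of_bound (measurable_section hψ measurable_const measurable_id)
      fun y _ => hψC r y
  obtain ⟨jp, ep⟩ := strip_side (q₀ := p₀) (q₁ := p₁) h0 hφ hψ hφC hψC hT
  obtain ⟨jq, eq⟩ := strip_side (q₀ := q₀) (q₁ := q₁) h0 hφ hψ hφC hψC hT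
  have j0 : IntervalIntegrable (fun r => ∫ y in p₀..q₀, ψ r y) volume 0 h :=
    intervalIntegrable_of_bound
      (measurable_intervalIntegral_param hψ measurable_const measurable_const)
      fun r _ => abs_intervalIntegral_le fun y _ => hψC r y
  have e0 : ∫ y in p₀..q₀, φ h y =
      (∫ y in p₀..q₀, φ 0 y) + ∫ r in (0 : ℝ)..h, ∫ y in p₀..q₀, ψ r y := by
    rw [intervalIntegral_swap_of_bound hψ fun r _ y _ => hψC r y,
      ← intervalIntegral.integral_add (iφ _ _ _)]
    · exact intervalIntegral.integral_congr fun y _ => hT y h ⟨h0, le_rfl⟩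
    · exact intervalIntegrable_of_bound
        (measurable_intervalIntegral_param (f := fun y σ => ψ σ y)
          (measurable_section hψ measurable_snd measurable_fst) measurable_const measurable_const)
        fun r _ => abs_intervalIntegral_le fun y _ => hψC y r
  have split : ∀ (f : ℝ → ℝ) (a b c d : ℝ), (∀ x y, IntervalIntegrable f volume x y) →
      ∫ y in c..d, f y = (∫ y in a..b, f y) + (∫ y in b..d, f y) - ∫ y in a..c, f y := by
    intro f a b c d hf
    rw [intervalIntegral.integral_add_adjacent_intervals (hf _ _) (hf _ _),
      intervalIntegral.integral_interval_sub_left (hf _ _) (hf _ _)]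
  have fe : (fun r => (∫ y in (p₀ + p₁ * r)..(q₀ + q₁ * r), ψ r y)
      + (q₁ * φ r (q₀ + q₁ * r) - p₁ * φ r (p₀ + p₁ * r))) = fun r =>
      ((∫ y in p₀..q₀, ψ r y) +
        (q₁ * φ r (q₀ + q₁ * r) + ∫ y in q₀..(q₀ + q₁ * r), ψ r y)) -
        (p₁ * φ r (p₀ + p₁ * r) + ∫ y in p₀..(p₀ + p₁ * r), ψ r y) := by
    funext r
    rw [split (ψ r) p₀ q₀ _ _ (iψ r)]
    ring
  rw [fe]
  refine ⟨(j0.add jq).sub jp, ?_⟩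
  rw [split (φ h) p₀ q₀ _ _ (iφ h), intervalIntegral.integral_sub (j0.add jq) jp,
    intervalIntegral.integral_add j0 jq, ep, eq, e0]
  ring

/-- On `[0, h]`, a linear inequality `d ≤ s * r` describes a closed interval
whose endpoints depend measurably on `d`. -/
theorem exists_endpoints_linear (s h : ℝ) :
    ∃ lo hi : ℝ → ℝ, Measurable lo ∧ Measurable hi ∧
      ∀ d, ∀ r ∈ Icc 0 h, (d ≤ s * r ↔ lo d ≤ r ∧ r ≤ hi d) := by
  rcases lt_trichotomy s 0 with hs | rfl | hs
  · refine ⟨fun _ => 0, fun d => d / s, by fun_prop, by fun_prop, fun d r hr => ?_⟩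
    rw [le_div_iff_of_neg hs, mul_comm]
    exact ⟨fun H => ⟨hr.1, H⟩, fun H => H.2⟩
  -- For zero slope and `d > 0` no `r` qualifies; the left endpoint `h + 1` makes the interval
  -- empty.
  · refine ⟨fun d => if d ≤ 0 then 0 else h + 1, fun _ => h,
      Measurable.ite measurableSet_Iic measurable_const measurable_const, by fun_prop,
      fun d r hr => ?_⟩
    rw [zero_mul]
    by_cases hd : d ≤ 0
    · simp [hd, hr.1, hr.2]
    · simp only [hd, if_false, false_iff]
      exact fun H => by linarith [H.1, hr.2]
  · refine ⟨fun d => d / s, fun _ => h, by fun_prop, by fun_prop, fun d r hr => ?_⟩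
    rw [div_le_iff₀ hs, mul_comm]
    exact ⟨fun H => ⟨H, hr.2⟩, fun H => H.1⟩

/-- Horizontal sections of a trapezoid are closed intervals with measurable endpoints. -/
theorem exists_endpoints_trapezoid (h p₀ p₁ q₀ q₁ : ℝ) :
    ∃ a b : ℝ → ℝ, Measurable a ∧ Measurable b ∧ (∀ y, 0 ≤ a y) ∧ (∀ y, b y ≤ h) ∧
      ∀ y, ∀ r ∈ Icc 0 h, ((p₀ + p₁ * r ≤ y ∧ y ≤ q₀ + q₁ * r) ↔ a y ≤ r ∧ r ≤ b y) := by
  obtain ⟨l₁, u₁, hl₁, hu₁, H₁⟩ := exists_endpoints_linear (-p₁) h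
  obtain ⟨l₂, u₂, hl₂, hu₂, H₂⟩ := exists_endpoints_linear q₁ h
  refine ⟨fun y => max 0 (max (l₁ (p₀ - y)) (l₂ (y - q₀))),
    fun y => min h (min (u₁ (p₀ - y)) (u₂ (y - q₀))), by fun_prop, by fun_prop,
    fun y => le_max_left _ _, fun y => min_le_left _ _, fun y r hr => ?_⟩
  have h1 := H₁ (p₀ - y) r hr
  have h2 := H₂ (y - q₀) r hr
  simp only [max_le_iff, le_min_iff]
  constructor
  · rintro ⟨ha, hb⟩
    have a1 := h1.1 (by linarith)
    have a2 := h2.1 (by linarith)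
    exact ⟨⟨hr.1, a1.1, a2.1⟩, hr.2, a1.2, a2.2⟩
  · rintro ⟨⟨_, ha, hb⟩, _, hc, hd⟩
    exact ⟨by linarith [h1.2 ⟨ha, hc⟩], by linarith [h2.2 ⟨hb, hd⟩]⟩

/-- Here transport is known only inside the trapezoid. Each horizontal section is an interval, so
`φ` can be continued to the whole strip by freezing it at the ends of the section while `ψ` is
continued by zero. The continued pair is transported everywhere, and the strip version applies. -/
theorem trapezoid_identity {φ ψ : ℝ → ℝ → ℝ} {h p₀ p₁ q₀ q₁ C : ℝ} (h0 : 0 ≤ h)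
    (hφ : Measurable (Function.uncurry φ)) (hψ : Measurable (Function.uncurry ψ))
    (hφC : ∀ r y, |φ r y| ≤ C) (hψC : ∀ r y, |ψ r y| ≤ C)
    (hpq : ∀ r ∈ Icc 0 h, p₀ + p₁ * r ≤ q₀ + q₁ * r)
    (hT : ∀ y r s, 0 ≤ r → r ≤ s → s ≤ h → y ∈ Icc (p₀ + p₁ * r) (q₀ + q₁ * r) →
      y ∈ Icc (p₀ + p₁ * s) (q₀ + q₁ * s) → φ s y = φ r y + ∫ σ in r..s, ψ σ y) :
    IntervalIntegrable (fun r => (∫ y in (p₀ + p₁ * r)..(q₀ + q₁ * r), ψ r y)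
      + (q₁ * φ r (q₀ + q₁ * r) - p₁ * φ r (p₀ + p₁ * r))) volume 0 h ∧
    ∫ y in (p₀ + p₁ * h)..(q₀ + q₁ * h), φ h y = (∫ y in p₀..q₀, φ 0 y) +
      ∫ r in (0 : ℝ)..h, ((∫ y in (p₀ + p₁ * r)..(q₀ + q₁ * r), ψ r y)
        + (q₁ * φ r (q₀ + q₁ * r) - p₁ * φ r (p₀ + p₁ * r))) := by
  have hC0 : 0 ≤ C := (abs_nonneg _).trans (hφC 0 0)
  obtain ⟨a, b, ha, hb, ha0, hbh, hab⟩ := exists_endpoints_trapezoid h p₀ p₁ q₀ q₁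
  let φ' : ℝ → ℝ → ℝ := fun r y => if a y ≤ b y then φ (max (a y) (min r (b y))) y else 0
  let ψ' : ℝ → ℝ → ℝ := fun r y => if a y ≤ r ∧ r ≤ b y then ψ r y else 0
  have hφ' : Measurable (Function.uncurry φ') :=
    Measurable.ite (measurableSet_le (ha.comp measurable_snd) (hb.comp measurable_snd))
      (measurable_section hφ ((ha.comp measurable_snd).max
        (measurable_fst.min (hb.comp measurable_snd))) measurable_snd) measurable_const
  have hψ' : Measurable (Function.uncurry ψ') :=
    Measurable.ite ((measurableSet_le (ha.comp measurable_snd) measurable_fst).inter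
      (measurableSet_le measurable_fst (hb.comp measurable_snd))) hψ measurable_const
  have hφ'C : ∀ r y, |φ' r y| ≤ C := fun r y => by
    simp only [φ']; split_ifs
    · exact hφC _ _
    · simpa using hC0
  have hψ'C : ∀ r y, |ψ' r y| ≤ C := fun r y => by
    simp only [ψ']; split_ifs
    · exact hψC _ _
    · simpa using hC0
  have eφ : ∀ r ∈ Icc 0 h, ∀ y ∈ Icc (p₀ + p₁ * r) (q₀ + q₁ * r), φ' r y = φ r y := by
    intro r hr y hy
    obtain ⟨h1, h2⟩ := (hab y r hr).1 hy
    simp only [φ', h1.trans h2, if_true, min_eq_left h2, max_eq_right h1]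
  have eψ : ∀ r ∈ Icc 0 h, ∀ y ∈ Icc (p₀ + p₁ * r) (q₀ + q₁ * r), ψ' r y = ψ r y := by
    intro r hr y hy
    obtain ⟨h1, h2⟩ := (hab y r hr).1 hy
    simp only [ψ', h1, h2, and_self, if_true]
  have hT' : ∀ y, ∀ r ∈ Icc 0 h, φ' r y = φ' 0 y + ∫ σ in (0 : ℝ)..r, ψ' σ y := by
    intro y r hr
    by_cases hle : a y ≤ b y
    · set c := max (a y) (min r (b y)) with hc
      have hac : a y ≤ c := le_max_left _ _
      have hcb : c ≤ b y := max_le hle (min_le_right _ _)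
      have h0a : max (a y) (min 0 (b y)) = a y := by
        rw [min_eq_left ((ha0 y).trans hle), max_eq_left (ha0 y)]
      have mem : ∀ s, a y ≤ s → s ≤ b y → y ∈ Icc (p₀ + p₁ * s) (q₀ + q₁ * s) := fun s h1 h2 =>
        (hab y s ⟨(ha0 y).trans h1, h2.trans (hbh y)⟩).2 ⟨h1, h2⟩
      simp only [φ', hle, if_true, h0a, ← hc]
      rw [hT y (a y) c (ha0 y) hac (hcb.trans (hbh y)) (mem _ le_rfl hle) (mem _ hac hcb)]
      congr 1
      rw [intervalIntegral.integral_of_le hac, intervalIntegral.integral_of_le hr.1]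
      rw [← integral_Icc_eq_integral_Ioc, ← integral_Icc_eq_integral_Ioc,
        ← integral_indicator measurableSet_Icc, ← integral_indicator measurableSet_Icc]
      -- When `r < a y`, the clamped point `c` equals `a y`, and the two integration sets differ by
      -- the single point `a y`.
      have hae : ∀ᵐ σ : ℝ, σ ≠ a y := Measure.ae_ne volume _
      refine integral_congr_ae ?_
      filter_upwards [hae] with σ hσ
      simp only [indicator, mem_Icc, ψ']
      by_cases h1 : a y ≤ σ ∧ σ ≤ b y
      · simp only [h1, and_self, if_true]
        have hlt : a y < σ := lt_of_le_of_ne h1.1 (Ne.symm hσ)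
        refine if_congr ?_ rfl rfl
        rw [hc, le_max_iff, le_min_iff]
        constructor
        · rintro ⟨-, h2 | h2⟩
          · exact absurd h2 (not_le.2 hlt)
          · exact ⟨(ha0 y).trans h1.1, h2.1⟩
        · exact fun h2 => ⟨trivial, Or.inr ⟨h2.2, h1.2⟩⟩
      · rw [if_neg (fun h2 => h1 ⟨h2.1, h2.2.trans hcb⟩)]
        simp [h1]
    · have : ∀ σ, ψ' σ y = 0 := fun σ => by
        simp only [ψ']
        rw [if_neg fun H => hle (H.1.trans H.2)]
      simp [φ', hle, this]
  obtain ⟨j, e⟩ := strip_identity (p₀ := p₀) (p₁ := p₁) (q₀ := q₀) (q₁ := q₁) h0 hφ' hψ' hφ'C hψ'C hT'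
  have hfe : ∀ r ∈ Icc 0 h, (∫ y in (p₀ + p₁ * r)..(q₀ + q₁ * r), ψ' r y)
      + (q₁ * φ' r (q₀ + q₁ * r) - p₁ * φ' r (p₀ + p₁ * r)) =
      (∫ y in (p₀ + p₁ * r)..(q₀ + q₁ * r), ψ r y)
      + (q₁ * φ r (q₀ + q₁ * r) - p₁ * φ r (p₀ + p₁ * r)) := by
    intro r hr
    have hle := hpq r hr
    rw [eφ r hr _ ⟨hle, le_rfl⟩, eφ r hr _ ⟨le_rfl, hle⟩]
    congr 1
    refine intervalIntegral.integral_congr fun y hy => ?_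
    rw [uIcc_of_le hle] at hy
    exact eψ r hr y hy
  have h00 : (0 : ℝ) ∈ Icc 0 h := ⟨le_rfl, h0⟩
  have hhh : h ∈ Icc 0 h := ⟨h0, le_rfl⟩
  have hpq0 : p₀ ≤ q₀ := by simpa using hpq 0 h00
  have ee0 : ∫ y in p₀..q₀, φ' 0 y = ∫ y in p₀..q₀, φ 0 y := by
    refine intervalIntegral.integral_congr fun y hy => ?_
    rw [uIcc_of_le hpq0] at hy
    exact eφ 0 h00 y (by simpa using hy)
  have eeh : ∫ y in (p₀ + p₁ * h)..(q₀ + q₁ * h), φ' h y =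
      ∫ y in (p₀ + p₁ * h)..(q₀ + q₁ * h), φ h y := by
    refine intervalIntegral.integral_congr fun y hy => ?_
    rw [uIcc_of_le (hpq h hhh)] at hy
    exact eφ h hhh y hy
  constructor
  · refine j.congr fun r hr => hfe r ?_
    rw [uIoc_of_le h0] at hr
    exact Ioc_subset_Icc_self hr
  · rw [← eeh, e, ee0]
    congr 1
    refine intervalIntegral.integral_congr fun r hr => hfe r ?_
    rwa [uIcc_of_le h0] at hr

/-- The rate of change of the integral over `[p₀ + p₁ r, q₀ + q₁ r]` of a product of two functions
that are transported in the direction `(1, c)`. -/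
theorem transported_product_identity {A a B b : ℝ → ℝ → ℝ} {h p₀ p₁ q₀ q₁ c C : ℝ} (h0 : 0 ≤ h)
    (hA : Measurable (Function.uncurry A)) (ha : Measurable (Function.uncurry a))
    (hB : Measurable (Function.uncurry B)) (hb : Measurable (Function.uncurry b))
    (hAC : ∀ r y, |A r y| ≤ C) (haC : ∀ r y, |a r y| ≤ C)
    (hBC : ∀ r y, |B r y| ≤ C) (hbC : ∀ r y, |b r y| ≤ C)
    (hpq : ∀ r ∈ Icc 0 h, p₀ + p₁ * r ≤ q₀ + q₁ * r)
    (hAT : ∀ y r s, 0 ≤ r → 0 ≤ s → r + s ≤ h → y ∈ Icc (p₀ + p₁ * r) (q₀ + q₁ * r) →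
      y + c * s ∈ Icc (p₀ + p₁ * (r + s)) (q₀ + q₁ * (r + s)) →
      A (r + s) (y + c * s) = A r y + ∫ σ in (0 : ℝ)..s, a (r + σ) (y + c * σ))
    (hBT : ∀ y r s, 0 ≤ r → 0 ≤ s → r + s ≤ h → y ∈ Icc (p₀ + p₁ * r) (q₀ + q₁ * r) →
      y + c * s ∈ Icc (p₀ + p₁ * (r + s)) (q₀ + q₁ * (r + s)) →
      B (r + s) (y + c * s) = B r y + ∫ σ in (0 : ℝ)..s, b (r + σ) (y + c * σ)) :
    IntervalIntegrable (fun r =>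
      (∫ y in (p₀ + p₁ * r)..(q₀ + q₁ * r), (a r y * B r y + A r y * b r y))
      + ((q₁ - c) * (A r (q₀ + q₁ * r) * B r (q₀ + q₁ * r))
        - (p₁ - c) * (A r (p₀ + p₁ * r) * B r (p₀ + p₁ * r)))) volume 0 h ∧
    ∫ y in (p₀ + p₁ * h)..(q₀ + q₁ * h), A h y * B h y = (∫ y in p₀..q₀, A 0 y * B 0 y) +
      ∫ r in (0 : ℝ)..h,
        ((∫ y in (p₀ + p₁ * r)..(q₀ + q₁ * r), (a r y * B r y + A r y * b r y))
        + ((q₁ - c) * (A r (q₀ + q₁ * r) * B r (q₀ + q₁ * r))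
          - (p₁ - c) * (A r (p₀ + p₁ * r) * B r (p₀ + p₁ * r)))) := by
  have hC0 : 0 ≤ C := (abs_nonneg _).trans (hAC 0 0)
  have hm : Measurable fun z : ℝ × ℝ => z.2 + c * z.1 := by fun_prop
  have bound : ∀ x y, |x| ≤ C → |y| ≤ C → |x * y| ≤ C * C := fun x y hx hy => by
    rw [abs_mul]; exact mul_le_mul hx hy (abs_nonneg _) hC0
  -- The shear `y ↦ y + c * r` straightens the characteristics, so the endpoint slopes become `p₁ -
  -- c` and `q₁ - c`.
  obtain ⟨j, e⟩ := trapezoid_identity (φ := fun r y => A r (y + c * r) * B r (y + c * r))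
    (ψ := fun r y => a r (y + c * r) * B r (y + c * r) + A r (y + c * r) * b r (y + c * r))
    (p₀ := p₀) (p₁ := p₁ - c) (q₀ := q₀) (q₁ := q₁ - c) (C := C * C + C * C) h0
    ((measurable_section hA measurable_fst hm).mul (measurable_section hB measurable_fst hm))
    (((measurable_section ha measurable_fst hm).mul (measurable_section hB measurable_fst hm)).add
      ((measurable_section hA measurable_fst hm).mul (measurable_section hb measurable_fst hm)))
    (fun r y => (bound _ _ (hAC _ _) (hBC _ _)).trans (by nlinarith))
    (fun r y => (abs_add_le _ _).trans
      (add_le_add (bound _ _ (haC _ _) (hBC _ _)) (bound _ _ (hAC _ _) (hbC _ _))))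
    (fun r hr => by linarith [hpq r hr]) (fun y r s hr hrs hsh hyr hys => by
      have hm1 : Measurable fun σ : ℝ => r + σ := by fun_prop
      have hm2 : Measurable fun σ : ℝ => y + c * r + c * σ := by fun_prop
      -- By convexity of the trapezoid, the characteristic segment between two of its points stays
      -- inside; this is needed to apply the product rule along it.
      have mid : ∀ σ ∈ Icc 0 (s - r), 0 ≤ r ∧ 0 ≤ σ ∧ r + σ ≤ h ∧
          y + c * r ∈ Icc (p₀ + p₁ * r) (q₀ + q₁ * r) ∧
          y + c * r + c * σ ∈ Icc (p₀ + p₁ * (r + σ)) (q₀ + q₁ * (r + σ)) := by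
        intro σ hσ
        refine ⟨hr, hσ.1, by linarith [hσ.2], ⟨by linarith [hyr.1], by linarith [hyr.2]⟩, ?_⟩
        have hr1 := hyr.1
        have hr2 := hyr.2
        have hs1 := hys.1
        have hs2 := hys.2
        rcases eq_or_lt_of_le hrs with rfl | hlt
        · have : σ = 0 := le_antisymm (by linarith [hσ.2]) hσ.1
          subst this
          constructor <;> linarith
        · have w1 : 0 ≤ σ / (s - r) := div_nonneg hσ.1 (by linarith)
          have w2 : σ / (s - r) ≤ 1 := (div_le_one (by linarith)).2 hσ.2
          have w3 : σ = σ / (s - r) * (s - r) := by field_simp [(sub_pos.2 hlt).ne']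
          generalize σ / (s - r) = θ at w1 w2 w3
          subst w3
          constructor <;> nlinarith
      have := mul_eq_add_integral (A := fun σ => A (r + σ) (y + c * r + c * σ))
        (B := fun σ => B (r + σ) (y + c * r + c * σ))
        (a := fun σ => a (r + σ) (y + c * r + c * σ))
        (b := fun σ => b (r + σ) (y + c * r + c * σ)) (s := s - r) (C := C) (by linarith)
        (measurable_section ha hm1 hm2) (measurable_section hb hm1 hm2)
        (fun _ => haC _ _) (fun _ => hbC _ _)
        (fun σ hσ => by
          obtain ⟨m1, m2, m3, m4, m5⟩ := mid σ hσ
          simpa using hAT _ r σ m1 m2 m3 m4 m5)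
        (fun σ hσ => by
          obtain ⟨m1, m2, m3, m4, m5⟩ := mid σ hσ
          simpa using hBT _ r σ m1 m2 m3 m4 m5)
      have e1 : ∀ σ, y + c * r + c * σ = y + c * (r + σ) := fun σ => by ring
      simp only [e1] at this
      rw [intervalIntegral.integral_comp_add_left (fun σ => a σ (y + c * σ) * B σ (y + c * σ) +
        A σ (y + c * σ) * b σ (y + c * σ)) r] at this
      simpa using this)
  have fe : ∀ r, (∫ y in (p₀ + (p₁ - c) * r)..(q₀ + (q₁ - c) * r),
      (a r (y + c * r) * B r (y + c * r) + A r (y + c * r) * b r (y + c * r))) =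
      ∫ y in (p₀ + p₁ * r)..(q₀ + q₁ * r), (a r y * B r y + A r y * b r y) := by
    intro r
    rw [intervalIntegral.integral_comp_add_right (fun y => a r y * B r y + A r y * b r y) (c * r)]
    congr 1 <;> ring
  have ge : ∀ r q d, q + (d - c) * r + c * r = q + d * r := fun r q d => by ring
  simp only [fe, ge] at j e
  refine ⟨j, ?_⟩
  rw [intervalIntegral.integral_comp_add_right (fun y => A h y * B h y) (c * h), ge, ge] at e
  simpa using e

/-! ### Integral kernels of the upper triangular cascade -/

theorem intervalIntegrable_bounded_mul {κ f : ℝ → ℝ} {C : ℝ} (hκ : Measurable κ)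
    (hκC : ∀ x, |κ x| ≤ C) (hf : Continuous f) (a b : ℝ) :
    IntervalIntegrable (fun x => κ x * f x) volume a b :=
  (intervalIntegrable_of_bound hκ fun x _ => hκC x).mul_continuousOn hf.continuousOn

theorem intervalIntegrable_finsetSum {ι : Type*} (s : Finset ι) {f : ι → ℝ → ℝ} {a b : ℝ}
    (h : ∀ i ∈ s, IntervalIntegrable (f i) volume a b) :
    IntervalIntegrable (fun r => ∑ i ∈ s, f i r) volume a b := by
  have := IntervalIntegrable.sum s h
  rwa [show ∑ i ∈ s, f i = fun r => ∑ i ∈ s, f i r by ext; simp] at this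

/-- At time `r` the slow characteristic meets a value that the faster row sends to the outlet at `t
+ ν`, with `ν = s r + (1-x)/lam'` and `s = 1 - lam/lam'`. Since `s > 0`, `ν` is a legitimate
integration variable, and the source becomes an integral against `f` with density `g / s`. -/
theorem exists_kernel_evaluation {g : ℝ → ℝ} {C lam lam' : ℝ} (hg : Measurable g)
    (hgC : ∀ x, |g x| ≤ C) (hl : 0 < lam) (hll : lam < lam') :
    ∃ κ : ℝ → ℝ → ℝ, Measurable (Function.uncurry κ) ∧ (∃ C', ∀ x ν, |κ x ν| ≤ C') ∧
      ∀ f : ℝ → ℝ, Continuous f → ∀ t, ∀ x ∈ Icc (0 : ℝ) 1,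
        IntervalIntegrable (fun r => g (x + lam * r) * f (t + r + (1 - (x + lam * r)) / lam'))
          volume 0 ((1 - x) / lam) ∧
        ∫ r in (0 : ℝ)..((1 - x) / lam), g (x + lam * r) * f (t + r + (1 - (x + lam * r)) / lam') =
          ∫ ν in (0 : ℝ)..((1 - x) / lam), κ x ν * f (t + ν) := by
  have hl' : 0 < lam' := hl.trans hll
  set s := 1 - lam / lam' with hs
  have hs0 : 0 < s := by
    have := (div_lt_one hl').2 hll
    linarith
  have hC0 : 0 ≤ C := (abs_nonneg _).trans (hgC 0)
  refine ⟨fun x ν => if (1 - x) / lam' < ν then g (x + lam * ((ν - (1 - x) / lam') / s)) / s else 0,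
    ?_, ⟨C / s, fun x ν => ?_⟩, fun f hf t x hx => ⟨?_, ?_⟩⟩
  · refine Measurable.ite (measurableSet_lt (by fun_prop) measurable_snd) ?_ measurable_const
    exact (hg.comp (by fun_prop)).div_const s
  · beta_reduce
    split_ifs
    · rw [abs_div, abs_of_pos hs0]
      exact div_le_div_of_nonneg_right (hgC _) hs0.le
    · rw [abs_zero]; positivity
  · exact intervalIntegrable_bounded_mul (hg.comp (by fun_prop)) (fun _ => hgC _) (by fun_prop) _ _
  · have h1x : 0 ≤ 1 - x := by linarith [hx.2]
    have hd : 0 ≤ (1 - x) / lam' := by positivity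
    have hdT : (1 - x) / lam' ≤ (1 - x) / lam := by gcongr
    -- At the end of the slow characteristic the remaining time of the fast one is zero, so `ν`
    -- reaches exactly `(1-x)/lam`.
    have hT : s * ((1 - x) / lam) + (1 - x) / lam' = (1 - x) / lam := by
      rw [hs]; field_simp; ring
    have e1 : ∀ r, g (x + lam * r) * f (t + r + (1 - (x + lam * r)) / lam') =
        (fun ν => g (x + lam * ((ν - (1 - x) / lam') / s)) * f (t + ν)) (s * r + (1 - x) / lam') := by
      intro r
      simp only [add_sub_cancel_right, mul_div_cancel_left₀ r hs0.ne']
      congr 2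
      rw [hs]; field_simp; ring
    simp only [e1]
    rw [intervalIntegral.integral_comp_mul_add
      (fun ν => g (x + lam * ((ν - (1 - x) / lam') / s)) * f (t + ν)) hs0.ne', mul_zero, zero_add, hT,
      intervalIntegral_eq_indicator hd hdT le_rfl, smul_eq_mul,
      ← intervalIntegral.integral_const_mul]
    refine intervalIntegral.integral_congr_ae (.of_forall fun ν hν => ?_)
    rw [uIoc_of_le (hd.trans hdT)] at hν
    simp only [indicator, mem_Ioc, hν.2, and_true]
    split_ifs
    · rw [div_eq_inv_mul _ s]; ring
    · simp

/-- The look-ahead integral of a faster row, accumulated along a slower characteristic, is again a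
look-ahead integral: shift the inner variable by `r` and exchange the integrals. -/
theorem exists_kernel_composition {g : ℝ → ℝ} {k : ℝ → ℝ → ℝ} {C lam lam' : ℝ} (hg : Measurable g)
    (hgC : ∀ x, |g x| ≤ C) (hk : Measurable (Function.uncurry k)) (hkC : ∀ x ν, |k x ν| ≤ C)
    (hl : 0 < lam) (hll : lam < lam') :
    ∃ κ : ℝ → ℝ → ℝ, Measurable (Function.uncurry κ) ∧ (∃ C', ∀ x ν, |κ x ν| ≤ C') ∧
      ∀ f : ℝ → ℝ, Continuous f → ∀ t, ∀ x ∈ Icc (0 : ℝ) 1,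
        IntervalIntegrable (fun r => g (x + lam * r) *
          ∫ ν in (0 : ℝ)..((1 - (x + lam * r)) / lam'), k (x + lam * r) ν * f (t + r + ν))
          volume 0 ((1 - x) / lam) ∧
        ∫ r in (0 : ℝ)..((1 - x) / lam), g (x + lam * r) *
          ∫ ν in (0 : ℝ)..((1 - (x + lam * r)) / lam'), k (x + lam * r) ν * f (t + r + ν) =
          ∫ ν in (0 : ℝ)..((1 - x) / lam), κ x ν * f (t + ν) := by
  have hl' : 0 < lam' := hl.trans hll
  have hC0 : 0 ≤ C := (abs_nonneg _).trans (hgC 0)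
  let Φ : (ℝ × ℝ) → ℝ → ℝ := fun z r =>
    if (z.1 + lam * r ≤ 1 ∧ r < z.2) ∧ z.2 ≤ r + (1 - (z.1 + lam * r)) / lam' then
      g (z.1 + lam * r) * k (z.1 + lam * r) (z.2 - r) else 0
  have hΦ : Measurable (Function.uncurry Φ) := by
    have m1 : MeasurableSet {w : (ℝ × ℝ) × ℝ | w.1.1 + lam * w.2 ≤ 1} :=
      measurableSet_le (by fun_prop) (by fun_prop)
    have m2 : MeasurableSet {w : (ℝ × ℝ) × ℝ | w.2 < w.1.2} :=
      measurableSet_lt (by fun_prop) (by fun_prop)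
    have m3 : MeasurableSet
        {w : (ℝ × ℝ) × ℝ | w.1.2 ≤ w.2 + (1 - (w.1.1 + lam * w.2)) / lam'} :=
      measurableSet_le (by fun_prop) (by fun_prop)
    refine Measurable.ite ((m1.inter m2).inter m3) ?_ measurable_const
    exact (hg.comp (by fun_prop)).mul (measurable_section hk (by fun_prop) (by fun_prop))
  have hΦC : ∀ z r, |Φ z r| ≤ C * C := fun z r => by
    simp only [Φ]
    split_ifs
    · rw [abs_mul]; exact mul_le_mul (hgC _) (hkC _ _) (abs_nonneg _) hC0
    · rw [abs_zero]; positivity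
  -- The upper limit does not depend on `x`, because `Φ` vanishes once the characteristic has left
  -- `[0, 1]`.
  refine ⟨fun x ν => ∫ r in (0 : ℝ)..(1 / lam), Φ (x, ν) r,
    measurable_intervalIntegral_param hΦ measurable_const measurable_const,
    ⟨C * C * |1 / lam - 0|, fun x ν => abs_intervalIntegral_le fun r _ => hΦC _ r⟩,
    fun f hf t x hx => ?_⟩
  have h1x : 0 ≤ 1 - x := by linarith [hx.2]
  set T := (1 - x) / lam with hT
  have hT0 : 0 ≤ T := by positivity
  have hT1 : T ≤ 1 / lam := by
    rw [hT]; gcongr; linarith [hx.1]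
  have hxT : ∀ r, x + lam * r ≤ 1 ↔ r ≤ T := fun r => by
    rw [hT, le_div_iff₀ hl]; constructor <;> intro h <;> linarith
  have inner : ∀ r ∈ Icc 0 T, g (x + lam * r) *
      ∫ ν in (0 : ℝ)..((1 - (x + lam * r)) / lam'), k (x + lam * r) ν * f (t + r + ν) =
      ∫ ν in (0 : ℝ)..T, Φ (x, ν) r * f (t + ν) := by
    intro r hr
    have hxr : x + lam * r ≤ 1 := (hxT r).2 hr.2
    have hT'0 : 0 ≤ (1 - (x + lam * r)) / lam' := div_nonneg (by linarith) hl'.le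
    -- The ordering of the speeds enters here: the shifted window of the faster row ends no later
    -- than `T`.
    have hT' : r + (1 - (x + lam * r)) / lam' ≤ T := by
      have : (1 - (x + lam * r)) / lam' ≤ (1 - (x + lam * r)) / lam := by
        gcongr
      have e : (1 - (x + lam * r)) / lam = T - r := by rw [hT]; field_simp; ring
      linarith
    have e1 : ∀ ν, k (x + lam * r) ν * f (t + r + ν) =
        (fun μ => k (x + lam * r) (μ - r) * f (t + μ)) (r + ν) := fun ν => by
      simp [add_assoc]
    simp only [e1]
    rw [intervalIntegral.integral_comp_add_left
      (fun μ => k (x + lam * r) (μ - r) * f (t + μ)), add_zero,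
      intervalIntegral_eq_indicator hr.1 (by linarith) hT', ← intervalIntegral.integral_const_mul]
    refine intervalIntegral.integral_congr fun ν _ => ?_
    simp only [indicator, mem_Ioc, Φ, hxr, true_and]
    split_ifs
    · ring
    · simp
  obtain ⟨M, hM⟩ := (isCompact_uIcc (a := (0 : ℝ)) (b := T)).exists_bound_of_continuousOn
    (f := fun ν => f (t + ν)) (by fun_prop)
  have hF : Measurable (Function.uncurry fun r ν => Φ (x, ν) r * f (t + ν)) :=
    (hΦ.comp (g := Function.uncurry Φ) (f := fun z : ℝ × ℝ => ((x, z.2), z.1)) (by fun_prop)).mul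
      (hf.measurable.comp (f := fun z : ℝ × ℝ => t + z.2) (by fun_prop))
  have hFC : ∀ r, ∀ ν ∈ uIcc 0 T, |Φ (x, ν) r * f (t + ν)| ≤ C * C * M := fun r ν hν => by
    rw [abs_mul]
    exact mul_le_mul (hΦC _ _) (hM ν hν) (abs_nonneg _) (by positivity)
  constructor
  · refine IntervalIntegrable.congr (f := fun r => ∫ ν in (0 : ℝ)..T, Φ (x, ν) r * f (t + ν))
      (fun r hr => (inner r ?_).symm) ?_
    · rw [uIoc_of_le hT0] at hr
      exact Ioc_subset_Icc_self hr
    · exact intervalIntegrable_of_bound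
        (measurable_intervalIntegral_param hF measurable_const measurable_const)
        fun r _ => abs_intervalIntegral_le (hFC r)
  · rw [intervalIntegral.integral_congr (g := fun r => ∫ ν in (0 : ℝ)..T, Φ (x, ν) r * f (t + ν))
      (fun r hr => inner r (by rwa [uIcc_of_le hT0] at hr)),
      intervalIntegral_swap_of_bound hF fun r _ ν hν => hFC r ν hν]
    refine intervalIntegral.integral_congr fun ν _ => ?_
    simp only
    rw [intervalIntegral.integral_mul_const]
    congr 1
    rw [intervalIntegral_eq_indicator le_rfl hT0 hT1]
    refine intervalIntegral.integral_congr_ae (.of_forall fun r hr => ?_)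
    rw [uIoc_of_le (hT0.trans hT1)] at hr
    simp only [indicator, mem_Ioc, hr.1, true_and, Φ, hxT]
    by_cases h : r ≤ T <;> simp [h]

/-- The candidate solution of a strictly upper triangular system of transport equations with
prescribed outflow `ζ`. -/
def cascade {n : ℕ} (lam : Fin n → ℝ) (k : Fin n → Fin n → ℝ → ℝ → ℝ) (ζ : ℝ → Fin n → ℝ)
    (j : Fin n) (t x : ℝ) : ℝ :=
  ζ (t + (1 - x) / lam j) j +
    ∑ l ∈ Finset.Ioi j, ∫ ν in (0 : ℝ)..((1 - x) / lam j), k j l x ν * ζ (t + ν) l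

/-- `cascade lam k` solves the system with coefficients `g`, in row `j`. -/
def CascadeRow {n : ℕ} (lam : Fin n → ℝ) (g : Fin n → Fin n → ℝ → ℝ)
    (k : Fin n → Fin n → ℝ → ℝ → ℝ) (j : Fin n) : Prop :=
  ∀ ζ : ℝ → Fin n → ℝ, Continuous ζ → ∀ t, ∀ x ∈ Icc (0 : ℝ) 1,
    IntervalIntegrable (fun r => ∑ l ∈ Finset.Ioi j, g j l (x + lam j * r) *
        cascade lam k ζ l (t + r) (x + lam j * r)) volume 0 ((1 - x) / lam j) ∧
    cascade lam k ζ j t x = ζ (t + (1 - x) / lam j) j -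
      ∫ r in (0 : ℝ)..((1 - x) / lam j), ∑ l ∈ Finset.Ioi j, g j l (x + lam j * r) *
        cascade lam k ζ l (t + r) (x + lam j * r)

/-- Substituting the solved rows `l > j` into the integrated equation of row `j` yields one
evaluation term per row and one composition term per pair of rows. The conclusion quantifies over
`k'` so that the new row can later be glued to kernels already built. -/
theorem exists_cascade_row {n : ℕ} {lam : Fin n → ℝ} (hpos : ∀ j, 0 < lam j)
    (hmono : StrictMono lam) {g : Fin n → Fin n → ℝ → ℝ} {C : ℝ} (hg : ∀ j l, Measurable (g j l))
    (hgC : ∀ j l x, |g j l x| ≤ C) {k : Fin n → Fin n → ℝ → ℝ → ℝ}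
    (hk : ∀ j l, Measurable (Function.uncurry (k j l))) (hkC : ∀ j l, ∃ C, ∀ x ν, |k j l x ν| ≤ C)
    (j : Fin n) :
    ∃ κ : Fin n → ℝ → ℝ → ℝ, (∀ l, Measurable (Function.uncurry (κ l))) ∧
      (∀ l, ∃ C, ∀ x ν, |κ l x ν| ≤ C) ∧ ∀ k' : Fin n → Fin n → ℝ → ℝ → ℝ,
        k' j = κ → (∀ l > j, k' l = k l) → CascadeRow lam g k' j := by
  have H1 : ∀ p, ∃ κ : ℝ → ℝ → ℝ, Measurable (Function.uncurry κ) ∧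
      (∃ C', ∀ x ν, |κ x ν| ≤ C') ∧ (j < p → ∀ f : ℝ → ℝ, Continuous f → ∀ t, ∀ x ∈ Icc (0 : ℝ) 1,
        IntervalIntegrable (fun r => g j p (x + lam j * r) *
          f (t + r + (1 - (x + lam j * r)) / lam p)) volume 0 ((1 - x) / lam j) ∧
        ∫ r in (0 : ℝ)..((1 - x) / lam j), g j p (x + lam j * r) *
          f (t + r + (1 - (x + lam j * r)) / lam p) =
          ∫ ν in (0 : ℝ)..((1 - x) / lam j), κ x ν * f (t + ν)) := by
    intro p
    by_cases hp : j < p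
    · obtain ⟨κ, h1, h2, h3⟩ := exists_kernel_evaluation (hg j p) (hgC j p) (hpos j) (hmono hp)
      exact ⟨κ, h1, h2, fun _ => h3⟩
    · exact ⟨fun _ _ => 0, measurable_const, ⟨0, by simp⟩, fun h => absurd h hp⟩
  have H2 : ∀ p q, ∃ κ : ℝ → ℝ → ℝ, Measurable (Function.uncurry κ) ∧
      (∃ C', ∀ x ν, |κ x ν| ≤ C') ∧ (j < p → ∀ f : ℝ → ℝ, Continuous f → ∀ t, ∀ x ∈ Icc (0 : ℝ) 1,
        IntervalIntegrable (fun r => g j p (x + lam j * r) *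
          ∫ ν in (0 : ℝ)..((1 - (x + lam j * r)) / lam p), k p q (x + lam j * r) ν * f (t + r + ν))
          volume 0 ((1 - x) / lam j) ∧
        ∫ r in (0 : ℝ)..((1 - x) / lam j), g j p (x + lam j * r) *
          ∫ ν in (0 : ℝ)..((1 - (x + lam j * r)) / lam p), k p q (x + lam j * r) ν * f (t + r + ν) =
          ∫ ν in (0 : ℝ)..((1 - x) / lam j), κ x ν * f (t + ν)) := by
    intro p q
    by_cases hp : j < p
    · obtain ⟨C', hC'⟩ := hkC p q
      obtain ⟨κ, h1, h2, h3⟩ := exists_kernel_composition (C := max C C') (hg j p)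
        (fun x => (hgC j p x).trans (le_max_left _ _)) (hk p q)
        (fun x ν => (hC' x ν).trans (le_max_right _ _)) (hpos j) (hmono hp)
      exact ⟨κ, h1, h2, fun _ => h3⟩
    · exact ⟨fun _ _ => 0, measurable_const, ⟨0, by simp⟩, fun h => absurd h hp⟩
  choose κ₁ m1 b1 e1 using H1
  choose κ₂ m2 b2 e2 using H2
  choose B1 hB1 using b1
  choose B2 hB2 using b2
  -- `κ₁ l` collects the direct action of row `l` on row `j`; `κ₂ p l` collects the influence of
  -- `ζ^l` that passes through an intermediate row `j < p < l`. The sign comes from integrating back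
  -- from the outflow.
  let κ : Fin n → ℝ → ℝ → ℝ := fun l x ν => -(κ₁ l x ν + ∑ p ∈ Finset.Ioo j l, κ₂ p l x ν)
  refine ⟨κ, fun l => ?_, fun l => ⟨B1 l + ∑ p ∈ Finset.Ioo j l, B2 p l, fun x ν => ?_⟩, ?_⟩
  · refine ((m1 l).add ?_).neg
    exact Finset.measurable_fun_sum _ fun p _ => m2 p l
  · simp only [κ, abs_neg]
    refine (abs_add_le _ _).trans (add_le_add (hB1 _ _ _) ?_)
    exact (Finset.abs_sum_le_sum_abs _ _).trans (Finset.sum_le_sum fun p _ => hB2 _ _ _ _)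
  · intro k' hk'j hk'l ζ hζ t x hx
    have hζl : ∀ l, Continuous fun s => ζ s l := fun l => (continuous_apply l).comp hζ
    set T := (1 - x) / lam j with hT
    have hfun : ∀ r, ∑ l ∈ Finset.Ioi j, g j l (x + lam j * r) *
        cascade lam k' ζ l (t + r) (x + lam j * r) =
        ∑ l ∈ Finset.Ioi j, (g j l (x + lam j * r) *
          (ζ (t + r + (1 - (x + lam j * r)) / lam l) l) + ∑ q ∈ Finset.Ioi l,
          g j l (x + lam j * r) * ∫ ν in (0 : ℝ)..((1 - (x + lam j * r)) / lam l),
            k l q (x + lam j * r) ν * ζ (t + r + ν) q) := by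
      intro r
      refine Finset.sum_congr rfl fun l hl => ?_
      rw [Finset.mem_Ioi] at hl
      simp only [cascade, hk'l l hl, mul_add, Finset.mul_sum]
    have I1 : ∀ l ∈ Finset.Ioi j, IntervalIntegrable (fun r => g j l (x + lam j * r) *
          (ζ (t + r + (1 - (x + lam j * r)) / lam l) l)) volume 0 T := fun l hl =>
      (e1 l (Finset.mem_Ioi.1 hl) _ (hζl l) t x hx).1
    have I2 : ∀ l ∈ Finset.Ioi j, ∀ q ∈ Finset.Ioi l, IntervalIntegrable (fun r =>
        g j l (x + lam j * r) * ∫ ν in (0 : ℝ)..((1 - (x + lam j * r)) / lam l),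
            k l q (x + lam j * r) ν * ζ (t + r + ν) q) volume 0 T := fun l hl q _ =>
      (e2 l q (Finset.mem_Ioi.1 hl) _ (hζl q) t x hx).1
    have I2' : ∀ l ∈ Finset.Ioi j, IntervalIntegrable (fun r => ∑ q ∈ Finset.Ioi l,
        g j l (x + lam j * r) * ∫ ν in (0 : ℝ)..((1 - (x + lam j * r)) / lam l),
            k l q (x + lam j * r) ν * ζ (t + r + ν) q) volume 0 T := fun l hl =>
      intervalIntegrable_finsetSum _ (I2 l hl)
    simp only [hfun]
    constructor
    · exact intervalIntegrable_finsetSum _ fun l hl => (I1 l hl).add (I2' l hl)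
    · rw [intervalIntegral.integral_finsetSum fun l hl => (I1 l hl).add (I2' l hl)]
      have s1 : ∀ l ∈ Finset.Ioi j, (∫ r in (0 : ℝ)..T, (g j l (x + lam j * r) *
          (ζ (t + r + (1 - (x + lam j * r)) / lam l) l) + ∑ q ∈ Finset.Ioi l,
          g j l (x + lam j * r) * ∫ ν in (0 : ℝ)..((1 - (x + lam j * r)) / lam l),
            k l q (x + lam j * r) ν * ζ (t + r + ν) q)) =
          (∫ ν in (0 : ℝ)..T, κ₁ l x ν * ζ (t + ν) l) +
          ∑ q ∈ Finset.Ioi l, ∫ ν in (0 : ℝ)..T, κ₂ l q x ν * ζ (t + ν) q := by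
        intro l hl
        rw [intervalIntegral.integral_add (I1 l hl) (I2' l hl),
          intervalIntegral.integral_finsetSum (I2 l hl),
          (e1 l (Finset.mem_Ioi.1 hl) _ (hζl l) t x hx).2]
        congr 1
        exact Finset.sum_congr rfl fun q _ => (e2 l q (Finset.mem_Ioi.1 hl) _ (hζl q) t x hx).2
      rw [Finset.sum_congr rfl s1, Finset.sum_add_distrib]
      rw [Finset.sum_comm' (t' := Finset.Ioi j) (s' := fun q => Finset.Ioo j q)
        (fun l q => by
          simp only [Finset.mem_Ioi, Finset.mem_Ioo]
          exact ⟨fun h => ⟨⟨h.1, h.2⟩, h.1.trans h.2⟩, fun h => ⟨h.1.1, h.1.2⟩⟩),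
        ← Finset.sum_add_distrib]
      rw [cascade, ← hT, sub_eq_add_neg, ← Finset.sum_neg_distrib]
      congr 1
      refine Finset.sum_congr rfl fun l _ => ?_
      have hc : Continuous fun ν => ζ (t + ν) l := (hζl l).comp (by fun_prop)
      have J1 : IntervalIntegrable (fun ν => κ₁ l x ν * ζ (t + ν) l) volume 0 T :=
        intervalIntegrable_bounded_mul (measurable_section (m1 l) measurable_const measurable_id)
          (hB1 l x) hc _ _
      have J2 : ∀ p ∈ Finset.Ioo j l,
          IntervalIntegrable (fun ν => κ₂ p l x ν * ζ (t + ν) l) volume 0 T := fun p _ =>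
        intervalIntegrable_bounded_mul (measurable_section (m2 p l) measurable_const measurable_id)
          (hB2 p l x) hc _ _
      have J2' : IntervalIntegrable (fun ν => ∑ p ∈ Finset.Ioo j l, κ₂ p l x ν * ζ (t + ν) l)
          volume 0 T :=
        intervalIntegrable_finsetSum _ J2
      rw [← intervalIntegral.integral_finsetSum J2, ← intervalIntegral.integral_add J1 J2',
        ← intervalIntegral.integral_neg]
      refine intervalIntegral.integral_congr fun ν _ => ?_
      simp only [hk'j, κ, neg_mul, add_mul, Finset.sum_mul]

/-- The rows are solved from the last one upwards; at stage `N` the last `N` rows are available. -/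
theorem exists_cascade_kernel {n : ℕ} {lam : Fin n → ℝ} (hpos : ∀ j, 0 < lam j)
    (hmono : StrictMono lam) {g : Fin n → Fin n → ℝ → ℝ} {C : ℝ} (hg : ∀ j l, Measurable (g j l))
    (hgC : ∀ j l x, |g j l x| ≤ C) :
    ∃ k : Fin n → Fin n → ℝ → ℝ → ℝ, (∀ j l, Measurable (Function.uncurry (k j l))) ∧
      (∀ j l, ∃ C, ∀ x ν, |k j l x ν| ≤ C) ∧ ∀ j, CascadeRow lam g k j := by
  have main : ∀ N : ℕ, ∃ k : Fin n → Fin n → ℝ → ℝ → ℝ,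
      (∀ j l, Measurable (Function.uncurry (k j l))) ∧
      (∀ j l, ∃ C, ∀ x ν, |k j l x ν| ≤ C) ∧ ∀ j : Fin n, n ≤ j + N → CascadeRow lam g k j := by
    intro N
    induction N with
    | zero =>
      exact ⟨fun _ _ _ _ => 0, fun _ _ => measurable_const, fun _ _ => ⟨0, by simp⟩,
        fun j hj => absurd j.2 (by omega)⟩
    | succ N ih =>
      obtain ⟨k, hk, hkC, hrow⟩ := ih
      choose κ hκ hκC hκrow using exists_cascade_row hpos hmono hg hgC hk hkC
      let k' : Fin n → Fin n → ℝ → ℝ → ℝ := fun j => if n ≤ j + N then k j else κ j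
      refine ⟨k', fun j l => ?_, fun j l => ?_, fun j hj => ?_⟩
      · simp only [k']; split_ifs
        exacts [hk j l, hκ j l]
      · simp only [k']; split_ifs
        exacts [hkC j l, hκC j l]
      · have heq : ∀ l : Fin n, n ≤ l + N → k' l = k l := fun l hl => by simp [k', hl]
        by_cases hjN : n ≤ j + N
        · intro ζ hζ t x hx
          -- Redefining higher rows of the matrix does not disturb a solved row, whose equation only
          -- involves rows with index at least `j`.
          have hl : ∀ l ≥ j, ∀ s y, cascade lam k' ζ l s y = cascade lam k ζ l s y := by
            intro l hl s y
            have : (j : ℕ) ≤ l := hl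
            rw [cascade, cascade, heq l (by omega)]
          have hsum : ∀ r, ∑ l ∈ Finset.Ioi j, g j l (x + lam j * r) *
              cascade lam k' ζ l (t + r) (x + lam j * r) = ∑ l ∈ Finset.Ioi j,
              g j l (x + lam j * r) * cascade lam k ζ l (t + r) (x + lam j * r) := fun r =>
            Finset.sum_congr rfl fun l hl' => by rw [hl l (Finset.mem_Ioi.1 hl').le]
          simp only [hsum, hl j le_rfl]
          exact hrow j hjN ζ hζ t x hx
        · refine hκrow j k' (by simp [k', hjN]) fun l hl => heq l ?_
          have : (j : ℕ) < l := hl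
          omega
  obtain ⟨k, hk, hkC, hrow⟩ := main n
  exact ⟨k, hk, hkC, fun j => hrow j (by omega)⟩

/-! ### Transport and uniqueness for the cascade -/

/-- Two points of the same characteristic share their exit point, so the `ζ` terms of the two
outflow formulas agree and only the integral over the segment between them remains. -/
theorem CascadeRow.transport {n : ℕ} {lam : Fin n → ℝ} {g : Fin n → Fin n → ℝ → ℝ}
    {k : Fin n → Fin n → ℝ → ℝ → ℝ} {j : Fin n} (hpos : 0 < lam j) (hk : CascadeRow lam g k j)
    {ζ : ℝ → Fin n → ℝ} (hζ : Continuous ζ) {t x h : ℝ} (h0 : 0 ≤ h) (hx : x ∈ Icc (0 : ℝ) 1)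
    (hxh : x + lam j * h ≤ 1) :
    cascade lam k ζ j (t + h) (x + lam j * h) = cascade lam k ζ j t x +
      ∫ r in (0 : ℝ)..h, ∑ l ∈ Finset.Ioi j, g j l (x + lam j * r) *
        cascade lam k ζ l (t + r) (x + lam j * r) := by
  obtain ⟨i1, e1⟩ := hk ζ hζ t x hx
  obtain ⟨-, e2⟩ := hk ζ hζ (t + h) (x + lam j * h) ⟨by have := hx.1; positivity, hxh⟩
  have hT : (1 - (x + lam j * h)) / lam j = (1 - x) / lam j - h := by field_simp; ring
  have hhT : h ≤ (1 - x) / lam j := by rw [le_div_iff₀ hpos]; linarith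
  rw [e1, e2, hT]
  have a1 : t + h + ((1 - x) / lam j - h) = t + (1 - x) / lam j := by ring
  set Φ : ℝ → ℝ := fun r => ∑ l ∈ Finset.Ioi j, g j l (x + lam j * r) *
        cascade lam k ζ l (t + r) (x + lam j * r) with hΦ
  have a2 : ∀ r, ∑ l ∈ Finset.Ioi j, g j l (x + lam j * h + lam j * r) *
        cascade lam k ζ l (t + h + r) (x + lam j * h + lam j * r) = Φ (h + r) := fun r => by
    simp only [hΦ, mul_add, add_assoc]
  simp only [a1, a2]
  rw [intervalIntegral.integral_comp_add_left Φ, add_zero, add_sub_cancel]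
  have hmem : h ∈ uIcc 0 ((1 - x) / lam j) := by
    rw [uIcc_of_le (h0.trans hhT)]; exact ⟨h0, hhT⟩
  rw [← intervalIntegral.integral_add_adjacent_intervals
    (i1.mono_set (uIcc_subset_uIcc_left hmem)) (i1.mono_set (uIcc_subset_uIcc_right hmem))]
  ring

/-- `α` satisfies the cascade of transport equations wherever its delayed terms,
which reach back in time by `x / lam₁`, are defined. -/
def CascadeTransport {n : ℕ} (lam : Fin n → ℝ) (lam₁ : ℝ) (g : Fin n → Fin n → ℝ → ℝ)
    (α : Fin n → ℝ → ℝ → ℝ) : Prop :=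
  ∀ j t x h, 0 ≤ t → 0 ≤ h → x ∈ Icc (0 : ℝ) 1 → x + lam j * h ≤ 1 →
    (x + lam j * h) / lam₁ ≤ t + h →
    α j (t + h) (x + lam j * h) = α j t x +
      ∫ r in (0 : ℝ)..h, ∑ l ∈ Finset.Ioi j, g j l (x + lam j * r) * α l (t + r) (x + lam j * r)

/-- Downward induction on the row: the characteristic is followed forward to `x = 1`, where both
functions equal `ζ`, and the source only involves rows already identified. The bound `1 / lam₁ ≤ s`
guarantees that the delayed terms are defined at the exit. -/
theorem CascadeTransport.eq_of_outflow {n : ℕ} {lam : Fin n → ℝ} {lam₁ : ℝ}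
    {g : Fin n → Fin n → ℝ → ℝ} {α : Fin n → ℝ → ℝ → ℝ} {k : Fin n → Fin n → ℝ → ℝ → ℝ}
    (hα : CascadeTransport lam lam₁ g α) (h₁ : 0 < lam₁) (hlam : ∀ j, lam₁ ≤ lam j)
    (hk : ∀ j, CascadeRow lam g k j) {ζ : ℝ → Fin n → ℝ} (hζ : Continuous ζ) {s : ℝ}
    (hs : 1 / lam₁ ≤ s) (hout : ∀ t > s, ∀ j, α j t 1 = ζ t j) (j : Fin n) :
    ∀ t > s, ∀ x ∈ Icc (0 : ℝ) 1, α j t x = cascade lam k ζ j t x := by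
  induction j using WellFoundedGT.induction with
  | ind j ih =>
    intro t ht x hx
    have hpos : 0 < lam j := h₁.trans_le (hlam j)
    have hs0 : 0 < 1 / lam₁ := by positivity
    set h := (1 - x) / lam j with hh
    have h0 : 0 ≤ h := div_nonneg (by linarith [hx.2]) hpos.le
    have hend : x + lam j * h = 1 := by rw [hh]; field_simp; ring
    have e := hα j t x h (by linarith) h0 hx hend.le (by rw [hend]; linarith)
    rw [hend, hout _ (by linarith)] at e
    rw [(hk j ζ hζ t x hx).2, ← hh, e]
    have : ∫ r in (0 : ℝ)..h, ∑ l ∈ Finset.Ioi j, g j l (x + lam j * r) *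
        α l (t + r) (x + lam j * r) = ∫ r in (0 : ℝ)..h, ∑ l ∈ Finset.Ioi j,
        g j l (x + lam j * r) * cascade lam k ζ l (t + r) (x + lam j * r) := by
      refine intervalIntegral.integral_congr fun r hr => ?_
      rw [uIcc_of_le h0] at hr
      refine Finset.sum_congr rfl fun l hl => ?_
      rw [ih l (Finset.mem_Ioi.1 hl) (t + r) (by linarith [hr.1]) _ ⟨?_, ?_⟩]
      · have := hx.1; have := hr.1; positivity
      · rw [← hend]; have := hr.2; gcongr
    rw [this]
    ring

/-- The same induction, with characteristics followed back to `x = 0`. The region `s < t - x / lam₁`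
is stable under this motion because no row is slower than `lam₁`. -/
theorem CascadeTransport.eq_of_inflow {n : ℕ} {lam : Fin n → ℝ} {lam₁ : ℝ}
    {g : Fin n → Fin n → ℝ → ℝ} {α : Fin n → ℝ → ℝ → ℝ} {k : Fin n → Fin n → ℝ → ℝ → ℝ}
    (hα : CascadeTransport lam lam₁ g α) (h₁ : 0 < lam₁) (hlam : ∀ j, lam₁ ≤ lam j)
    (hk : ∀ j, CascadeRow lam g k j) {ζ : ℝ → Fin n → ℝ} (hζ : Continuous ζ) {s : ℝ}
    (hs : 0 ≤ s) (hin : ∀ t > s, ∀ j, α j t 0 = cascade lam k ζ j t 0) (j : Fin n) :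
    ∀ t, ∀ x ∈ Icc (0 : ℝ) 1, s < t - x / lam₁ → α j t x = cascade lam k ζ j t x := by
  induction j using WellFoundedGT.induction with
  | ind j ih =>
    intro t x hx htx
    have hpos : 0 < lam j := h₁.trans_le (hlam j)
    set h := x / lam j with hh
    have h0 : 0 ≤ h := div_nonneg hx.1 hpos.le
    have hle : h ≤ x / lam₁ := div_le_div_of_nonneg_left hx.1 h₁ (hlam j)
    have hend : 0 + lam j * h = x := by rw [hh]; field_simp; ring
    have h00 : (0 : ℝ) ∈ Icc (0 : ℝ) 1 := ⟨le_rfl, zero_le_one⟩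
    have e := hα j (t - h) 0 h (by linarith) h0 h00 (hend.le.trans hx.2) (by rw [hend]; linarith)
    have e' := (hk j).transport hpos hζ (t := t - h) h0 h00 (hend.le.trans hx.2)
    rw [hend, sub_add_cancel] at e e'
    rw [e, e', hin _ (by linarith)]
    congr 1
    refine intervalIntegral.integral_congr fun r hr => ?_
    rw [uIcc_of_le h0] at hr
    refine Finset.sum_congr rfl fun l hl => ?_
    have hxr : 0 + lam j * r ≤ x := by rw [← hend]; have := hr.2; gcongr
    rw [ih l (Finset.mem_Ioi.1 hl) (t - h + r) _ ⟨?_, hxr.trans hx.2⟩]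
    -- Along the row-`j` characteristic `t - x / lam₁` is nonincreasing, since `lam j / lam₁ ≥ 1`;
    -- hence earlier points satisfy the same inequality.
    · have e3 : x / lam₁ - (0 + lam j * r) / lam₁ = (h - r) * (lam j / lam₁) := by
        rw [← hend]; field_simp; ring
      have e4 : h - r ≤ (h - r) * (lam j / lam₁) :=
        le_mul_of_one_le_right (by linarith [hr.2]) ((one_le_div h₁).2 (hlam j))
      linarith
    · have := hr.1; positivity

/-! ### From pointwise bounds to `L²` bounds -/

/-- Cauchy–Schwarz against the constant function, read off from the nonnegativity of the variance of
`q`. -/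
theorem sq_intervalIntegral_le {q : ℝ → ℝ} (hq : Continuous q) {η : ℝ} (hη : 0 < η) :
    (∫ ν in (0 : ℝ)..η, q ν) ^ 2 ≤ η * ∫ ν in (0 : ℝ)..η, q ν ^ 2 := by
  set m := (∫ ν in (0 : ℝ)..η, q ν) / η with hm
  have h1 : 0 ≤ ∫ ν in (0 : ℝ)..η, (q ν - m) ^ 2 :=
    intervalIntegral.integral_nonneg hη.le fun _ _ => sq_nonneg _
  have e : ∫ ν in (0 : ℝ)..η, (q ν - m) ^ 2 =
      (∫ ν in (0 : ℝ)..η, q ν ^ 2) - 2 * m * (∫ ν in (0 : ℝ)..η, q ν) + η * m ^ 2 := by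
    have : ∀ ν, (q ν - m) ^ 2 = q ν ^ 2 - 2 * m * q ν + m ^ 2 := fun ν => by ring
    simp only [this]
    rw [intervalIntegral.integral_add
      (Continuous.intervalIntegrable (by fun_prop) _ _) (by simp),
      intervalIntegral.integral_sub (Continuous.intervalIntegrable (by fun_prop) _ _)
      (Continuous.intervalIntegrable (by fun_prop) _ _), intervalIntegral.integral_const_mul]
    simp
  have hI : ∫ ν in (0 : ℝ)..η, q ν = m * η := by rw [hm]; field_simp
  rw [e, hI] at h1
  rw [hI]
  nlinarith [mul_nonneg hη.le h1]

/-- The substitution `ν = (1-x)/c` produces the factor `c`; the constant term squared costs the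
factor `η` by Cauchy–Schwarz. -/
theorem integral_sq_le_of_abs_le {f q : ℝ → ℝ} {C c η : ℝ} (hq : Continuous q) (hc : 0 < c)
    (hcη : 1 / c ≤ η) (hf : IntervalIntegrable (fun x => f x ^ 2) volume 0 1)
    (hfq : ∀ x ∈ Icc (0 : ℝ) 1, |f x| ≤ C * (q ((1 - x) / c) + ∫ ν in (0 : ℝ)..η, q ν)) :
    ∫ x in (0 : ℝ)..1, f x ^ 2 ≤ 2 * C ^ 2 * (c + η) * ∫ ν in (0 : ℝ)..η, q ν ^ 2 := by
  have hη : 0 < η := lt_of_lt_of_le (by positivity) hcη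
  set I := ∫ ν in (0 : ℝ)..η, q ν
  have h1 : ∫ x in (0 : ℝ)..1, f x ^ 2 ≤
      ∫ x in (0 : ℝ)..1, (2 * C ^ 2 * q ((1 - x) / c) ^ 2 + 2 * C ^ 2 * I ^ 2) := by
    refine intervalIntegral.integral_mono_on zero_le_one hf
      (Continuous.intervalIntegrable (by fun_prop) _ _) fun x hx => ?_
    have := hfq x hx
    rw [← sq_abs]
    have h2 : |f x| ^ 2 ≤ (C * (q ((1 - x) / c) + I)) ^ 2 := by gcongr
    refine h2.trans ?_
    nlinarith [mul_nonneg (sq_nonneg C) (sq_nonneg (q ((1 - x) / c) - I))]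
  refine h1.trans ?_
  have e1 : ∫ x in (0 : ℝ)..1, q ((1 - x) / c) ^ 2 = c * ∫ ν in (0 : ℝ)..(1 / c), q ν ^ 2 := by
    have := intervalIntegral.integral_comp_sub_left (a := 0) (b := 1) (fun y => q (y / c) ^ 2) 1
    rw [this, intervalIntegral.integral_comp_div (fun y => q y ^ 2) hc.ne']
    simp
  have e2 : ∫ ν in (0 : ℝ)..(1 / c), q ν ^ 2 ≤ ∫ ν in (0 : ℝ)..η, q ν ^ 2 :=
    intervalIntegral.integral_mono_interval le_rfl (by positivity) hcη
      (.of_forall fun _ => sq_nonneg _) (Continuous.intervalIntegrable (by fun_prop) _ _)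
  rw [intervalIntegral.integral_add (Continuous.intervalIntegrable (by fun_prop) _ _) (by simp),
    intervalIntegral.integral_const_mul, e1]
  simp only [intervalIntegral.integral_const, sub_zero, one_smul]
  have e3 := sq_intervalIntegral_le hq hη
  have e4 := mul_le_mul_of_nonneg_left e2 hc.le
  have hC := sq_nonneg C
  nlinarith [mul_le_mul_of_nonneg_left e3 hC, mul_le_mul_of_nonneg_left e4 hC]

theorem windowNorm_sq_past {d : ℕ} {η : ℝ} (hη : 0 ≤ η) (φ : ℝ → Fin d → ℝ) (t : ℝ) :
    windowNorm η φ t ^ 2 = ∫ ν in (0 : ℝ)..η, ∑ l, φ (t - ν) l ^ 2 := by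
  have e : ∫ θ in (-η)..0, φ (t + θ) ⬝ᵥ φ (t + θ) = ∫ ν in (0 : ℝ)..η, ∑ l, φ (t - ν) l ^ 2 := by
    have := intervalIntegral.integral_comp_neg (a := 0) (b := η)
      (fun θ => φ (t + θ) ⬝ᵥ φ (t + θ))
    rw [neg_zero] at this
    rw [← this]
    simp only [dotProduct, sq, sub_eq_add_neg]
  rw [windowNorm, Real.sq_sqrt (abs_nonneg _), e, abs_of_nonneg]
  exact intervalIntegral.integral_nonneg hη fun _ _ => Finset.sum_nonneg fun _ _ => sq_nonneg _

theorem windowNorm_sq_future {d : ℕ} {η : ℝ} (hη : 0 ≤ η) (φ : ℝ → Fin d → ℝ) (t : ℝ) :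
    windowNorm (-η) φ t ^ 2 = ∫ ν in (0 : ℝ)..η, ∑ l, φ (t + ν) l ^ 2 := by
  have e : ∫ θ in (-(-η))..0, φ (t + θ) ⬝ᵥ φ (t + θ) =
      -∫ ν in (0 : ℝ)..η, ∑ l, φ (t + ν) l ^ 2 := by
    rw [neg_neg, intervalIntegral.integral_symm]
    simp only [dotProduct, sq]
  rw [windowNorm, Real.sq_sqrt (abs_nonneg _), e, abs_neg, abs_of_nonneg]
  exact intervalIntegral.integral_nonneg hη fun _ _ => Finset.sum_nonneg fun _ _ => sq_nonneg _

/-! ### Bounded measurable truncations of kernels and states -/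

/-- Bounded measurable functions. -/
def BddMeas {X : Type*} [MeasurableSpace X] (f : X → ℝ) : Prop :=
  Measurable f ∧ ∃ C, ∀ x, |f x| ≤ C

namespace BddMeas

variable {X Y : Type*} [MeasurableSpace X] [MeasurableSpace Y] {f g : X → ℝ}

theorem const (c : ℝ) : BddMeas fun _ : X => c := ⟨measurable_const, |c|, fun _ => le_rfl⟩

theorem add (hf : BddMeas f) (hg : BddMeas g) : BddMeas fun x => f x + g x := by
  obtain ⟨mf, C, hC⟩ := hf
  obtain ⟨mg, D, hD⟩ := hg
  exact ⟨mf.add mg, C + D, fun x => (abs_add_le _ _).trans (add_le_add (hC x) (hD x))⟩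

theorem neg (hf : BddMeas f) : BddMeas fun x => -f x := by
  obtain ⟨mf, C, hC⟩ := hf
  exact ⟨mf.neg, C, fun x => by rw [abs_neg]; exact hC x⟩

theorem mul (hf : BddMeas f) (hg : BddMeas g) : BddMeas fun x => f x * g x := by
  obtain ⟨mf, C, hC⟩ := hf
  obtain ⟨mg, D, hD⟩ := hg
  refine ⟨mf.mul mg, C * D, fun x => ?_⟩
  rw [abs_mul]
  exact mul_le_mul (hC x) (hD x) (abs_nonneg _) ((abs_nonneg _).trans (hC x))

theorem sum {ι : Type*} (s : Finset ι) {f : ι → X → ℝ} (hf : ∀ i, BddMeas (f i)) :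
    BddMeas fun x => ∑ i ∈ s, f i x := by
  choose mf C hC using hf
  exact ⟨Finset.measurable_fun_sum _ fun i _ => mf i, ∑ i ∈ s, C i, fun x =>
    (Finset.abs_sum_le_sum_abs _ _).trans (Finset.sum_le_sum fun i _ => hC i x)⟩

theorem comp (hf : BddMeas f) {u : Y → X} (hu : Measurable u) : BddMeas fun y => f (u y) :=
  ⟨hf.1.comp hu, hf.2.imp fun _ hC y => hC (u y)⟩

theorem intervalIntegrable {f : ℝ → ℝ} (hf : BddMeas f) (a b : ℝ) :
    IntervalIntegrable f volume a b :=
  intervalIntegrable_of_bound hf.1 fun x _ => hf.2.choose_spec x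

end BddMeas

theorem affine_nonneg {a b s σ : ℝ} (ha : 0 ≤ a) (hs : 0 ≤ a + b * s) (hσ : σ ∈ Icc 0 s) :
    0 ≤ a + b * σ := by
  rcases le_total 0 b with hb | hb
  · have := mul_nonneg hb hσ.1
    linarith
  · have := mul_le_mul_of_nonpos_left hσ.2 hb
    linarith

theorem transported_product_identity_of_bddMeas {A a B b : ℝ × ℝ → ℝ} {h p₀ p₁ q₀ q₁ c : ℝ}
    (h0 : 0 ≤ h) (hA : BddMeas A) (ha : BddMeas a) (hB : BddMeas B) (hb : BddMeas b)
    (hpq : ∀ r ∈ Icc 0 h, p₀ + p₁ * r ≤ q₀ + q₁ * r)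
    (hAT : ∀ y r s, 0 ≤ r → 0 ≤ s → r + s ≤ h → y ∈ Icc (p₀ + p₁ * r) (q₀ + q₁ * r) →
      y + c * s ∈ Icc (p₀ + p₁ * (r + s)) (q₀ + q₁ * (r + s)) →
      A (r + s, y + c * s) = A (r, y) + ∫ σ in (0 : ℝ)..s, a (r + σ, y + c * σ))
    (hBT : ∀ y r s, 0 ≤ r → 0 ≤ s → r + s ≤ h → y ∈ Icc (p₀ + p₁ * r) (q₀ + q₁ * r) →
      y + c * s ∈ Icc (p₀ + p₁ * (r + s)) (q₀ + q₁ * (r + s)) →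
      B (r + s, y + c * s) = B (r, y) + ∫ σ in (0 : ℝ)..s, b (r + σ, y + c * σ)) :
    IntervalIntegrable (fun r =>
      (∫ y in (p₀ + p₁ * r)..(q₀ + q₁ * r), (a (r, y) * B (r, y) + A (r, y) * b (r, y)))
      + ((q₁ - c) * (A (r, q₀ + q₁ * r) * B (r, q₀ + q₁ * r))
        - (p₁ - c) * (A (r, p₀ + p₁ * r) * B (r, p₀ + p₁ * r)))) volume 0 h ∧
    ∫ y in (p₀ + p₁ * h)..(q₀ + q₁ * h), A (h, y) * B (h, y) =
      (∫ y in p₀..q₀, A (0, y) * B (0, y)) + ∫ r in (0 : ℝ)..h,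
        ((∫ y in (p₀ + p₁ * r)..(q₀ + q₁ * r), (a (r, y) * B (r, y) + A (r, y) * b (r, y)))
        + ((q₁ - c) * (A (r, q₀ + q₁ * r) * B (r, q₀ + q₁ * r))
          - (p₁ - c) * (A (r, p₀ + p₁ * r) * B (r, p₀ + p₁ * r)))) := by
  obtain ⟨mA, C1, hC1⟩ := hA
  obtain ⟨ma, C2, hC2⟩ := ha
  obtain ⟨mB, C3, hC3⟩ := hB
  obtain ⟨mb, C4, hC4⟩ := hb
  exact transported_product_identity (A := fun r y => A (r, y)) (a := fun r y => a (r, y))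
    (B := fun r y => B (r, y)) (b := fun r y => b (r, y))
    (C := max (max C1 C2) (max C3 C4)) h0 mA ma mB mb
    (fun r y => (hC1 _).trans (by simp)) (fun r y => (hC2 _).trans (by simp))
    (fun r y => (hC3 _).trans (by simp)) (fun r y => (hC4 _).trans (by simp)) hpq hAT hBT

/-- On a compact set each of the finitely many continuous pieces is bounded, and preimages split
into finitely many measurable parts. -/
theorem PiecewiseContinuousOn.bddMeas {f : ℝ × ℝ → ℝ} {D : Set (ℝ × ℝ)}
    (hf : PiecewiseContinuousOn f D) (hD : IsCompact D) : BddMeas (D.indicator f) := by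
  obtain ⟨p, A, g, hA, hcov, hfg⟩ := hf
  have key : ∀ x ∈ D, ∃ k, x ∈ A k ∧ f x = g k x := fun x hx => by
    obtain ⟨k, hk⟩ := mem_iUnion.1 (hcov hx)
    exact ⟨k, hk, hfg k ⟨hk, hx⟩⟩
  constructor
  · intro B hB
    rw [indicator_preimage, Set.ite]
    refine MeasurableSet.union ?_ ((measurable_const hB).diff hD.measurableSet)
    have : f ⁻¹' B ∩ D = (⋃ k, A k ∩ g k ⁻¹' B) ∩ D := by
      ext x
      simp only [mem_preimage, mem_iUnion, mem_inter_iff]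
      constructor
      · rintro ⟨hB, hx⟩
        obtain ⟨k, hk, hk'⟩ := key x hx
        exact ⟨⟨k, hk, by rwa [← hk']⟩, hx⟩
      · rintro ⟨⟨l, hl, hl'⟩, hx⟩
        exact ⟨by rwa [hfg l ⟨hl, hx⟩], hx⟩
    rw [this]
    exact (MeasurableSet.iUnion fun k => (hA k).1.inter ((hA k).2.2.measurable hB)).inter
      hD.measurableSet
  · choose C hC using fun k => hD.exists_bound_of_continuousOn (hA k).2.2.continuousOn
    refine ⟨∑ k, |C k|, fun x => ?_⟩
    by_cases hx : x ∈ D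
    · rw [indicator_of_mem hx]
      obtain ⟨k, -, hk⟩ := key x hx
      rw [hk]
      exact ((hC k x hx).trans (le_abs_self _)).trans
        (Finset.single_le_sum (f := fun k => |C k|) (fun _ _ => abs_nonneg _) (Finset.mem_univ k))
    · rw [indicator_of_notMem hx, abs_zero]
      exact Finset.sum_nonneg fun _ _ => abs_nonneg _

theorem isCompact_upperTriangle : IsCompact upperTriangle := by
  refine (isCompact_Icc (a := (0 : ℝ)) (b := 1)).prod (isCompact_Icc (a := (0 : ℝ)) (b := 1))
    |>.of_isClosed_subset ?_ ?_
  · exact (isClosed_le continuous_const continuous_fst).inter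
      ((isClosed_le continuous_fst continuous_snd).inter
        (isClosed_le continuous_snd continuous_const))
  · rintro ⟨x, y⟩ ⟨h1, h2, h3⟩
    simp only at h1 h2 h3
    exact ⟨⟨h1, by simp only; linarith⟩, ⟨by simp only; linarith, h3⟩⟩

/-- The projection of the line onto `[0, T]`. -/
def clamp (T s : ℝ) : ℝ := max 0 (min s T)

theorem continuous_clamp (T : ℝ) : Continuous (clamp T) := by unfold clamp; fun_prop

theorem clamp_of_mem {T s : ℝ} (h : s ∈ Icc 0 T) : clamp T s = s := by
  rw [clamp, min_eq_left h.2, max_eq_right h.1]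

theorem clamp_mem {T : ℝ} (hT : 0 ≤ T) (s : ℝ) : clamp T s ∈ Icc 0 T :=
  ⟨le_max_left _ _, max_le hT (min_le_right _ _)⟩

/-- The integral identities ask for functions bounded and measurable on all of `ℝ`; composing with
`clamp` achieves this without changing values on the domain. -/
theorem bddMeas_clamp {f : ℝ → ℝ} {T : ℝ} (hT : 0 ≤ T) (hf : ContinuousOn f (Icc 0 T)) :
    BddMeas fun s => f (clamp T s) := by
  refine ⟨(hf.comp_continuous (continuous_clamp T) (clamp_mem hT)).measurable, ?_⟩
  obtain ⟨C, hC⟩ := isCompact_Icc.exists_bound_of_continuousOn hf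
  exact ⟨C, fun s => hC _ (clamp_mem hT s)⟩

theorem bddMeas_clamp₂ {f : ℝ × ℝ → ℝ} {T : ℝ} (hT : 0 ≤ T)
    (hf : ContinuousOn f (Icc 0 T ×ˢ Icc 0 1)) :
    BddMeas fun p : ℝ × ℝ => f (clamp T p.1, clamp 1 p.2) := by
  have hmem : ∀ p : ℝ × ℝ, (clamp T p.1, clamp 1 p.2) ∈ Icc 0 T ×ˢ Icc (0 : ℝ) 1 := fun p =>
    ⟨clamp_mem hT _, clamp_mem zero_le_one _⟩
  refine ⟨(hf.comp_continuous (((continuous_clamp T).comp continuous_fst).prodMk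
    ((continuous_clamp 1).comp continuous_snd)) hmem).measurable, ?_⟩
  obtain ⟨C, hC⟩ := (isCompact_Icc.prod isCompact_Icc).exists_bound_of_continuousOn hf
  exact ⟨C, fun p => hC _ (hmem p)⟩

/-! ### The equation satisfied by the Volterra part -/

namespace HyperbolicChain

variable {S : HyperbolicChain}

theorem vel_ne_zero {i : ℕ} (hi : i < S.N) (k : S.Idx i) : S.vel i k ≠ 0 := by
  rcases k with k | k
  · exact (S.lam_pos i hi k).ne'
  · exact neg_ne_zero.2 (S.mu_pos i hi k).ne'

theorem bddMeas_Sig {i : ℕ} (hi : i < S.N) (k l : S.Idx i) :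
    BddMeas fun x => S.Sig i (clamp 1 x) k l :=
  bddMeas_clamp (f := fun x => S.Sig i x k l) zero_le_one
    (continuousOn_pi.1 (continuousOn_pi.1 (S.Sig_cont i hi) k) l)

theorem IsStateKernel.bddMeas {i : ℕ} {K : ℝ → ℝ → Matrix (S.Idx i) (S.Idx i) ℝ}
    (hK : S.IsStateKernel i K) (k l : S.Idx i) :
    BddMeas (upperTriangle.indicator fun p => K p.1 p.2 k l) :=
  (hK.piecewise k l).bddMeas isCompact_upperTriangle

theorem IsStateKernel.bddMeas_G {i : ℕ} (hi : i < S.N)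
    {K : ℝ → ℝ → Matrix (S.Idx i) (S.Idx i) ℝ} (hK : S.IsStateKernel i K) (a b : Fin (S.n i)) :
    BddMeas fun x => S.G i K (clamp 1 x) a b := by
  simp only [G, Matrix.of_apply]
  split_ifs
  · refine (bddMeas_Sig hi _ _).add ((BddMeas.const _).mul ?_)
    have := (hK.bddMeas (Sum.inl a) (Sum.inl b)).comp
      (u := fun x : ℝ => (clamp 1 x, clamp 1 x))
      ((continuous_clamp 1).measurable.prodMk (continuous_clamp 1).measurable)
    convert this using 2 with x
    have := clamp_mem zero_le_one x
    rw [indicator_of_mem]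
    exact ⟨this.1, le_rfl, this.2⟩
  · exact BddMeas.const 0

theorem IsStateKernel.bddMeas_Gblock {i : ℕ} (hi : i < S.N)
    {K : ℝ → ℝ → Matrix (S.Idx i) (S.Idx i) ℝ} (hK : S.IsStateKernel i K) (k l : S.Idx i) :
    BddMeas fun x => S.Gblock i K (clamp 1 x) k l := by
  rcases k with k | k <;> rcases l with l | l
  · exact hK.bddMeas_G hi k l
  all_goals exact BddMeas.const 0

theorem IsSolution.bddMeas {U : ℝ → Fin (S.n 0) → ℝ} {w : S.State} (hw : S.IsSolution U w)
    {i : ℕ} (hi : i < S.N) {T : ℝ} (hT : 0 ≤ T) (k : S.Idx i) :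
    BddMeas fun p : ℝ × ℝ => w i (clamp T p.1) (clamp 1 p.2) k := by
  refine bddMeas_clamp₂ (f := fun p => w i p.1 p.2 k) hT ?_
  exact (continuousOn_pi.1 (hw.cont i hi) k).mono
    (prod_mono_left Icc_subset_Ici_self)

/-- The Volterra transformation `w(t,x) + ∫_x^1 K(x,y) w(t,y) dy` of the state of subsystem `i`. -/
def volterra (w : S.State) (i : ℕ) (K : ℝ → ℝ → Matrix (S.Idx i) (S.Idx i) ℝ) (t x : ℝ)
    (k : S.Idx i) : ℝ :=
  w i t x k + ∫ y in x..1, ((K x y).mulVec (w i t y)) k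

/-- Along the characteristic of row `k`, both `K_{kl}(X(r), y)` and `w_l(t+r, y)` are transported in
the direction `(1, c_l)` of the `(r, y)` plane, so the product rule applies to each `l`. The terms
in `Σ` cancel inside the triangle, the diagonal condition absorbs the terms at `y = X(r)`, and the
terms at `y = 1` remain as the outlet source. -/
theorem volterra_transport {U : ℝ → Fin (S.n 0) → ℝ} {w : S.State} (hw : S.IsSolution U w)
    {i : ℕ} (hi : i < S.N) {K : ℝ → ℝ → Matrix (S.Idx i) (S.Idx i) ℝ}
    (hK : S.IsStateKernel i K) (k : S.Idx i) {t x h : ℝ} (ht : 0 ≤ t) (h0 : 0 ≤ h)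
    (hx : x ∈ Icc (0 : ℝ) 1) (hxh : x + S.vel i k * h ∈ Icc (0 : ℝ) 1) :
    IntervalIntegrable (fun r =>
      ∑ m, S.Gblock i K (x + S.vel i k * r) k m * volterra w i K (t + r) (x + S.vel i k * r) m -
      ∑ l, K (x + S.vel i k * r) 1 k l * (S.vel i l * w i (t + r) 1 l)) volume 0 h ∧
    volterra w i K (t + h) (x + S.vel i k * h) k = volterra w i K t x k + ∫ r in (0 : ℝ)..h,
      (∑ m, S.Gblock i K (x + S.vel i k * r) k m * volterra w i K (t + r) (x + S.vel i k * r) m -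
      ∑ l, K (x + S.vel i k * r) 1 k l * (S.vel i l * w i (t + r) 1 l)) := by
  have hT : 0 ≤ t + h := by linarith
  set c := S.vel i with hc
  let X : ℝ → ℝ := fun r => x + c k * r
  have hX01 : ∀ r ∈ Icc 0 h, X r ∈ Icc (0 : ℝ) 1 := fun r hr => by
    refine ⟨affine_nonneg hx.1 hxh.1 hr, ?_⟩
    have := affine_nonneg (a := 1 - x) (b := -c k) (by linarith [hx.2]) (by linarith [hxh.2]) hr
    simp only [X]; linarith
  let Kt : S.Idx i → S.Idx i → ℝ × ℝ → ℝ := fun m l =>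
    upperTriangle.indicator fun p => K p.1 p.2 m l
  let wt : S.Idx i → ℝ × ℝ → ℝ := fun l p => w i (clamp (t + h) p.1) (clamp 1 p.2) l
  have hKt : ∀ m l, BddMeas (Kt m l) := fun m l => hK.bddMeas m l
  have hwt : ∀ l, BddMeas (wt l) := fun l => hw.bddMeas hi hT l
  let KX : S.Idx i → S.Idx i → ℝ × ℝ → ℝ := fun m l p => Kt m l (X p.1, p.2)
  let B : S.Idx i → ℝ × ℝ → ℝ := fun l p => wt l (t + p.1, p.2)
  let a : S.Idx i → ℝ × ℝ → ℝ := fun l p => -(∑ m, KX k m p * S.Sig i (clamp 1 p.2) m l) +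
    ∑ m, S.Gblock i K (clamp 1 (X p.1)) k m * KX m l p
  let b : S.Idx i → ℝ × ℝ → ℝ := fun l p => ∑ m, S.Sig i (clamp 1 p.2) l m * B m p
  have mX : Measurable X := by simp only [X]; fun_prop
  have hKX : ∀ m l, BddMeas (KX m l) := fun m l =>
    (hKt m l).comp (u := fun p : ℝ × ℝ => (X p.1, p.2))
      ((mX.comp measurable_fst).prodMk measurable_snd)
  have hB : ∀ l, BddMeas (B l) := fun l =>
    (hwt l).comp (u := fun p : ℝ × ℝ => (t + p.1, p.2)) (by fun_prop)
  have hSg : ∀ m l, BddMeas fun p : ℝ × ℝ => S.Sig i (clamp 1 p.2) m l := fun m l =>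
    (bddMeas_Sig hi m l).comp measurable_snd
  have hG : ∀ m l, BddMeas fun p : ℝ × ℝ => S.Gblock i K (clamp 1 (X p.1)) m l := fun m l =>
    (hK.bddMeas_Gblock hi m l).comp (mX.comp measurable_fst)
  have ha : ∀ l, BddMeas (a l) := fun l =>
    (BddMeas.sum _ fun m => (hKX k m).mul (hSg m l)).neg.add
      (BddMeas.sum _ fun m => (hG k m).mul (hKX m l))
  have hb : ∀ l, BddMeas (b l) := fun l => BddMeas.sum _ fun m => (hSg l m).mul (hB m)
  have eKX : ∀ r ∈ Icc 0 h, ∀ y ∈ Icc (X r) 1, ∀ m l, KX m l (r, y) = K (X r) y m l := by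
    intro r hr y hy m l
    exact indicator_of_mem (show (X r, y) ∈ upperTriangle from ⟨(hX01 r hr).1, hy.1, hy.2⟩) _
  have y01 : ∀ r ∈ Icc 0 h, ∀ y ∈ Icc (X r) 1, y ∈ Icc (0 : ℝ) 1 := fun r hr y hy =>
    ⟨(hX01 r hr).1.trans hy.1, hy.2⟩
  have eB : ∀ r ∈ Icc 0 h, ∀ y ∈ Icc (0 : ℝ) 1, ∀ l, B l (r, y) = w i (t + r) y l := by
    intro r hr y hy l
    simp only [B, wt]
    rw [clamp_of_mem ⟨by linarith [hr.1], by linarith [hr.2]⟩, clamp_of_mem hy]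
  have ea : ∀ r ∈ Icc 0 h, ∀ y ∈ Icc (X r) 1, ∀ l, a l (r, y) =
      (-(K (X r) y * S.Sig i y) + S.Gblock i K (X r) * K (X r) y) k l := by
    intro r hr y hy l
    simp only [a, eKX r hr y hy, clamp_of_mem (y01 r hr y hy), clamp_of_mem (hX01 r hr),
      Matrix.add_apply, Matrix.neg_apply, Matrix.mul_apply]
  have eb : ∀ r ∈ Icc 0 h, ∀ y ∈ Icc (0 : ℝ) 1, ∀ l, b l (r, y) =
      ((S.Sig i y).mulVec (w i (t + r) y)) l := by
    intro r hr y hy l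
    simp only [b, eB r hr y hy, clamp_of_mem hy, Matrix.mulVec, dotProduct]
  have seg : ∀ l y r s, 0 ≤ r → 0 ≤ s → r + s ≤ h → y ∈ Icc (x + c k * r) (1 + 0 * r) →
      y + c l * s ∈ Icc (x + c k * (r + s)) (1 + 0 * (r + s)) →
      ∀ σ ∈ Icc 0 s, r + σ ∈ Icc 0 h ∧ y + c l * σ ∈ Icc (X (r + σ)) 1 := by
    intro l y r s hr hs hrs hy hys σ hσ
    refine ⟨⟨by linarith [hσ.1], by linarith [hσ.2]⟩, ?_, ?_⟩
    · have := affine_nonneg (a := y - (x + c k * r)) (b := c l - c k) (by linarith [hy.1])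
        (by linarith [hys.1]) hσ
      simp only [X]; linarith
    · have := affine_nonneg (a := 1 - y) (b := -c l) (by linarith [hy.2])
        (by linarith [hys.2]) hσ
      linarith
  -- The lower end moves with speed `c k`, the upper end `y = 1` is fixed, and the transport speed
  -- is `c l`.
  have main := fun l => transported_product_identity_of_bddMeas (A := KX k l) (a := a l) (B := B l)
    (b := b l) (h := h) (p₀ := x) (p₁ := c k) (q₀ := 1) (q₁ := 0) (c := c l) h0 (hKX k l) (ha l)
    (hB l) (hb l) (fun r hr => by simpa using (hX01 r hr).2)
    (fun y r s hr hs hrs hy hys => by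
      have sg := seg l y r s hr hs hrs hy hys
      obtain ⟨g1, g2⟩ := sg 0 ⟨le_rfl, hs⟩
      obtain ⟨g3, g4⟩ := sg s ⟨hs, le_rfl⟩
      rw [add_zero] at g1
      rw [add_zero, mul_zero, add_zero] at g2
      rw [eKX _ g3 _ g4, eKX _ g1 _ g2]
      have e1 : ∀ σ, X (r + σ) = X r + c k * σ := fun σ => by simp only [X]; ring
      rw [e1, hK.transport k l (X r) y s hs ⟨(hX01 r g1).1, g2.1, g2.2⟩
        ⟨by rw [← hc, ← e1]; exact (hX01 _ g3).1, by rw [← hc, ← e1]; exact g4.1, g4.2⟩]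
      congr 1
      refine intervalIntegral.integral_congr fun σ hσ => ?_
      rw [uIcc_of_le hs] at hσ
      obtain ⟨g5, g6⟩ := sg σ hσ
      rw [ea _ g5 _ g6, e1])
    (fun y r s hr hs hrs hy hys => by
      have sg := seg l y r s hr hs hrs hy hys
      obtain ⟨g1, g2⟩ := sg 0 ⟨le_rfl, hs⟩
      obtain ⟨g3, g4⟩ := sg s ⟨hs, le_rfl⟩
      rw [add_zero] at g1
      rw [add_zero, mul_zero, add_zero] at g2
      rw [eB _ g3 _ (y01 _ g3 _ g4), eB _ g1 _ (y01 _ g1 _ g2), ← add_assoc]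
      rw [hw.transport i hi l (t + r) y s (by linarith) hs (y01 _ g1 _ g2) (y01 _ g3 _ g4)]
      congr 1
      refine intervalIntegral.integral_congr fun σ hσ => ?_
      rw [uIcc_of_le hs] at hσ
      obtain ⟨g5, g6⟩ := sg σ hσ
      rw [eb _ g5 _ (y01 _ g5 _ g6), add_assoc])
  simp only [zero_mul, add_zero, zero_sub] at main
  change ∀ l, IntervalIntegrable (fun r => (∫ y in X r..1, (a l (r, y) * B l (r, y) +
    KX k l (r, y) * b l (r, y))) + (-c l * (KX k l (r, 1) * B l (r, 1)) -
      (c k - c l) * (KX k l (r, X r) * B l (r, X r)))) volume 0 h ∧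
    ∫ y in X h..1, KX k l (h, y) * B l (h, y) = (∫ y in x..1, KX k l (0, y) * B l (0, y)) +
      ∫ r in (0 : ℝ)..h, ((∫ y in X r..1, (a l (r, y) * B l (r, y) +
    KX k l (r, y) * b l (r, y))) + (-c l * (KX k l (r, 1) * B l (r, 1)) -
      (c k - c l) * (KX k l (r, X r) * B l (r, X r)))) at main
  have iKB : ∀ m l r u v, IntervalIntegrable (fun y => KX m l (r, y) * B l (r, y)) volume u v :=
    fun m l r u v => (((hKX m l).mul (hB l)).comp (u := fun y : ℝ => (r, y))
      (by fun_prop)).intervalIntegrable u v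
  have evol : ∀ r ∈ Icc 0 h, ∀ m, volterra w i K (t + r) (X r) m =
      w i (t + r) (X r) m + ∑ l, ∫ y in X r..1, KX m l (r, y) * B l (r, y) := by
    intro r hr m
    rw [volterra, ← intervalIntegral.integral_finsetSum fun l _ => iKB m l r _ _]
    congr 1
    refine intervalIntegral.integral_congr fun y hy => ?_
    rw [uIcc_of_le (hX01 r hr).2] at hy
    simp only [Matrix.mulVec, dotProduct, eKX r hr y hy, eB r hr y (y01 r hr y hy)]
  have h0m : (0 : ℝ) ∈ Icc 0 h := ⟨le_rfl, h0⟩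
  have hhm : h ∈ Icc 0 h := ⟨h0, le_rfl⟩
  have hX0 : X 0 = x := by simp [X]
  -- the equation satisfied by the untransformed component
  have ew : w i (t + h) (X h) k = w i t x k + ∫ r in (0 : ℝ)..h, b k (r, X r) := by
    rw [hw.transport i hi k t x h ht h0 hx hxh]
    congr 1
    refine intervalIntegral.integral_congr fun r hr => ?_
    rw [uIcc_of_le h0] at hr
    exact (eb r hr _ (hX01 r hr) k).symm
  have iw : IntervalIntegrable (fun r => b k (r, X r)) volume 0 h :=
    ((hb k).comp (u := fun r => (r, X r)) (measurable_id.prodMk mX)).intervalIntegrable _ _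
  set Φ : S.Idx i → ℝ → ℝ := fun l r => (∫ y in X r..1, (a l (r, y) * B l (r, y) +
    KX k l (r, y) * b l (r, y))) + (-c l * (KX k l (r, 1) * B l (r, 1)) -
      (c k - c l) * (KX k l (r, X r) * B l (r, X r))) with hΦ
  have iΦ : IntervalIntegrable (fun r => ∑ l, Φ l r) volume 0 h :=
    intervalIntegrable_finsetSum _ fun l _ => (main l).1
  have etot : volterra w i K (t + h) (X h) k = volterra w i K t x k +
      ∫ r in (0 : ℝ)..h, (b k (r, X r) + ∑ l, Φ l r) := by
    have e0 := evol 0 h0m k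
    rw [hX0, add_zero] at e0
    rw [evol h hhm, e0, ew, intervalIntegral.integral_add iw iΦ,
      intervalIntegral.integral_finsetSum fun l _ => (main l).1,
      Finset.sum_congr rfl fun l _ => (main l).2, Finset.sum_add_distrib]
    ring
  have ept : ∀ r ∈ Icc 0 h, X r ≠ 1 → b k (r, X r) + ∑ l, Φ l r =
      ∑ m, S.Gblock i K (X r) k m * volterra w i K (t + r) (X r) m -
      ∑ l, K (X r) 1 k l * (c l * w i (t + r) 1 l) := by
    intro r hr hne
    have hXr := hX01 r hr
    have iab : ∀ l, IntervalIntegrable (fun y => a l (r, y) * B l (r, y) +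
        KX k l (r, y) * b l (r, y)) volume (X r) 1 := fun l =>
      ((((ha l).mul (hB l)).add ((hKX k l).mul (hb l))).comp (u := fun y : ℝ => (r, y))
        (by fun_prop)).intervalIntegrable _ _
    -- The terms `-KΣw` from the kernel and `KΣw` from the state cancel after exchanging the
    -- summation indices; only `G K w` survives.
    have eint : ∑ l, ∫ y in X r..1, (a l (r, y) * B l (r, y) + KX k l (r, y) * b l (r, y)) =
        ∑ m, S.Gblock i K (X r) k m * ∑ l, ∫ y in X r..1, KX m l (r, y) * B l (r, y) := by
      rw [← intervalIntegral.integral_finsetSum fun l _ => iab l]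
      have : ∀ m, S.Gblock i K (X r) k m * ∑ l, ∫ y in X r..1, KX m l (r, y) * B l (r, y) =
          ∫ y in X r..1, ∑ l, S.Gblock i K (X r) k m * (KX m l (r, y) * B l (r, y)) := by
        intro m
        rw [intervalIntegral.integral_finsetSum fun l _ => (iKB m l r _ _).const_mul _,
          Finset.mul_sum]
        exact Finset.sum_congr rfl fun l _ => (intervalIntegral.integral_const_mul _ _).symm
      simp only [this]
      rw [← intervalIntegral.integral_finsetSum fun m _ =>
        intervalIntegrable_finsetSum _ fun l _ => (iKB m l r _ _).const_mul _]
      refine intervalIntegral.integral_congr fun y _ => ?_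
      simp only [a, b, clamp_of_mem hXr, add_mul, neg_mul, Finset.sum_mul, Finset.mul_sum,
        Finset.sum_add_distrib, Finset.sum_neg_distrib]
      rw [Finset.sum_comm (f := fun l m => KX k m (r, y) * S.Sig i (clamp 1 y) m l * B l (r, y)),
        Finset.sum_comm (f := fun l m => S.Gblock i K (X r) k m * KX m l (r, y) * B l (r, y))]
      simp only [mul_assoc]
      ring
    -- The commutator condition on the diagonal is exactly what turns `Σ w` into `G w`.
    have ediag : b k (r, X r) - ∑ l, (c k - c l) * (KX k l (r, X r) * B l (r, X r)) =
        ∑ m, S.Gblock i K (X r) k m * w i (t + r) (X r) m := by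
      rw [eb r hr _ hXr, Matrix.mulVec, dotProduct, ← Finset.sum_sub_distrib]
      refine Finset.sum_congr rfl fun l _ => ?_
      rw [eKX r hr _ ⟨le_rfl, hXr.2⟩, eB r hr _ hXr]
      have := congrFun (congrFun (hK.diag_bc (X r) ⟨hXr.1, lt_of_le_of_ne hXr.2 hne⟩) k) l
      rw [Matrix.sub_apply, Matrix.sub_apply, Matrix.diagonal_mul, Matrix.mul_diagonal] at this
      linear_combination (-w i (t + r) (X r) l) * this
    have eend : ∑ l, -c l * (KX k l (r, 1) * B l (r, 1)) =
        -∑ l, K (X r) 1 k l * (c l * w i (t + r) 1 l) := by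
      rw [← Finset.sum_neg_distrib]
      refine Finset.sum_congr rfl fun l _ => ?_
      rw [eKX r hr 1 ⟨hXr.2, le_rfl⟩, eB r hr 1 ⟨zero_le_one, le_rfl⟩]
      ring
    simp only [hΦ, Finset.sum_add_distrib, Finset.sum_sub_distrib, evol r hr, mul_add]
    rw [eint, eend, ← ediag]
    ring
  -- The diagonal condition is not available at the corner `x = 1`; as the velocity is nonzero, the
  -- characteristic meets it at a single `r` at most.
  have hae : ∀ᵐ r : ℝ, X r ≠ 1 := by
    filter_upwards [Measure.ae_ne volume ((1 - x) / c k)] with r hr h1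
    apply hr
    rw [eq_div_iff (vel_ne_zero hi k)]
    simp only [X] at h1
    linarith
  have hcongr : ∀ᵐ r : ℝ, r ∈ uIoc 0 h → b k (r, X r) + ∑ l, Φ l r =
      ∑ m, S.Gblock i K (X r) k m * volterra w i K (t + r) (X r) m -
      ∑ l, K (X r) 1 k l * (c l * w i (t + r) 1 l) := by
    filter_upwards [hae] with r hr hmem
    rw [uIoc_of_le h0] at hmem
    exact ept r (Ioc_subset_Icc_self hmem) hr
  constructor
  · exact (iw.add iΦ).congr_ae ((ae_restrict_iff' measurableSet_uIoc).2 hcongr)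
  · rw [← intervalIntegral.integral_congr_ae hcongr]
    exact etot

end HyperbolicChain

/-! ### The delayed part and the decoupled equations -/

namespace HyperbolicChain

variable {S : HyperbolicChain}

theorem lam1_pos {i : ℕ} (hi : i < S.N) : 0 < S.lam1 i := S.lam_pos i hi 0

theorem mu1_pos {i : ℕ} (hi : i < S.N) : 0 < S.mu1 i := S.mu_pos i hi 0

theorem lam1_le {i : ℕ} (hi : i < S.N) (j : Fin (S.n i)) : S.lam1 i ≤ S.lam i j :=
  (S.lam_mono i hi).monotone (Fin.zero_le j)

theorem mu1_le {i : ℕ} (hi : i < S.N) (j : Fin (S.m i)) : S.mu1 i ≤ S.mu i j :=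
  (S.mu_mono i hi).monotone (Fin.zero_le j)

theorem isCompact_delayTriangle {i : ℕ} (hi : i < S.N) : IsCompact (S.delayTriangle i) := by
  have h1 := lam1_pos hi
  refine (isCompact_Icc (a := (0 : ℝ)) (b := 1)).prod (isCompact_Icc (a := 0) (b := 1 / S.lam1 i))
    |>.of_isClosed_subset ?_ ?_
  · exact (isClosed_le continuous_const continuous_fst).inter
      ((isClosed_le continuous_fst continuous_const).inter
        ((isClosed_le continuous_const continuous_snd).inter
          (isClosed_le continuous_snd (continuous_fst.div_const _))))
  · rintro ⟨x, y⟩ ⟨h2, h3, h4, h5⟩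
    exact ⟨⟨h2, h3⟩, h4, h5.trans (div_le_div_of_nonneg_right h3 h1.le)⟩

theorem IsDelayKernel.bddMeas {i : ℕ} (hi : i < S.N)
    {K : ℝ → ℝ → Matrix (S.Idx i) (S.Idx i) ℝ}
    {F : ℝ → ℝ → Matrix (Fin (S.n i)) (Fin (S.m (i + 1))) ℝ} (hF : S.IsDelayKernel i K F)
    (k : Fin (S.n i)) (l : Fin (S.m (i + 1))) :
    BddMeas ((S.delayTriangle i).indicator fun p => F p.1 p.2 k l) :=
  (hF.piecewise k l).bddMeas (isCompact_delayTriangle hi)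

/-- The delayed part `∫_0^{x/λ_i^1} F(x,y) z(t-y) dy` of the transformation. -/
def delayPart (i : ℕ) (F : ℝ → ℝ → Matrix (Fin (S.n i)) (Fin (S.m (i + 1))) ℝ)
    (z : ℝ → Fin (S.m (i + 1)) → ℝ) (t x : ℝ) (a : Fin (S.n i)) : ℝ :=
  ∫ y in (0 : ℝ)..(x / S.lam1 i), ((F x y).mulVec (z (t - y))) a

/-- In the `(r, y)` plane `z(t + r - y)` is constant in the direction `(1, 1)`, which is also the
direction in which `F` is transported when `x` follows row `k`. The end `y = 0` yields the source
`F(x,0) z`, and the moving edge contributes nothing. -/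
theorem delayPart_transport {i : ℕ} (hi : i < S.N) {K : ℝ → ℝ → Matrix (S.Idx i) (S.Idx i) ℝ}
    (hK : S.IsStateKernel i K) {F : ℝ → ℝ → Matrix (Fin (S.n i)) (Fin (S.m (i + 1))) ℝ}
    (hF : S.IsDelayKernel i K F) {z : ℝ → Fin (S.m (i + 1)) → ℝ} (hz : ContinuousOn z (Ici 0))
    (k : Fin (S.n i)) {t x h : ℝ} (ht : 0 ≤ t) (h0 : 0 ≤ h)
    (hx : 0 ≤ x) (hxh : x + S.lam i k * h ≤ 1) (hmem : (x + S.lam i k * h) / S.lam1 i ≤ t + h) :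
    IntervalIntegrable (fun r =>
      ∑ m, S.G i K (x + S.lam i k * r) k m * delayPart i F z (t + r) (x + S.lam i k * r) m +
      ∑ l, F (x + S.lam i k * r) 0 k l * z (t + r) l) volume 0 h ∧
    delayPart i F z (t + h) (x + S.lam i k * h) k = delayPart i F z t x k + ∫ r in (0 : ℝ)..h,
      (∑ m, S.G i K (x + S.lam i k * r) k m * delayPart i F z (t + r) (x + S.lam i k * r) m +
      ∑ l, F (x + S.lam i k * r) 0 k l * z (t + r) l) := by
  have hT : 0 ≤ t + h := by linarith
  have h1 := lam1_pos hi
  have hck := S.lam_pos i hi k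
  have hc1 := lam1_le hi k
  set c := S.lam i with hc
  set L := S.lam1 i with hL
  let X : ℝ → ℝ := fun r => x + c k * r
  have hX01 : ∀ r ∈ Icc 0 h, X r ∈ Icc (0 : ℝ) 1 := fun r hr => by
    have h2 := mul_le_mul_of_nonneg_left hr.2 hck.le
    have h3 := mul_nonneg hck.le hr.1
    exact ⟨by simp only [X]; linarith, by simp only [X]; linarith⟩
  let Ft : Fin (S.n i) → Fin (S.m (i + 1)) → ℝ × ℝ → ℝ := fun m l =>
    (S.delayTriangle i).indicator fun p => F p.1 p.2 m l
  have hFt : ∀ m l, BddMeas (Ft m l) := fun m l => hF.bddMeas hi m l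
  have hzt : ∀ l, BddMeas fun s => z (clamp (t + h) s) l := fun l =>
    bddMeas_clamp (f := fun s => z s l) hT ((continuousOn_pi.1 hz l).mono Icc_subset_Ici_self)
  let FX : Fin (S.n i) → Fin (S.m (i + 1)) → ℝ × ℝ → ℝ := fun m l p => Ft m l (X p.1, p.2)
  let B : Fin (S.m (i + 1)) → ℝ × ℝ → ℝ := fun l p => z (clamp (t + h) (t + p.1 - p.2)) l
  let a : Fin (S.m (i + 1)) → ℝ × ℝ → ℝ := fun l p =>
    ∑ m, S.G i K (clamp 1 (X p.1)) k m * FX m l p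
  have mX : Measurable X := by simp only [X]; fun_prop
  have hFX : ∀ m l, BddMeas (FX m l) := fun m l =>
    (hFt m l).comp (u := fun p : ℝ × ℝ => (X p.1, p.2))
      ((mX.comp measurable_fst).prodMk measurable_snd)
  have hB : ∀ l, BddMeas (B l) := fun l =>
    (hzt l).comp (u := fun p : ℝ × ℝ => t + p.1 - p.2) (by fun_prop)
  have hG : ∀ m l, BddMeas fun p : ℝ × ℝ => S.G i K (clamp 1 (X p.1)) m l := fun m l =>
    (hK.bddMeas_G hi m l).comp (mX.comp measurable_fst)
  have ha : ∀ l, BddMeas (a l) := fun l => BddMeas.sum _ fun m => (hG k m).mul (hFX m l)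
  have eFX : ∀ r ∈ Icc 0 h, ∀ y ∈ Icc 0 (X r / L), ∀ m l, FX m l (r, y) = F (X r) y m l := by
    intro r hr y hy m l
    exact indicator_of_mem (show (X r, y) ∈ S.delayTriangle i from
      ⟨(hX01 r hr).1, (hX01 r hr).2, hy.1, hy.2⟩) _
  -- The condition at the end of the segment implies it at earlier points, because `c k ≥ L`; thus
  -- `z` is only evaluated at nonnegative times.
  have hle : ∀ r ∈ Icc 0 h, X r / L ≤ t + r := by
    intro r hr
    have e3 : (x + c k * h) / L - X r / L = (h - r) * (c k / L) := by
      simp only [X]; field_simp; ring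
    have e4 : h - r ≤ (h - r) * (c k / L) :=
      le_mul_of_one_le_right (by linarith [hr.2]) ((one_le_div h1).2 hc1)
    linarith
  have eB : ∀ r ∈ Icc 0 h, ∀ y ∈ Icc 0 (X r / L), ∀ l, B l (r, y) = z (t + r - y) l := by
    intro r hr y hy l
    simp only [B]
    rw [clamp_of_mem ⟨by linarith [hle r hr, hy.2], by linarith [hr.2, hy.1]⟩]
  have ea : ∀ r ∈ Icc 0 h, ∀ y ∈ Icc 0 (X r / L), ∀ l, a l (r, y) =
      (S.G i K (X r) * F (X r) y) k l := by
    intro r hr y hy l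
    simp only [a, eFX r hr y hy, clamp_of_mem (hX01 r hr), Matrix.mul_apply]
  have eXL : ∀ r, x / L + c k / L * r = X r / L := fun r => by simp only [X]; ring
  -- The edge `y = X(r)/L` moves with speed `c k / L`; the second factor is constant along `(1, 1)`,
  -- hence `b = 0`.
  have main := fun l => transported_product_identity_of_bddMeas (A := FX k l) (a := a l) (B := B l)
    (b := fun _ => 0) (h := h) (p₀ := 0) (p₁ := 0) (q₀ := x / L) (q₁ := c k / L) (c := 1) h0
    (hFX k l) (ha l) (hB l) (BddMeas.const 0)
    (fun r hr => by
      rw [eXL, zero_mul, add_zero]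
      exact div_nonneg (hX01 r hr).1 h1.le)
    (fun y r s hr hs hrs hy hys => by
      rw [eXL, zero_mul, add_zero] at hy hys
      rw [one_mul] at hys ⊢
      have e1 : ∀ σ, X (r + σ) = X r + c k * σ := fun σ => by simp only [X]; ring
      have g1 : r ∈ Icc 0 h := ⟨hr, by linarith⟩
      have g3 : r + s ∈ Icc 0 h := ⟨by linarith, hrs⟩
      rw [eFX _ g3 _ hys, eFX _ g1 _ hy]
      rw [e1, hF.transport k l (X r) y s hs ⟨(hX01 r g1).1, (hX01 r g1).2, hy.1, hy.2⟩
        (by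
          rw [← hc, ← e1]
          exact ⟨(hX01 _ g3).1, (hX01 _ g3).2, hys.1, hys.2⟩)]
      congr 1
      refine intervalIntegral.integral_congr fun σ hσ => ?_
      rw [uIcc_of_le hs] at hσ
      have g5 : r + σ ∈ Icc 0 h := ⟨by linarith [hσ.1], by linarith [hσ.2]⟩
      have g6 : y + σ ∈ Icc 0 (X (r + σ) / L) := by
        refine ⟨by linarith [hσ.1, hy.1], ?_⟩
        have := affine_nonneg (a := X r / L - y) (b := c k / L - 1) (by linarith [hy.2])
          (by
            have := hys.2
            rw [e1, add_div, mul_div_right_comm] at this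
            linarith) hσ
        rw [e1, add_div, mul_div_right_comm]
        linarith
      simp only [one_mul]
      rw [ea _ g5 _ g6, e1])
    (fun y r s _ _ _ _ _ => by
      have : t + (r + s) - (y + 1 * s) = t + r - y := by ring
      simp only [B, this, intervalIntegral.integral_zero, add_zero])
  simp only [eXL, zero_mul, add_zero, mul_zero, zero_sub, neg_mul, one_mul, sub_neg_eq_add] at main
  have iFB : ∀ m l r u v, IntervalIntegrable (fun y => FX m l (r, y) * B l (r, y)) volume u v :=
    fun m l r u v => (((hFX m l).mul (hB l)).comp (u := fun y : ℝ => (r, y))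
      (by fun_prop)).intervalIntegrable u v
  have hX0L : ∀ r ∈ Icc 0 h, 0 ≤ X r / L := fun r hr => div_nonneg (hX01 r hr).1 h1.le
  have eD : ∀ r ∈ Icc 0 h, ∀ m, delayPart i F z (t + r) (X r) m =
      ∑ l, ∫ y in (0 : ℝ)..(X r / L), FX m l (r, y) * B l (r, y) := by
    intro r hr m
    rw [delayPart, ← intervalIntegral.integral_finsetSum fun l _ => iFB m l r _ _]
    refine intervalIntegral.integral_congr fun y hy => ?_
    rw [← hL, uIcc_of_le (hX0L r hr)] at hy
    simp only [Matrix.mulVec, dotProduct, eFX r hr y hy, eB r hr y hy]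
  have h0m : (0 : ℝ) ∈ Icc 0 h := ⟨le_rfl, h0⟩
  have hhm : h ∈ Icc 0 h := ⟨h0, le_rfl⟩
  have hX0 : X 0 = x := by simp [X]
  set Φ : Fin (S.m (i + 1)) → ℝ → ℝ := fun l r =>
    (∫ y in (0 : ℝ)..(X r / L), a l (r, y) * B l (r, y)) +
      ((c k / L - 1) * (FX k l (r, X r / L) * B l (r, X r / L)) + FX k l (r, 0) * B l (r, 0))
    with hΦ
  have iΦ : IntervalIntegrable (fun r => ∑ l, Φ l r) volume 0 h :=
    intervalIntegrable_finsetSum _ fun l _ => (main l).1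
  have etot : delayPart i F z (t + h) (X h) k = delayPart i F z t x k +
      ∫ r in (0 : ℝ)..h, ∑ l, Φ l r := by
    have e0 := eD 0 h0m k
    rw [hX0, add_zero] at e0
    rw [eD h hhm, e0, intervalIntegral.integral_finsetSum fun l _ => (main l).1,
      Finset.sum_congr rfl fun l _ => (main l).2, Finset.sum_add_distrib]
  have ept : ∀ r ∈ Ioc 0 h, ∑ l, Φ l r =
      ∑ m, S.G i K (X r) k m * delayPart i F z (t + r) (X r) m +
      ∑ l, F (X r) 0 k l * z (t + r) l := by
    intro r hr'
    have hr := Ioc_subset_Icc_self hr'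
    have hXr := hX01 r hr
    have iab : ∀ l, IntervalIntegrable (fun y => a l (r, y) * B l (r, y)) volume 0 (X r / L) :=
      fun l => (((ha l).mul (hB l)).comp (u := fun y : ℝ => (r, y))
        (by fun_prop)).intervalIntegrable _ _
    have eint : ∑ l, ∫ y in (0 : ℝ)..(X r / L), a l (r, y) * B l (r, y) =
        ∑ m, S.G i K (X r) k m * ∑ l, ∫ y in (0 : ℝ)..(X r / L), FX m l (r, y) * B l (r, y) := by
      rw [← intervalIntegral.integral_finsetSum fun l _ => iab l]
      have : ∀ m, S.G i K (X r) k m *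
          ∑ l, ∫ y in (0 : ℝ)..(X r / L), FX m l (r, y) * B l (r, y) =
          ∫ y in (0 : ℝ)..(X r / L), ∑ l, S.G i K (X r) k m * (FX m l (r, y) * B l (r, y)) := by
        intro m
        rw [intervalIntegral.integral_finsetSum fun l _ => (iFB m l r _ _).const_mul _,
          Finset.mul_sum]
        exact Finset.sum_congr rfl fun l _ => (intervalIntegral.integral_const_mul _ _).symm
      simp only [this]
      rw [← intervalIntegral.integral_finsetSum fun m _ =>
        intervalIntegrable_finsetSum _ fun l _ => (iFB m l r _ _).const_mul _]
      refine intervalIntegral.integral_congr fun y _ => ?_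
      simp only [a, clamp_of_mem hXr, Finset.sum_mul]
      rw [Finset.sum_comm]
      simp only [mul_assoc]
    -- In the first row the edge is itself characteristic, so the factor vanishes; in the other rows
    -- `F` vanishes on the edge.
    have eedge : ∀ l, (c k / L - 1) * (FX k l (r, X r / L) * B l (r, X r / L)) = 0 := by
      intro l
      by_cases hk : k = 0
      · have : c k = L := by rw [hk]; rfl
        rw [this, div_self h1.ne']
        ring
      · have hpos : 0 < X r := by
          have := mul_pos hck hr'.1
          simp only [X]; linarith
        rw [eFX r hr _ ⟨hX0L r hr, le_rfl⟩, hL, hF.edge_bc (X r) ⟨hpos, hXr.2⟩ k l hk]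
        ring
    simp only [hΦ, Finset.sum_add_distrib, eD r hr, eedge, zero_add]
    rw [eint]
    congr 1
    refine Finset.sum_congr rfl fun l _ => ?_
    rw [eFX r hr 0 ⟨le_rfl, hX0L r hr⟩, eB r hr 0 ⟨le_rfl, hX0L r hr⟩, sub_zero]
  constructor
  · refine iΦ.congr fun r hr => ?_
    rw [uIoc_of_le h0] at hr
    exact ept r hr
  · have hcongr : ∀ᵐ r : ℝ, r ∈ uIoc 0 h → ∑ l, Φ l r =
        ∑ m, S.G i K (X r) k m * delayPart i F z (t + r) (X r) m +
          ∑ l, F (X r) 0 k l * z (t + r) l := .of_forall fun r hr => by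
      rw [uIoc_of_le h0] at hr
      exact ept r hr
    rw [← intervalIntegral.integral_congr_ae hcongr]
    exact etot

theorem target_inl (K : S.StateKernels) (F : S.DelayKernels) (w : S.State) (i : ℕ) (t x : ℝ)
    (a : Fin (S.n i)) : target K F w i t x (Sum.inl a) = volterra w i (K i) t x (Sum.inl a) +
      delayPart i (F i) (fun s => v w (i + 1) s 0) t x a := rfl

theorem target_inr (K : S.StateKernels) (F : S.DelayKernels) (w : S.State) (i : ℕ) (t x : ℝ)
    (b : Fin (S.m i)) :
    target K F w i t x (Sum.inr b) = volterra w i (K i) t x (Sum.inr b) := by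
  simp [target, volterra]

theorem G_eq_zero {i : ℕ} (hi : i < S.N) (K : ℝ → ℝ → Matrix (S.Idx i) (S.Idx i) ℝ) {x : ℝ}
    (hx : x ∈ Icc (0 : ℝ) 1) {a b : Fin (S.n i)} (h : b ≤ a) : S.G i K x a b = 0 := by
  rcases eq_or_lt_of_le h with rfl | h
  · simp [G, S.Sig_diag i hi x hx]
  · simp [G, not_le.2 h]

theorem IsSolution.continuousOn_v {U : ℝ → Fin (S.n 0) → ℝ} {w : S.State}
    (hw : S.IsSolution U w) {i : ℕ} (hi : i < S.N) {x : ℝ} (hx : x ∈ Icc (0 : ℝ) 1) :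
    ContinuousOn (fun s => v w i s x) (Ici 0) := by
  have h : ContinuousOn (fun s : ℝ => w i s x) (Ici 0) :=
    (hw.cont i hi).comp (f := fun s : ℝ => (s, x)) (by fun_prop) fun s hs => ⟨hs, hx⟩
  exact continuousOn_pi.2 fun b => continuousOn_pi.1 h (Sum.inr b)

/-- The kernels cancel the boundary terms of the transformed equation. -/
theorem boundary_cancel {U : ℝ → Fin (S.n 0) → ℝ} {w : S.State} (hw : S.IsSolution U w) {i : ℕ}
    (hi : i + 1 < S.N) {K : ℝ → ℝ → Matrix (S.Idx i) (S.Idx i) ℝ} (hK : S.IsStateKernel i K)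
    {F : ℝ → ℝ → Matrix (Fin (S.n i)) (Fin (S.m (i + 1))) ℝ} (hF : S.IsDelayKernel i K F)
    {t x : ℝ} (ht : 0 ≤ t) (hx : x ∈ Ico (0 : ℝ) 1) (a : Fin (S.n i)) :
    ∑ l, K x 1 (Sum.inl a) l * (S.vel i l * w i t 1 l) =
      ∑ l, F x 0 a l * v w (i + 1) t 0 l := by
  have hv : ∀ b, w i t 1 (Sum.inr b) = ∑ p, S.R i b p * w i t 1 (Sum.inl p) +
      ∑ q, S.Rc i b q * v w (i + 1) t 0 q := fun b => congrFun (hw.right_bc i hi t ht) b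
  have hR : ∀ p, K x 1 (Sum.inl a) (Sum.inl p) * S.lam i p =
      ∑ b, K x 1 (Sum.inl a) (Sum.inr b) * S.mu i b * S.R i b p := fun p => by
    have := congrFun (congrFun (hK.right_bc x hx) a) p
    simpa [Matrix.mul_apply, Matrix.mul_diagonal, Matrix.toBlocks₁₁, Matrix.toBlocks₁₂,
      Matrix.diagonal_apply] using this
  have hFl : ∀ q, F x 0 a q =
      -∑ b, K x 1 (Sum.inl a) (Sum.inr b) * S.mu i b * S.Rc i b q := fun q => by
    have := congrFun (congrFun (hF.left_bc x (Ico_subset_Icc_self hx)) a) q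
    simpa [Matrix.mul_apply, Matrix.mul_diagonal, Matrix.toBlocks₁₁, Matrix.toBlocks₁₂,
      Matrix.diagonal_apply] using this
  rw [Fintype.sum_sum_type]
  simp only [vel, Sum.elim_inl, Sum.elim_inr, hv, hFl]
  have e1 : ∑ p, K x 1 (Sum.inl a) (Sum.inl p) * (S.lam i p * w i t 1 (Sum.inl p)) =
      ∑ b, ∑ p, K x 1 (Sum.inl a) (Sum.inr b) * S.mu i b * S.R i b p * w i t 1 (Sum.inl p) := by
    rw [Finset.sum_comm]
    refine Finset.sum_congr rfl fun p _ => ?_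
    rw [← mul_assoc, hR, Finset.sum_mul]
  have e2 : ∑ q, -(∑ b, K x 1 (Sum.inl a) (Sum.inr b) * S.mu i b * S.Rc i b q) *
      v w (i + 1) t 0 q = -∑ b, ∑ q, K x 1 (Sum.inl a) (Sum.inr b) * S.mu i b * S.Rc i b q *
      v w (i + 1) t 0 q := by
    rw [Finset.sum_comm, ← Finset.sum_neg_distrib]
    refine Finset.sum_congr rfl fun q _ => ?_
    rw [neg_mul, Finset.sum_mul]
  rw [e1, e2, ← Finset.sum_add_distrib, ← Finset.sum_neg_distrib]
  refine Finset.sum_congr rfl fun b _ => ?_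
  have e3 : ∑ p, K x 1 (Sum.inl a) (Sum.inr b) * S.mu i b * S.R i b p * w i t 1 (Sum.inl p) =
      K x 1 (Sum.inl a) (Sum.inr b) * S.mu i b * ∑ p, S.R i b p * w i t 1 (Sum.inl p) := by
    rw [Finset.mul_sum]; exact Finset.sum_congr rfl fun p _ => by ring
  have e4 : ∑ q, K x 1 (Sum.inl a) (Sum.inr b) * S.mu i b * S.Rc i b q * v w (i + 1) t 0 q =
      K x 1 (Sum.inl a) (Sum.inr b) * S.mu i b * ∑ q, S.Rc i b q * v w (i + 1) t 0 q := by
    rw [Finset.mul_sum]; exact Finset.sum_congr rfl fun q _ => by ring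
  rw [e3, e4]
  ring

/-- The outlet source of the Volterra part and the source at `y = 0` of the delayed part cancel, and
what is left is `G α`, with `G` strictly upper triangular. -/
theorem alpha_cascadeTransport {K : S.StateKernels} {F : S.DelayKernels}
    {U : ℝ → Fin (S.n 0) → ℝ} {w : S.State} (hw : S.IsSolution U w) {i : ℕ} (hi : i + 1 < S.N)
    (hK : S.IsStateKernel i (K i)) (hF : S.IsDelayKernel i (K i) (F i)) :
    CascadeTransport (S.lam i) (S.lam1 i) (fun a b x => S.G i (K i) (clamp 1 x) a b)
      (fun a t x => alpha K F w i t x a) := by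
  intro a t x h ht h0 hx hxh hmem
  have hiN : i < S.N := by omega
  have hpos := S.lam_pos i hiN a
  have hX01 : ∀ r ∈ Icc 0 h, x + S.lam i a * r ∈ Icc (0 : ℝ) 1 := fun r hr => by
    have h2 := mul_le_mul_of_nonneg_left hr.2 hpos.le
    have h3 := mul_nonneg hpos.le hr.1
    exact ⟨by linarith [hx.1], by linarith⟩
  obtain ⟨i1, e1⟩ := volterra_transport hw hiN hK (Sum.inl a) ht h0 hx
    (hX01 h ⟨h0, le_rfl⟩)
  obtain ⟨i2, e2⟩ := delayPart_transport hiN hK hF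
    (hw.continuousOn_v hi (x := 0) ⟨le_rfl, zero_le_one⟩) a ht h0 hx.1 hxh hmem
  change IntervalIntegrable (fun r => _) volume 0 h at i1
  simp only [alpha, target_inl]
  change volterra w i (K i) (t + h) (x + S.lam i a * h) (Sum.inl a) = _ at e1
  rw [e1, e2, add_add_add_comm, ← intervalIntegral.integral_add i1 i2]
  congr 1
  refine intervalIntegral.integral_congr_ae ?_
  -- The kernel condition behind the cancellation is imposed only for `x < 1`, so the exit instant
  -- is discarded.
  filter_upwards [Measure.ae_ne volume ((1 - x) / S.lam i a)] with r hr hmem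
  rw [uIoc_of_le h0] at hmem
  have hXr := hX01 r (Ioc_subset_Icc_self hmem)
  have hne : x + S.lam i a * r ≠ 1 := fun h1 => by
    apply hr
    rw [eq_div_iff hpos.ne']
    linarith
  have hb := boundary_cancel hw hi hK hF (t := t + r) (by linarith [hmem.1])
    ⟨hXr.1, lt_of_le_of_ne hXr.2 hne⟩ a
  have hvel : S.vel i (Sum.inl a) = S.lam i a := rfl
  rw [hvel, hb, sub_add_add_cancel, Fintype.sum_sum_type]
  simp only [Gblock, Matrix.fromBlocks_apply₁₁, Matrix.fromBlocks_apply₁₂, Matrix.zero_apply,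
    zero_mul, Finset.sum_const_zero, add_zero, clamp_of_mem hXr]
  rw [← Finset.sum_add_distrib, ← Finset.sum_subset (Finset.subset_univ (Finset.Ioi a))]
  · exact Finset.sum_congr rfl fun b _ => by ring
  · intro b _ hb
    rw [Finset.mem_Ioi, not_lt] at hb
    rw [G_eq_zero hiN (K i) hXr hb]
    ring

/-- The `G`-block has no lower rows, so only the outlet source remains. -/
theorem target_inr_transport {K : S.StateKernels} {F : S.DelayKernels}
    {U : ℝ → Fin (S.n 0) → ℝ} {w : S.State} (hw : S.IsSolution U w) {i : ℕ} (hi : i < S.N)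
    (hK : S.IsStateKernel i (K i)) (b : Fin (S.m i)) {t x h : ℝ} (ht : 0 ≤ t) (h0 : 0 ≤ h)
    (hx : x ∈ Icc (0 : ℝ) 1) (hxh : x - S.mu i b * h ∈ Icc (0 : ℝ) 1) :
    target K F w i (t + h) (x - S.mu i b * h) (Sum.inr b) = target K F w i t x (Sum.inr b) -
      ∫ r in (0 : ℝ)..h, ∑ l, K i (x - S.mu i b * r) 1 (Sum.inr b) l *
        (S.vel i l * w i (t + r) 1 l) := by
  have hvel : ∀ r, x + S.vel i (Sum.inr b) * r = x - S.mu i b * r := fun r => by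
    simp only [vel, Sum.elim_inr]; ring
  obtain ⟨-, e⟩ := volterra_transport hw hi hK (Sum.inr b) ht h0 hx (by rwa [hvel])
  have hG : ∀ x l, S.Gblock i (K i) x (Sum.inr b) l = 0 := fun x l => by
    rcases l with l | l <;> rfl
  simp only [hvel, hG, zero_mul, Finset.sum_const_zero, zero_sub,
    intervalIntegral.integral_neg] at e
  rw [target_inr, target_inr, e, sub_eq_add_neg]

end HyperbolicChain

/-! ### Pointwise bounds on the transformed state -/

theorem exists_uniform_bound {ι X : Type*} [Finite ι] {f : ι → X → ℝ}
    (h : ∀ i, ∃ C, ∀ x, |f i x| ≤ C) : ∃ C, 0 ≤ C ∧ ∀ i x, |f i x| ≤ C := by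
  cases nonempty_fintype ι
  choose C hC using h
  refine ⟨∑ i, |C i|, Finset.sum_nonneg fun _ _ => abs_nonneg _, fun i x => ?_⟩
  exact ((hC i x).trans (le_abs_self _)).trans
    (Finset.single_le_sum (f := fun i => |C i|) (fun _ _ => abs_nonneg _) (Finset.mem_univ i))

theorem BddMeas.intervalIntegral {f : ℝ × ℝ → ℝ} {p q : ℝ → ℝ} (hf : BddMeas f) (hp : BddMeas p)
    (hq : BddMeas q) : BddMeas fun x => ∫ y in p x..q x, f (x, y) := by
  obtain ⟨mf, C, hC⟩ := hf
  obtain ⟨mp, P, hP⟩ := hp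
  obtain ⟨mq, Q, hQ⟩ := hq
  refine ⟨measurable_intervalIntegral_param (f := fun x y => f (x, y)) mf mp mq, C * (Q + P),
    fun x => (abs_intervalIntegral_le fun y _ => hC _).trans ?_⟩
  refine mul_le_mul_of_nonneg_left ?_ ((abs_nonneg _).trans (hC (0, 0)))
  exact (abs_sub _ _).trans (add_le_add (hQ x) (hP x))

theorem bddMeas_clamp_id {T : ℝ} (hT : 0 ≤ T) : BddMeas fun s => clamp T s :=
  bddMeas_clamp (f := id) hT continuousOn_id

theorem sum_mul_abs_le {ι : Type*} (s : Finset ι) {c f : ι → ℝ} {M : ℝ}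
    (hf : ∀ i ∈ s, |f i| ≤ M) : |∑ i ∈ s, c i * f i| ≤ (∑ i ∈ s, |c i|) * M := by
  rw [Finset.sum_mul]
  refine (Finset.abs_sum_le_sum_abs _ _).trans (Finset.sum_le_sum fun i hi => ?_)
  rw [abs_mul]
  exact mul_le_mul_of_nonneg_left (hf i hi) (abs_nonneg _)

/-- The sum of the absolute values of the components. -/
def absSum {d : ℕ} (v : Fin d → ℝ) : ℝ := ∑ l, |v l|

theorem absSum_nonneg {d : ℕ} (v : Fin d → ℝ) : 0 ≤ absSum v :=
  Finset.sum_nonneg fun _ _ => abs_nonneg _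

theorem abs_le_absSum {d : ℕ} (v : Fin d → ℝ) (l : Fin d) : |v l| ≤ absSum v :=
  Finset.single_le_sum (f := fun l => |v l|) (fun _ _ => abs_nonneg _) (Finset.mem_univ l)

theorem absSum_sq_le {d : ℕ} (v : Fin d → ℝ) : absSum v ^ 2 ≤ d * ∑ l, v l ^ 2 := by
  have := sq_sum_le_card_mul_sum_sq (s := Finset.univ) (f := fun l => |v l|)
  simpa [absSum] using this

theorem continuous_absSum {d : ℕ} : Continuous (absSum : (Fin d → ℝ) → ℝ) := by
  unfold absSum; fun_prop

theorem exists_cascade_abs_le {n : ℕ} {lam : Fin n → ℝ} (hpos : ∀ j, 0 < lam j)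
    {k : Fin n → Fin n → ℝ → ℝ → ℝ} (hkC : ∀ j l, ∃ C, ∀ x ν, |k j l x ν| ≤ C) :
    ∃ C, 0 ≤ C ∧ ∀ ζ : ℝ → Fin n → ℝ, Continuous ζ → ∀ j t η, 1 / lam j ≤ η →
      ∀ x ∈ Icc (0 : ℝ) 1, |cascade lam k ζ j t x| ≤
        C * (absSum (ζ (t + (1 - x) / lam j)) + ∫ ν in (0 : ℝ)..η, absSum (ζ (t + ν))) := by
  obtain ⟨C, hC0, hC⟩ := exists_uniform_bound (ι := Fin n × Fin n) (X := ℝ × ℝ)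
    (f := fun i p => k i.1 i.2 p.1 p.2) fun i => (hkC i.1 i.2).imp fun C hC p => hC p.1 p.2
  refine ⟨1 + C, by linarith, fun ζ hζ j t η hη x hx => ?_⟩
  have hζl : ∀ l, Continuous fun s => ζ s l := fun l => (continuous_apply l).comp hζ
  have hT0 : 0 ≤ (1 - x) / lam j := div_nonneg (by linarith [hx.2]) (hpos j).le
  have hTη : (1 - x) / lam j ≤ η :=
    (div_le_div_of_nonneg_right (by linarith [hx.1]) (hpos j).le).trans hη
  have cz : ∀ l, Continuous fun ν => |ζ (t + ν) l| := fun l =>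
    ((hζl l).comp (continuous_const.add continuous_id)).abs
  have h1 : ∀ l, |∫ ν in (0 : ℝ)..((1 - x) / lam j), k j l x ν * ζ (t + ν) l| ≤
      C * ∫ ν in (0 : ℝ)..η, |ζ (t + ν) l| := by
    intro l
    have h2 : |∫ ν in (0 : ℝ)..((1 - x) / lam j), k j l x ν * ζ (t + ν) l| ≤
        ∫ ν in (0 : ℝ)..((1 - x) / lam j), C * |ζ (t + ν) l| := by
      rw [← Real.norm_eq_abs]
      refine intervalIntegral.norm_integral_le_of_norm_le hT0 (.of_forall fun ν _ => ?_)
        (((cz l).const_mul C).intervalIntegrable _ _)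
      rw [Real.norm_eq_abs, abs_mul]
      exact mul_le_mul_of_nonneg_right (hC (j, l) (x, ν)) (abs_nonneg _)
    refine h2.trans ?_
    rw [intervalIntegral.integral_const_mul]
    exact mul_le_mul_of_nonneg_left (intervalIntegral.integral_mono_interval le_rfl hT0 hTη
      (.of_forall fun _ => abs_nonneg _) ((cz l).intervalIntegrable _ _)) hC0
  have h3 : |∑ l ∈ Finset.Ioi j, ∫ ν in (0 : ℝ)..((1 - x) / lam j), k j l x ν * ζ (t + ν) l| ≤
      C * ∫ ν in (0 : ℝ)..η, absSum (ζ (t + ν)) := by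
    simp only [absSum]
    rw [intervalIntegral.integral_finsetSum fun l _ => (cz l).intervalIntegrable _ _,
      Finset.mul_sum]
    refine (Finset.abs_sum_le_sum_abs _ _).trans ((Finset.sum_le_sum fun l _ => h1 l).trans ?_)
    refine Finset.sum_le_sum_of_subset_of_nonneg (Finset.subset_univ _) fun l _ _ => ?_
    exact mul_nonneg hC0 (intervalIntegral.integral_nonneg (hT0.trans hTη) fun _ _ => abs_nonneg _)
  have h4 : 0 ≤ ∫ ν in (0 : ℝ)..η, absSum (ζ (t + ν)) :=
    intervalIntegral.integral_nonneg (hT0.trans hTη) fun _ _ => absSum_nonneg _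
  have h5 := abs_le_absSum (ζ (t + (1 - x) / lam j)) j
  have h6 := absSum_nonneg (ζ (t + (1 - x) / lam j))
  refine (abs_add_le _ _).trans ?_
  nlinarith [mul_nonneg hC0 h6]

namespace HyperbolicChain

variable {S : HyperbolicChain}

theorem exists_bddMeas_volterra {U : ℝ → Fin (S.n 0) → ℝ} {w : S.State} (hw : S.IsSolution U w)
    {i : ℕ} (hi : i < S.N) {K : ℝ → ℝ → Matrix (S.Idx i) (S.Idx i) ℝ} (hK : S.IsStateKernel i K)
    {t : ℝ} (ht : 0 ≤ t) (k : S.Idx i) :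
    ∃ f : ℝ → ℝ, BddMeas f ∧ ∀ x ∈ Icc (0 : ℝ) 1, volterra w i K t x k = f x := by
  have h1 : ∀ l, BddMeas fun y => w i t (clamp 1 y) l := fun l => by
    have := (hw.bddMeas hi ht l).comp (u := fun y : ℝ => (t, y)) (by fun_prop)
    simpa only [clamp_of_mem (⟨ht, le_rfl⟩ : t ∈ Icc 0 t)] using this
  have h2 : BddMeas fun p : ℝ × ℝ =>
      ∑ l, upperTriangle.indicator (fun p => K p.1 p.2 k l) p * w i t (clamp 1 p.2) l :=
    BddMeas.sum _ fun l => (hK.bddMeas k l).mul ((h1 l).comp measurable_snd)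
  refine ⟨_, (h1 k).add (h2.intervalIntegral (bddMeas_clamp_id zero_le_one) (BddMeas.const 1)),
    fun x hx => ?_⟩
  simp only [clamp_of_mem hx]
  rw [volterra]
  congr 1
  refine intervalIntegral.integral_congr fun y hy => ?_
  rw [uIcc_of_le hx.2] at hy
  simp only [Matrix.mulVec, dotProduct]
  refine Finset.sum_congr rfl fun l _ => ?_
  rw [indicator_of_mem (show (x, y) ∈ upperTriangle from ⟨hx.1, hy.1, hy.2⟩),
    clamp_of_mem ⟨hx.1.trans hy.1, hy.2⟩]

theorem exists_bddMeas_delayPart {i : ℕ} (hi : i < S.N)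
    {K : ℝ → ℝ → Matrix (S.Idx i) (S.Idx i) ℝ}
    {F : ℝ → ℝ → Matrix (Fin (S.n i)) (Fin (S.m (i + 1))) ℝ} (hF : S.IsDelayKernel i K F)
    {z : ℝ → Fin (S.m (i + 1)) → ℝ} (hz : ContinuousOn z (Ici 0)) {t : ℝ} (ht : 1 / S.lam1 i ≤ t)
    (a : Fin (S.n i)) :
    ∃ f : ℝ → ℝ, BddMeas f ∧ ∀ x ∈ Icc (0 : ℝ) 1, delayPart i F z t x a = f x := by
  have h1 := lam1_pos hi
  have ht0 : 0 ≤ t := le_trans (by positivity) ht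
  have hzt : ∀ l, BddMeas fun s => z (clamp t s) l := fun l =>
    bddMeas_clamp (f := fun s => z s l) ht0 ((continuousOn_pi.1 hz l).mono Icc_subset_Ici_self)
  have h2 : BddMeas fun p : ℝ × ℝ => ∑ l, (S.delayTriangle i).indicator
      (fun p => F p.1 p.2 a l) p * z (clamp t (t - p.2)) l :=
    BddMeas.sum _ fun l => (hF.bddMeas hi a l).mul
      ((hzt l).comp (u := fun p : ℝ × ℝ => t - p.2) (by fun_prop))
  refine ⟨_, h2.intervalIntegral (BddMeas.const 0)
    ((bddMeas_clamp_id zero_le_one).mul (BddMeas.const (1 / S.lam1 i))), fun x hx => ?_⟩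
  have hxl : 0 ≤ x / S.lam1 i := div_nonneg hx.1 h1.le
  have hxt : x / S.lam1 i ≤ t := (div_le_div_of_nonneg_right hx.2 h1.le).trans ht
  simp only [clamp_of_mem hx, mul_one_div]
  rw [delayPart]
  refine intervalIntegral.integral_congr fun y hy => ?_
  rw [uIcc_of_le hxl] at hy
  simp only [Matrix.mulVec, dotProduct]
  refine Finset.sum_congr rfl fun l _ => ?_
  rw [indicator_of_mem (show (x, y) ∈ S.delayTriangle i from ⟨hx.1, hx.2, hy.1, hy.2⟩),
    clamp_of_mem ⟨by linarith [hy.2], by linarith [hy.1]⟩]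

/-- The transformed state agrees on `[0, 1]` with a bounded measurable function. From time `1/λ_i^1`
on, its delayed integral only reads nonnegative times. -/
theorem memLp_target {K : S.StateKernels} {F : S.DelayKernels} {U : ℝ → Fin (S.n 0) → ℝ}
    {w : S.State} (hw : S.IsSolution U w) {i : ℕ} (hi : i + 1 < S.N)
    (hK : S.IsStateKernel i (K i)) (hF : S.IsDelayKernel i (K i) (F i)) {t : ℝ}
    (ht : 1 / S.lam1 i ≤ t) (k : S.Idx i) :
    MemLp (fun x => target K F w i t x k) 2 (volume.restrict (Icc (0 : ℝ) 1)) := by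
  have hiN : i < S.N := by omega
  have h1 := lam1_pos hiN
  have ht0 : 0 ≤ t := le_trans (by positivity) ht
  obtain ⟨f, ⟨mf, C, hC⟩, hf⟩ : ∃ f : ℝ → ℝ, BddMeas f ∧
      ∀ x ∈ Icc (0 : ℝ) 1, target K F w i t x k = f x := by
    obtain ⟨f, hf, hfx⟩ := exists_bddMeas_volterra hw hiN hK ht0 k
    rcases k with a | b
    · obtain ⟨f', hf', hfx'⟩ := exists_bddMeas_delayPart hiN hF
        (hw.continuousOn_v hi (x := 0) ⟨le_rfl, zero_le_one⟩) ht a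
      exact ⟨_, hf.add hf', fun x hx => by rw [target_inl, hfx x hx, hfx' x hx]⟩
    · exact ⟨f, hf, fun x hx => by rw [target_inr, hfx x hx]⟩
  have hm : MemLp f 2 (volume.restrict (Icc (0 : ℝ) 1)) :=
    MemLp.of_bound mf.aestronglyMeasurable C (.of_forall hC)
  refine (memLp_congr_ae ?_).2 hm
  exact (ae_restrict_iff' measurableSet_Icc).2 (.of_forall fun x hx => hf x hx)

/-- The pointwise size, `ν` units of time before `t`, of the two signals that drive `β_i`. -/
def pastSize {n m : ℕ} (ζ : ℝ → Fin n → ℝ) (z : ℝ → Fin m → ℝ) (t ν : ℝ) : ℝ :=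
  absSum (ζ (t - ν)) + absSum (z (t - ν))

theorem pastSize_nonneg {n m : ℕ} (ζ : ℝ → Fin n → ℝ) (z : ℝ → Fin m → ℝ) (t ν : ℝ) :
    0 ≤ pastSize ζ z t ν := add_nonneg (absSum_nonneg _) (absSum_nonneg _)

theorem continuous_pastSize {n m : ℕ} {ζ : ℝ → Fin n → ℝ} {z : ℝ → Fin m → ℝ} (hζ : Continuous ζ)
    (hz : Continuous z) (t : ℝ) : Continuous (pastSize ζ z t) :=
  (continuous_absSum.comp (hζ.comp (by fun_prop))).add
    (continuous_absSum.comp (hz.comp (by fun_prop)))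

theorem integral_pastSize_sub_le {n m : ℕ} {ζ : ℝ → Fin n → ℝ} {z : ℝ → Fin m → ℝ}
    (hζ : Continuous ζ) (hz : Continuous z) {t a b η : ℝ} (ha : 0 ≤ a) (hab : a ≤ b)
    (hb : b ≤ η) :
    ∫ ν in a..b, pastSize ζ z t ν ≤ ∫ ν in (0 : ℝ)..η, pastSize ζ z t ν :=
  intervalIntegral.integral_mono_interval ha hab hb (.of_forall fun _ => pastSize_nonneg _ _ _ _)
    ((continuous_pastSize hζ hz t).intervalIntegrable _ _)

/-- At `x = 1` the Volterra integral is empty, so `u_i(s,1)` is `ζ(s)` minus the delayed integral,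
and the boundary condition gives `v_i(s,1)`. The outlet is read at most `1/μ_i^1` before `t` and its
delay reaches back by `1/λ_i^1`: this is the origin of the window length. -/
theorem exists_outlet_bound {K : S.StateKernels} {F : S.DelayKernels} {i : ℕ} (hi : i + 1 < S.N)
    (hF : S.IsDelayKernel i (K i) (F i)) :
    ∃ C, 0 ≤ C ∧ ∀ (U : ℝ → Fin (S.n 0) → ℝ) (w : S.State), S.IsSolution U w →
      ∀ (ζ : ℝ → Fin (S.n i) → ℝ) (z : ℝ → Fin (S.m (i + 1)) → ℝ), Continuous ζ → Continuous z →
      (∀ s, 0 ≤ s → z s = v w (i + 1) s 0) → ∀ t s, s ≤ t → t - s ≤ 1 / S.mu1 i →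
      1 / S.lam1 i ≤ s → alpha K F w i s 1 = ζ s → ∀ l, |w i s 1 l| ≤
        C * (pastSize ζ z t (t - s) +
          ∫ ν in (0 : ℝ)..(1 / S.lam1 i + 1 / S.mu1 i), pastSize ζ z t ν) := by
  have hiN : i < S.N := by omega
  have h1 := lam1_pos hiN
  have h1' : 0 < 1 / S.lam1 i := by positivity
  obtain ⟨CF, hCF0, hCF⟩ := exists_uniform_bound
    (ι := Fin (S.n i) × Fin (S.m (i + 1))) (X := ℝ × ℝ)
    (f := fun j => (S.delayTriangle i).indicator fun p => F i p.1 p.2 j.1 j.2)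
    fun j => (hF.bddMeas hiN j.1 j.2).2
  set CR : ℝ := ∑ b, ∑ p, |S.R i b p| with hCR
  set CC : ℝ := ∑ b, ∑ q, |S.Rc i b q| with hCC
  have hCR0 : 0 ≤ CR := Finset.sum_nonneg fun _ _ => Finset.sum_nonneg fun _ _ => abs_nonneg _
  have hCC0 : 0 ≤ CC := Finset.sum_nonneg fun _ _ => Finset.sum_nonneg fun _ _ => abs_nonneg _
  -- `1 + CF` bounds the components of `u_i`; the other two terms bound those of `v_i` through `R`
  -- and `Rc`.
  refine ⟨(1 + CF) + CR * (1 + CF) + CC, by positivity, ?_⟩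
  intro U w hw ζ z hζ hz hzv t s hst hts hs hα l
  have hs0 : 0 ≤ s := h1'.le.trans hs
  set Z := ∫ ν in (0 : ℝ)..(1 / S.lam1 i + 1 / S.mu1 i), pastSize ζ z t ν with hZ
  set q := pastSize ζ z t (t - s) with hq
  have hη0 : 0 ≤ 1 / S.lam1 i + 1 / S.mu1 i := by linarith
  have hZ0 : 0 ≤ Z := intervalIntegral.integral_nonneg hη0 fun _ _ => pastSize_nonneg _ _ _ _
  have hq0 : 0 ≤ q := pastSize_nonneg _ _ _ _
  have hts' : t - (t - s) = s := by ring
  have hζq : absSum (ζ s) ≤ q := by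
    rw [hq, pastSize, hts']; linarith [absSum_nonneg (z s)]
  have hzq : absSum (z s) ≤ q := by
    rw [hq, pastSize, hts']; linarith [absSum_nonneg (ζ s)]
  have hdelay : ∀ a, |delayPart i (F i) (fun s => v w (i + 1) s 0) s 1 a| ≤ CF * Z := by
    intro a
    have cq : Continuous fun y => pastSize ζ z t (t - s + y) :=
      (continuous_pastSize hζ hz t).comp (by fun_prop)
    have h2 : |delayPart i (F i) (fun s => v w (i + 1) s 0) s 1 a| ≤
        ∫ y in (0 : ℝ)..(1 / S.lam1 i), CF * pastSize ζ z t (t - s + y) := by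
      rw [← Real.norm_eq_abs, delayPart]
      refine intervalIntegral.norm_integral_le_of_norm_le h1'.le (.of_forall fun y hy => ?_)
        ((cq.const_mul CF).intervalIntegrable _ _)
      rw [Real.norm_eq_abs, Matrix.mulVec, dotProduct, ← hzv (s - y) (by linarith [hy.2])]
      have e : t - (t - s + y) = s - y := by ring
      have h3 : CF * absSum (z (s - y)) ≤ CF * pastSize ζ z t (t - s + y) := by
        rw [pastSize, e]
        exact mul_le_mul_of_nonneg_left (by linarith [absSum_nonneg (ζ (s - y))]) hCF0
      refine le_trans ?_ h3
      rw [absSum, Finset.mul_sum]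
      refine (Finset.abs_sum_le_sum_abs _ _).trans (Finset.sum_le_sum fun l _ => ?_)
      rw [abs_mul]
      refine mul_le_mul_of_nonneg_right ?_ (abs_nonneg _)
      have := hCF (a, l) (1, y)
      rwa [indicator_of_mem (show ((1 : ℝ), y) ∈ S.delayTriangle i from
        ⟨zero_le_one, le_rfl, hy.1.le, hy.2⟩)] at this
    refine h2.trans ?_
    rw [intervalIntegral.integral_const_mul, intervalIntegral.integral_comp_add_left
      (fun ν => pastSize ζ z t ν)]
    exact mul_le_mul_of_nonneg_left (integral_pastSize_sub_le hζ hz (by linarith) (by linarith)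
      (by linarith)) hCF0
  have hu : ∀ a, |w i s 1 (Sum.inl a)| ≤ (1 + CF) * (q + Z) := by
    intro a
    have e := congrFun hα a
    simp only [alpha, target_inl, volterra, intervalIntegral.integral_same, add_zero] at e
    have e2 : w i s 1 (Sum.inl a) =
        ζ s a - delayPart i (F i) (fun s => v w (i + 1) s 0) s 1 a := by linarith
    rw [e2]
    refine (abs_sub _ _).trans ?_
    have h3 := (abs_le_absSum (ζ s) a).trans hζq
    nlinarith [hdelay a, mul_nonneg hCF0 hq0]
  have hM0 : 0 ≤ (1 + CF) * (q + Z) := by positivity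
  rcases l with a | b
  · refine (hu a).trans (mul_le_mul_of_nonneg_right ?_ (by linarith))
    nlinarith [mul_nonneg hCR0 hCF0]
  · have e : w i s 1 (Sum.inr b) = ∑ p, S.R i b p * w i s 1 (Sum.inl p) +
        ∑ c, S.Rc i b c * v w (i + 1) s 0 c := congrFun (hw.right_bc i hi s hs0) b
    have r1 := sum_mul_abs_le Finset.univ (c := S.R i b) fun p _ => hu p
    have r2 := sum_mul_abs_le Finset.univ (c := S.Rc i b) (f := v w (i + 1) s 0) (M := q)
      fun c _ => by
        rw [← hzv s hs0]
        exact (abs_le_absSum (z s) c).trans hzq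
    have s1 : ∑ p, |S.R i b p| ≤ CR := Finset.single_le_sum
      (f := fun b => ∑ p, |S.R i b p|) (fun _ _ => Finset.sum_nonneg fun _ _ => abs_nonneg _)
      (Finset.mem_univ b)
    have s2 : ∑ c, |S.Rc i b c| ≤ CC := Finset.single_le_sum
      (f := fun b => ∑ p, |S.Rc i b p|) (fun _ _ => Finset.sum_nonneg fun _ _ => abs_nonneg _)
      (Finset.mem_univ b)
    rw [e]
    refine (abs_add_le _ _).trans ((add_le_add r1 r2).trans ?_)
    have t1 := mul_le_mul_of_nonneg_right s1 hM0
    have t2 := mul_le_mul_of_nonneg_right s2 hq0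
    nlinarith [mul_nonneg hCC0 hZ0, mul_nonneg hCF0 hq0, mul_nonneg hCF0 hZ0]

/-- `β_i` is traced back along its characteristic to `x = 1`, left `h = (1-x)/μ_i^b` before `t`. The
starting value and the accumulated source are both outlet values, taken at times between `t - h` and
`t`. -/
theorem exists_beta_bound {K : S.StateKernels} {F : S.DelayKernels} {i : ℕ} (hi : i + 1 < S.N)
    (hK : S.IsStateKernel i (K i)) (hF : S.IsDelayKernel i (K i) (F i)) :
    ∃ C, 0 ≤ C ∧ ∀ (U : ℝ → Fin (S.n 0) → ℝ) (w : S.State), S.IsSolution U w →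
      ∀ (ζ : ℝ → Fin (S.n i) → ℝ) (z : ℝ → Fin (S.m (i + 1)) → ℝ), Continuous ζ → Continuous z →
      (∀ s, 0 ≤ s → z s = v w (i + 1) s 0) → ∀ s₀, 1 / S.lam1 i ≤ s₀ →
      (∀ s > s₀, alpha K F w i s 1 = ζ s) → ∀ t > s₀ + 1 / S.mu1 i,
      ∀ b, ∀ x ∈ Icc (0 : ℝ) 1, |target K F w i t x (Sum.inr b)| ≤
        C * (pastSize ζ z t ((1 - x) / S.mu i b) +
          ∫ ν in (0 : ℝ)..(1 / S.lam1 i + 1 / S.mu1 i), pastSize ζ z t ν) := by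
  have hiN : i < S.N := by omega
  have h1 : 0 < 1 / S.lam1 i := by have := lam1_pos hiN; positivity
  have hm1 : 0 < 1 / S.mu1 i := by have := mu1_pos hiN; positivity
  obtain ⟨C, hC0, hC⟩ := exists_outlet_bound (K := K) hi hF
  obtain ⟨CK, hCK0, hCK⟩ := exists_uniform_bound (ι := S.Idx i × S.Idx i) (X := ℝ × ℝ)
    (f := fun j => upperTriangle.indicator fun p => K i p.1 p.2 j.1 j.2)
    fun j => (hK.bddMeas j.1 j.2).2
  set V : ℝ := ∑ l, |S.vel i l| with hV
  have hV0 : 0 ≤ V := Finset.sum_nonneg fun _ _ => abs_nonneg _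
  set η := 1 / S.lam1 i + 1 / S.mu1 i with hη
  set D := CK * V * C with hD
  have hD0 : 0 ≤ D := by positivity
  -- `C` pays for the starting value. The source costs `D` times the integral of the size over a
  -- subwindow plus `h * Z`, at most `D * (1 + η) * Z`.
  refine ⟨C + D * (1 + η), by positivity, ?_⟩
  intro U w hw ζ z hζ hz hzv s₀ hs₀ hα t ht b x hx
  have hpos := S.mu_pos i hiN b
  set Z := ∫ ν in (0 : ℝ)..η, pastSize ζ z t ν with hZ
  have hZ0 : 0 ≤ Z :=
    intervalIntegral.integral_nonneg (by positivity) fun _ _ => pastSize_nonneg _ _ _ _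
  set h := (1 - x) / S.mu i b with hh
  have h0 : 0 ≤ h := div_nonneg (by linarith [hx.2]) hpos.le
  have hhm : h ≤ 1 / S.mu1 i := div_le_div₀ zero_le_one (by linarith [hx.1]) (mu1_pos hiN)
    (mu1_le hiN b)
  have hend : 1 - S.mu i b * h = x := by rw [hh]; field_simp; ring
  have hout : ∀ r ∈ Icc 0 h, ∀ l, |w i (t - h + r) 1 l| ≤ C * (pastSize ζ z t (h - r) + Z) := by
    intro r hr l
    have := hC U w hw ζ z hζ hz hzv t (t - h + r) (by linarith [hr.2]) (by linarith [hr.1])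
      (by linarith [hr.1]) (hα _ (by linarith [hr.1])) l
    rwa [show t - (t - h + r) = h - r by ring] at this
  have e := target_inr_transport (F := F) hw hiN hK b (t := t - h) (x := 1) (h := h)
    (by linarith) h0 ⟨zero_le_one, le_rfl⟩ (by rwa [hend])
  rw [hend, sub_add_cancel] at e
  have e1 : target K F w i (t - h) 1 (Sum.inr b) = w i (t - h) 1 (Sum.inr b) := by
    rw [target_inr, volterra, intervalIntegral.integral_same, add_zero]
  have b1 : |w i (t - h) 1 (Sum.inr b)| ≤ C * (pastSize ζ z t h + Z) := by
    simpa using hout 0 ⟨le_rfl, h0⟩ (Sum.inr b)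
  have cq : Continuous fun r => D * (pastSize ζ z t (h - r) + Z) :=
    (((continuous_pastSize hζ hz t).comp (by fun_prop)).add continuous_const).const_mul D
  have b2 : |∫ r in (0 : ℝ)..h, ∑ l, K i (1 - S.mu i b * r) 1 (Sum.inr b) l *
      (S.vel i l * w i (t - h + r) 1 l)| ≤
      ∫ r in (0 : ℝ)..h, D * (pastSize ζ z t (h - r) + Z) := by
    rw [← Real.norm_eq_abs]
    refine intervalIntegral.norm_integral_le_of_norm_le h0 (.of_forall fun r hr => ?_)
      (cq.intervalIntegrable _ _)
    rw [Real.norm_eq_abs]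
    have hr' := Ioc_subset_Icc_self hr
    have hM : 0 ≤ C * (pastSize ζ z t (h - r) + Z) := (abs_nonneg _).trans (hout r hr' (Sum.inr b))
    have hX : 0 ≤ 1 - S.mu i b * r ∧ 1 - S.mu i b * r ≤ 1 := by
      have := mul_le_mul_of_nonneg_left hr'.2 hpos.le
      have := mul_nonneg hpos.le hr'.1
      exact ⟨by linarith [hx.1], by linarith⟩
    have hbd : ∀ l, |K i (1 - S.mu i b * r) 1 (Sum.inr b) l * (S.vel i l * w i (t - h + r) 1 l)| ≤
        CK * |S.vel i l| * (C * (pastSize ζ z t (h - r) + Z)) := by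
      intro l
      rw [abs_mul, abs_mul, mul_assoc]
      refine mul_le_mul ?_ (mul_le_mul_of_nonneg_left (hout r hr' l) (abs_nonneg _))
        (by positivity) hCK0
      have := hCK (Sum.inr b, l) (1 - S.mu i b * r, 1)
      rwa [indicator_of_mem (show (1 - S.mu i b * r, (1 : ℝ)) ∈ upperTriangle from
        ⟨hX.1, hX.2, le_rfl⟩)] at this
    refine (Finset.abs_sum_le_sum_abs _ _).trans ((Finset.sum_le_sum fun l _ => hbd l).trans ?_)
    rw [← Finset.sum_mul, ← Finset.mul_sum, hD]
    exact le_of_eq (by ring)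
  have e2 : ∫ r in (0 : ℝ)..h, D * (pastSize ζ z t (h - r) + Z) =
      D * ((∫ ν in (0 : ℝ)..h, pastSize ζ z t ν) + h * Z) := by
    have cq' : Continuous fun r => pastSize ζ z t (h - r) :=
      (continuous_pastSize hζ hz t).comp (by fun_prop)
    rw [intervalIntegral.integral_const_mul,
      intervalIntegral.integral_add (cq'.intervalIntegrable _ _) (by simp),
      intervalIntegral.integral_comp_sub_left (fun ν => pastSize ζ z t ν)]
    simp
  have b3 : ∫ ν in (0 : ℝ)..h, pastSize ζ z t ν ≤ Z :=
    integral_pastSize_sub_le hζ hz le_rfl h0 (by linarith)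
  have b4 : h * Z ≤ η * Z := mul_le_mul_of_nonneg_right (by linarith) hZ0
  have b5 := mul_le_mul_of_nonneg_left (add_le_add b3 b4) hD0
  rw [e, e1]
  refine (abs_sub _ _).trans ((add_le_add b1 (b2.trans (e2.le.trans b5))).trans ?_)
  have b6 : 0 ≤ D * (1 + η) * pastSize ζ z t h :=
    mul_nonneg (by positivity) (pastSize_nonneg _ _ _ _)
  nlinarith

end HyperbolicChain

/-- The constant extension to negative times. -/
def extendPast {X : Type*} (ζ : ℝ → X) (s : ℝ) : X := ζ (max 0 s)

theorem extendPast_of_nonneg {X : Type*} (ζ : ℝ → X) {s : ℝ} (hs : 0 ≤ s) :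
    extendPast ζ s = ζ s := by rw [extendPast, max_eq_right hs]

theorem continuous_extendPast {X : Type*} [TopologicalSpace X] {ζ : ℝ → X}
    (h : ContinuousOn ζ (Ici 0)) : Continuous (extendPast ζ) :=
  h.comp_continuous (by fun_prop) fun _ => mem_Ici.2 (le_max_left _ _)

theorem windowNorm_extendPast {d : ℕ} {r t : ℝ} (ζ : ℝ → Fin d → ℝ) (ht : 0 ≤ t) (hr : r ≤ t) :
    windowNorm r (extendPast ζ) t = windowNorm r ζ t := by
  rw [windowNorm, windowNorm, intervalIntegral.integral_congr]
  intro θ hθ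
  have : 0 ≤ t + θ := by
    rcases le_total (-r) 0 with h | h
    · rw [uIcc_of_le h] at hθ; linarith [hθ.1]
    · rw [uIcc_of_ge h] at hθ; linarith [hθ.1]
  simp only [extendPast_of_nonneg ζ this]

theorem integral_absSum_sq_le {d : ℕ} {φ : ℝ → Fin d → ℝ} (hφ : Continuous φ) {η : ℝ}
    (hη : 0 ≤ η) (ε t : ℝ) :
    ∫ ν in (0 : ℝ)..η, absSum (φ (t + ε * ν)) ^ 2 ≤
      d * ∫ ν in (0 : ℝ)..η, ∑ l, φ (t + ε * ν) l ^ 2 := by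
  have c : Continuous fun ν => φ (t + ε * ν) := hφ.comp (by fun_prop)
  rw [← intervalIntegral.integral_const_mul]
  refine intervalIntegral.integral_mono_on hη
    (((continuous_absSum.comp c).pow 2).intervalIntegrable _ _)
    (Continuous.intervalIntegrable ?_ _ _) fun ν _ => absSum_sq_le _
  exact continuous_const.mul (continuous_finsetSum _ fun l _ =>
    ((continuous_apply l).comp c).pow 2)

/-! ### The input-to-state estimate -/

namespace HyperbolicChain

variable {S : HyperbolicChain}

/-- The rightward rows are controlled by the future window through the explicit cascade solution,
the leftward rows by the two past windows. -/
theorem exists_iss_constant {K : S.StateKernels} {F : S.DelayKernels} {i : ℕ} (hi : i + 1 < S.N)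
    (hK : S.IsStateKernel i (K i)) (hF : S.IsDelayKernel i (K i) (F i)) :
    ∃ κ, 0 < κ ∧ ∀ (U : ℝ → Fin (S.n 0) → ℝ) (w : S.State), S.IsSolution U w →
      ∀ ζ : ℝ → Fin (S.n i) → ℝ, ContinuousOn ζ (Ici 0) → ∀ s₀, 1 / S.lam1 i ≤ s₀ →
      (∀ s > s₀, alpha K F w i s 1 = ζ s) → ∀ t > s₀ + 1 / S.mu1 i,
      ISSEstimate K F w i ζ κ (1 / S.lam1 i + 1 / S.mu1 i) t := by
  have hiN : i < S.N := by omega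
  have hl1 := lam1_pos hiN
  have h1 : 0 < 1 / S.lam1 i := by positivity
  have hm1 : 0 < 1 / S.mu1 i := by have := mu1_pos hiN; positivity
  set η := 1 / S.lam1 i + 1 / S.mu1 i with hη
  have hη0 : 0 < η := by positivity
  obtain ⟨CG, -, hCG⟩ := exists_uniform_bound (ι := Fin (S.n i) × Fin (S.n i))
    (f := fun j x => S.G i (K i) (clamp 1 x) j.1 j.2) fun j => (hK.bddMeas_G hiN j.1 j.2).2
  obtain ⟨k, -, hkC, hrow⟩ := exists_cascade_kernel (S.lam_pos i hiN) (S.lam_mono i hiN)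
    (g := fun a b x => S.G i (K i) (clamp 1 x) a b) (fun a b => (hK.bddMeas_G hiN a b).1)
    fun a b x => hCG (a, b) x
  obtain ⟨Ca, hCa0, hCa⟩ := exists_cascade_abs_le (S.lam_pos i hiN) hkC
  obtain ⟨Cb, hCb0, hCb⟩ := exists_beta_bound hi hK hF
  set C := Ca + Cb with hC
  have hC0 : 0 ≤ C := by positivity
  -- The factor `2 C² (speed + η)` comes from `integral_sq_le_of_abs_le`; `2 (n + m)` pays for
  -- replacing the squared sum of absolute values by the sum of squares and for separating `ζ` from
  -- `z`.
  set κ₁ : S.Idx i → ℝ := fun j =>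
    2 * C ^ 2 * (|S.vel i j| + η) * (2 * (S.n i + S.m (i + 1))) with hκ₁
  have hκ₁0 : ∀ j, 0 ≤ κ₁ j := fun j => by positivity
  -- The summand `1` only secures positivity.
  refine ⟨1 + ∑ j, κ₁ j, by have := Finset.sum_nonneg fun j (_ : j ∈ Finset.univ) => hκ₁0 j
                            linarith, ?_⟩
  intro U w hw ζ hζ s₀ hs₀ hα t ht
  have ht0 : 0 ≤ t := by linarith
  have hηt : η ≤ t := by linarith
  have hmem := memLp_target hw hi hK hF (t := t) (by linarith)
  refine ⟨hmem, ?_⟩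
  have hsq : ∀ j, IntervalIntegrable (fun x => target K F w i t x j ^ 2) volume 0 1 := fun j => by
    rw [intervalIntegrable_iff_integrableOn_Icc_of_le zero_le_one]
    exact (hmem j).integrable_sq
  set ζ' := extendPast ζ with hζ'
  set z : ℝ → Fin (S.m (i + 1)) → ℝ := fun s => v w (i + 1) s 0 with hz
  set z' := extendPast z with hz'
  have cζ : Continuous ζ' := continuous_extendPast hζ
  have cz : Continuous z' :=
    continuous_extendPast (hw.continuousOn_v hi (x := 0) ⟨le_rfl, zero_le_one⟩)
  have hα' : ∀ s > s₀, alpha K F w i s 1 = ζ' s := fun s hs => by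
    rw [hα s hs, hζ', extendPast_of_nonneg ζ (by linarith)]
  rw [← windowNorm_extendPast ζ ht0 hηt, ← windowNorm_extendPast ζ ht0 (r := -η) (by linarith),
    ← windowNorm_extendPast z ht0 hηt, ← hζ', ← hz', windowNorm_sq_past hη0.le,
    windowNorm_sq_future hη0.le, windowNorm_sq_past hη0.le]
  set W₁ := ∫ ν in (0 : ℝ)..η, ∑ l, ζ' (t - ν) l ^ 2 with hW₁
  set W₂ := ∫ ν in (0 : ℝ)..η, ∑ l, ζ' (t + ν) l ^ 2 with hW₂
  set W₃ := ∫ ν in (0 : ℝ)..η, ∑ l, z' (t - ν) l ^ 2 with hW₃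
  have hW₁0 : 0 ≤ W₁ := intervalIntegral.integral_nonneg hη0.le fun _ _ =>
    Finset.sum_nonneg fun _ _ => sq_nonneg _
  have hW₂0 : 0 ≤ W₂ := intervalIntegral.integral_nonneg hη0.le fun _ _ =>
    Finset.sum_nonneg fun _ _ => sq_nonneg _
  have hW₃0 : 0 ≤ W₃ := intervalIntegral.integral_nonneg hη0.le fun _ _ =>
    Finset.sum_nonneg fun _ _ => sq_nonneg _
  have hn0 : (0 : ℝ) ≤ S.n i := by positivity
  have hm0 : (0 : ℝ) ≤ S.m (i + 1) := by positivity
  have key : ∀ j, ∫ x in (0 : ℝ)..1, target K F w i t x j ^ 2 ≤ κ₁ j * (W₁ + W₂ + W₃) := by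
    intro j
    have fin : ∀ I : ℝ, I ≤ 2 * (S.n i + S.m (i + 1)) * (W₁ + W₂ + W₃) →
        2 * C ^ 2 * (|S.vel i j| + η) * I ≤ κ₁ j * (W₁ + W₂ + W₃) := fun I hI => by
      rw [hκ₁]
      calc _ ≤ 2 * C ^ 2 * (|S.vel i j| + η) *
            (2 * (S.n i + S.m (i + 1)) * (W₁ + W₂ + W₃)) :=
          mul_le_mul_of_nonneg_left hI (by positivity)
        _ = _ := by ring
    rcases j with a | b
    · have hpos := S.lam_pos i hiN a
      have hvel : |S.vel i (Sum.inl a)| = S.lam i a := abs_of_pos hpos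
      have hla : 1 / S.lam i a ≤ η :=
        (one_div_le_one_div_of_le hl1 (lam1_le hiN a)).trans (by linarith)
      have cq : Continuous fun ν => absSum (ζ' (t + ν)) :=
        continuous_absSum.comp (cζ.comp (by fun_prop))
      have ecas := (alpha_cascadeTransport hw hi hK hF).eq_of_outflow hl1 (lam1_le hiN) hrow cζ hs₀
        (fun s hs j => congrFun (hα' s hs) j) a t (by linarith)
      refine (integral_sq_le_of_abs_le (q := fun ν => absSum (ζ' (t + ν))) (C := C)
        cq hpos hla (hsq _) fun x hx => ?_).trans ?_
      · have e := ecas x hx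
        rw [alpha] at e
        rw [e]
        refine (hCa ζ' cζ a t η hla x hx).trans (mul_le_mul_of_nonneg_right (by linarith) ?_)
        exact add_nonneg (absSum_nonneg _)
          (intervalIntegral.integral_nonneg hη0.le fun _ _ => absSum_nonneg _)
      · rw [← hvel]
        refine fin _ ?_
        have := integral_absSum_sq_le cζ hη0.le 1 t
        simp only [one_mul] at this
        refine this.trans ?_
        rw [← hW₂]
        nlinarith [mul_nonneg hn0 hW₁0, mul_nonneg hn0 hW₂0, mul_nonneg hn0 hW₃0,
          mul_nonneg hm0 hW₁0, mul_nonneg hm0 hW₂0, mul_nonneg hm0 hW₃0]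
    · have hpos := S.mu_pos i hiN b
      have hvel : |S.vel i (Sum.inr b)| = S.mu i b := by
        simp only [vel, Sum.elim_inr, abs_neg]; exact abs_of_pos hpos
      have hmb : 1 / S.mu i b ≤ η :=
        (one_div_le_one_div_of_le (mu1_pos hiN) (mu1_le hiN b)).trans (by linarith)
      refine (integral_sq_le_of_abs_le (q := pastSize ζ' z' t) (C := C)
        (continuous_pastSize cζ cz t) hpos hmb (hsq _) fun x hx => ?_).trans ?_
      · refine (hCb U w hw ζ' z' cζ cz (fun s hs => extendPast_of_nonneg z hs) s₀ hs₀ hα' t ht b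
          x hx).trans (mul_le_mul_of_nonneg_right (by linarith) ?_)
        exact add_nonneg (pastSize_nonneg _ _ _ _)
          (intervalIntegral.integral_nonneg hη0.le fun _ _ => pastSize_nonneg _ _ _ _)
      · rw [← hvel]
        refine fin _ ?_
        have c1 : Continuous fun ν => absSum (ζ' (t - ν)) ^ 2 :=
          (continuous_absSum.comp (cζ.comp (by fun_prop))).pow 2
        have c2 : Continuous fun ν => absSum (z' (t - ν)) ^ 2 :=
          (continuous_absSum.comp (cz.comp (by fun_prop))).pow 2
        have i1 := integral_absSum_sq_le cζ hη0.le (-1) t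
        have i2 := integral_absSum_sq_le cz hη0.le (-1) t
        simp only [neg_mul, one_mul, ← sub_eq_add_neg] at i1 i2
        have i3 : ∫ ν in (0 : ℝ)..η, pastSize ζ' z' t ν ^ 2 ≤ ∫ ν in (0 : ℝ)..η,
            (2 * absSum (ζ' (t - ν)) ^ 2 + 2 * absSum (z' (t - ν)) ^ 2) := by
          refine intervalIntegral.integral_mono_on hη0.le
            (((continuous_pastSize cζ cz t).pow 2).intervalIntegrable _ _)
            (((c1.const_mul 2).add (c2.const_mul 2)).intervalIntegrable _ _) fun ν _ => ?_
          rw [pastSize]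
          nlinarith [sq_nonneg (absSum (ζ' (t - ν)) - absSum (z' (t - ν)))]
        rw [intervalIntegral.integral_add ((c1.const_mul 2).intervalIntegrable _ _)
          ((c2.const_mul 2).intervalIntegrable _ _), intervalIntegral.integral_const_mul,
          intervalIntegral.integral_const_mul] at i3
        rw [← hW₁] at i1
        rw [← hW₃] at i2
        nlinarith [mul_nonneg hn0 hW₁0, mul_nonneg hn0 hW₂0, mul_nonneg hn0 hW₃0,
          mul_nonneg hm0 hW₁0, mul_nonneg hm0 hW₂0, mul_nonneg hm0 hW₃0]
  rw [l2NormSq]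
  refine (Finset.sum_le_sum fun j _ => key j).trans ?_
  rw [← Finset.sum_mul]
  exact mul_le_mul_of_nonneg_right (by linarith) (by positivity)

/-! ### The effect of the tracking law at the inlet -/

theorem delay_nonneg {i : ℕ} (hi : i < S.N) : 0 ≤ S.delay i :=
  Finset.sum_nonneg fun j hj => by
    have := lam1_pos (S := S) (i := j) (by have := Finset.mem_range.1 hj; omega)
    positivity

/-- At `x = 1` the upstream `α` differs from `u` only by its delayed integral; subtracting the
corresponding term recovers the physical inflow. For the first subsystem both the delay and the
correction are zero. -/
theorem inflow_eq_virtualInput_sub {K : S.StateKernels} {F : S.DelayKernels}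
    {U : ℝ → Fin (S.n 0) → ℝ} {w : S.State} {i : ℕ} (hi : i < S.N) (t : ℝ)
    {p : ℝ → Fin (S.m i) → ℝ}
    (hp : ∀ y ∈ Icc 0 (S.memory i), p (t - y) = v w i (t - y + S.delay i) 0) :
    S.inflow U w i (t + S.delay i) = virtualInput K F U w i t - delayedTerm F i p t := by
  cases i with
  | zero => simp [inflow, virtualInput, delayedTerm, delay]
  | succ k =>
    have h1 : 0 ≤ 1 / S.lam1 k := by
      have := lam1_pos (S := S) (i := k) (by omega)
      positivity
    simp only [inflow, virtualInput, delayedTerm]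
    rw [← Matrix.mulVec_sub]
    congr 1
    funext a
    rw [Pi.sub_apply, alpha, target_inl, volterra, intervalIntegral.integral_same, delayPart,
      add_zero, eq_sub_iff_add_eq]
    rw [u]
    congr 1
    refine intervalIntegral.integral_congr fun y hy => ?_
    rw [uIcc_of_le h1] at hy
    rw [hp y hy, show t + S.delay (k + 1) - y = t - y + S.delay (k + 1) by ring]

/-- With exact predictions, the correction terms of the law cancel the reflection `Q v`, the
Volterra integral at `x = 0` and the upstream delayed term; the delayed part of `α` is empty at `x =
0`. -/
theorem alpha_zero_eq_feedforward {K : S.StateKernels} {F : S.DelayKernels}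
    {U : ℝ → Fin (S.n 0) → ℝ} {w : S.State} (hw : S.IsSolution U w) {i : ℕ} (hi : i < S.N)
    {g : ℝ → Matrix (Fin (S.n i)) (Fin (S.n i)) ℝ} {ζ : ℝ → Fin (S.n i) → ℝ} {t₀ : ℝ}
    (ht₀ : 0 < t₀) {Pu : ℝ → ℝ → Fin (S.n i) → ℝ} {Pv : ℝ → ℝ → Fin (S.m i) → ℝ}
    (hP : ExactPredictors w i t₀ Pu Pv) {t : ℝ} (ht : t₀ < t)
    (hU : virtualInput K F U w i t = trackingLaw K F i g ζ Pu Pv t) :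
    alpha K F w i (t + S.delay i) 0 = S.feedforward i g ζ t := by
  have hD := delay_nonneg hi
  obtain ⟨hx, hy⟩ := hP t ht
  have e := hw.left_bc i hi (t + S.delay i) (by linarith)
  rw [inflow_eq_virtualInput_sub (K := K) (F := F) hi t (p := fun s => Pv s 0) hy, hU,
    trackingLaw, (hx 0 ⟨le_rfl, zero_le_one⟩).2] at e
  funext a
  have ea := congrFun e a
  simp only [Pi.add_apply, Pi.sub_apply] at ea
  have eint : ∫ y in (0 : ℝ)..1, ((K i 0 y).mulVec (Sum.elim (Pu t y) (Pv t y))) (Sum.inl a) =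
      ∫ y in (0 : ℝ)..1, ((K i 0 y).mulVec (w i (t + S.delay i) y)) (Sum.inl a) := by
    refine intervalIntegral.integral_congr fun y hy => ?_
    rw [uIcc_of_le zero_le_one] at hy
    rw [(hx y hy).1, (hx y hy).2]
    congr 2
    funext j
    rcases j with j | j <;> rfl
  rw [eint] at ea
  rw [alpha, target_inl, volterra, delayPart, zero_div, intervalIntegral.integral_same, add_zero]
  rw [u] at ea
  linarith

theorem feedforward_eq_cascade {i : ℕ} (hi : i < S.N)
    (k : Fin (S.n i) → Fin (S.n i) → ℝ → ℝ → ℝ) (ζ : ℝ → Fin (S.n i) → ℝ) {t : ℝ} (ht : 0 ≤ t)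
    (j : Fin (S.n i)) :
    S.feedforward i (fun ν => Matrix.of fun j l => k j l 0 ν) ζ t j =
      cascade (S.lam i) k (extendPast ζ) j (t + S.delay i) 0 := by
  have hD := delay_nonneg hi
  have hl : 0 ≤ 1 / S.lam i j := by have := S.lam_pos i hi j; positivity
  rw [feedforward, cascade, sub_zero, extendPast_of_nonneg ζ (by positivity)]
  congr 1
  refine Finset.sum_congr rfl fun l _ => intervalIntegral.integral_congr fun ν hν => ?_
  rw [uIcc_of_le hl] at hν
  have : 0 ≤ t + S.delay i + ν := by linarith [hν.1]
  simp only [Matrix.of_apply, extendPast_of_nonneg ζ this]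

end HyperbolicChain

end

/-! ### The tracking theorem -/

theorem mainTheorem4 (S : HyperbolicChain) (K : S.StateKernels) (F : S.DelayKernels)
    (hK : ∀ k, k + 1 < S.N → S.IsStateKernel k (K k))
    (hF : ∀ k, k + 1 < S.N → S.IsDelayKernel k (K k) (F k))
    (i : ℕ) (hi : i + 1 < S.N) :
    ∃ (κ η : ℝ) (g : ℝ → Matrix (Fin (S.n i)) (Fin (S.n i)) ℝ),
      0 < κ ∧ 0 < η ∧ η ≤ 1 / S.lam1 i + 1 / S.mu1 i ∧
      (∀ j l, Measurable (fun ν => g ν j l) ∧ ∃ C, ∀ ν, |g ν j l| ≤ C) ∧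
      ∀ (t₀ : ℝ), 0 < t₀ →
      ∀ (U : ℝ → Fin (S.n 0) → ℝ) (w : S.State), S.IsSolution U w →
      ∀ (ζ : ℝ → Fin (S.n i) → ℝ), ContinuousOn ζ (Set.Ici 0) →
        ((∀ t > t₀ + 1 / S.lam1 i, HyperbolicChain.alpha K F w i t 1 = ζ t) →
          ∀ t > t₀ + 1 / S.lam1 i + 1 / S.mu1 i,
            HyperbolicChain.ISSEstimate K F w i ζ κ η t) ∧
        (∀ (Pu : ℝ → ℝ → Fin (S.n i) → ℝ) (Pv : ℝ → ℝ → Fin (S.m i) → ℝ),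
          HyperbolicChain.ExactPredictors w i t₀ Pu Pv →
          (∀ t > t₀, HyperbolicChain.virtualInput K F U w i t =
            HyperbolicChain.trackingLaw K F i g ζ Pu Pv t) →
          (∀ t > t₀ + S.delay i + 1 / S.lam1 i,
            HyperbolicChain.alpha K F w i t 1 = ζ t) ∧
          ∀ t > t₀ + S.delay i + 1 / S.lam1 i + 1 / S.mu1 i,
            HyperbolicChain.ISSEstimate K F w i ζ κ η t) := by
  have hiN : i < S.N := by omega
  have hl1 := HyperbolicChain.lam1_pos hiN
  have h1 : 0 < 1 / S.lam1 i := by positivity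
  have hm1 : 0 < 1 / S.mu1 i := by have := HyperbolicChain.mu1_pos hiN; positivity
  have hKi := hK i hi
  have hFi := hF i hi
  have hD := HyperbolicChain.delay_nonneg hiN
  obtain ⟨CG, -, hCG⟩ := exists_uniform_bound (ι := Fin (S.n i) × Fin (S.n i))
    (f := fun j x => S.G i (K i) (clamp 1 x) j.1 j.2) fun j => (hKi.bddMeas_G hiN j.1 j.2).2
  obtain ⟨k, hk, hkC, hrow⟩ := exists_cascade_kernel (S.lam_pos i hiN) (S.lam_mono i hiN)
    (g := fun a b x => S.G i (K i) (clamp 1 x) a b) (fun a b => (hKi.bddMeas_G hiN a b).1)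
    fun a b x => hCG (a, b) x
  obtain ⟨κ, hκ, hiss⟩ := HyperbolicChain.exists_iss_constant (K := K) (F := F) hi hKi hFi
  -- The feedforward matrix is the trace at `x = 0` of the cascade kernel, so that the feedforward
  -- is the inlet value of the solution with outflow `ζ`.
  refine ⟨κ, 1 / S.lam1 i + 1 / S.mu1 i, fun ν => Matrix.of fun j l => k j l 0 ν, hκ,
    by positivity, le_rfl, fun j l => ⟨measurable_section (hk j l) measurable_const measurable_id,
      (hkC j l).imp fun C hC ν => hC 0 ν⟩, ?_⟩
  intro t₀ ht₀ U w hw ζ hζ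
  refine ⟨fun hα t ht => hiss U w hw ζ hζ _ (by linarith) hα t ht, fun Pu Pv hP hU => ?_⟩
  have hα : ∀ t > t₀ + S.delay i + 1 / S.lam1 i, HyperbolicChain.alpha K F w i t 1 = ζ t := by
    intro t ht
    funext j
    -- The inlet identity holds for times after `t₀ + D_i`; the slowest row needs a further
    -- `1/λ_i^1` to carry it to `x = 1`.
    have hcas := (HyperbolicChain.alpha_cascadeTransport hw hi hKi hFi).eq_of_inflow hl1
      (HyperbolicChain.lam1_le hiN) hrow (continuous_extendPast hζ) (s := t₀ + S.delay i)
      (by positivity) (fun s hs j => by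
        have e := HyperbolicChain.alpha_zero_eq_feedforward hw hiN ht₀ hP
          (t := s - S.delay i) (by linarith) (hU _ (by linarith))
        have e' := HyperbolicChain.feedforward_eq_cascade hiN k ζ (t := s - S.delay i)
          (by linarith) j
        rw [sub_add_cancel] at e e'
        rw [e, e']) j t 1 ⟨zero_le_one, le_rfl⟩ (by linarith)
    -- At `x = 1` the look-ahead windows are empty, and the cascade solution reduces to `ζ`.
    rw [hcas, cascade, sub_self, zero_div, add_zero, extendPast_of_nonneg ζ (by linarith)]
    simp
  exact ⟨hα, fun t ht => hiss U w hw ζ hζ _ (by linarith) hα t ht⟩
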